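/- Let $d\ge 1$. A finite simplicial complex $K$ in $\mathbb R^d$ is a nonempty finite abstract simplicial complex together with an injective map of its vertices to points of $\mathbb R^d$. It is \emph{embedded} if, for any two simplices $\sigma,\tau\in K$, the convex hulls of $\sigma$ and $\tau$ intersect either in the empty set or in the convex hull of a common face. Let $|K|$ be the number of (nonempty) simplices of $K$, $n_0$ the number of its vertices, $\kappa$ its dimension, $K_i$ its $i$-skeleton (the set of simplices of dimension at most $i$, so $K_{-1}=\emptyset$) and $|K_i|$ the number of simplices of $K_i$. For a simplex $\sigma\in K$ and a unit vector $s$ perpendicular to $\sigma$, an \emph{indegree query} $(\sigma,s)$ returns the number of simplices $\sigma\cup\{v\}\in K$ with $v\notin\sigma$ and $s\cdot v\le s\cdot\sigma$; let $I\ge 0$ be the time that a query takes. A \emph{candidate vertex} of an $i$-simplex $\sigma\in K$ is a vertex $v\notin\sigma$ of $K$ such that all proper faces of $\sigma\cup\{v\}$ are in $K_i$ and $K_i\cup\{\sigma\cup\{v\}\}$ is a subcomplex of some embedded simplicial complex in $\mathbb R^d$. As soon as all of $K_i$ has been reconstructed, the candidate vertices of each $i$-simplex are available to an algorithm (written out as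 a $0/1$-vector of length $n_0$ in time $O(i+n_0)$). Algorithms run on a real RAM: exact real arithmetic ($+,-,\times,/,\sqrt{\ }$), addition, subtraction and halving of natural numbers, comparisons and memory accesses take unit time. \textbf{Theorem.} There is a single algorithm on this machine that, for every $d\ge1$ and every nonempty finite embedded simplicial complex $K$ in $\mathbb R^d$, given $d$, $n_0$ and the coordinates of the vertices of $K$ (in any order), reconstructs $K$ using $O(|K|\log n_0)$ indegree queries and $$O\bigl(|K|(n_0d+n_0\log n_0+I\log n_0)+|K_{\kappa-1}|\,d^3\bigr)$$ time. The constants hidden in the $O$-notation are absolute: they depend on none of $K$, $n_0$, $d$, $\kappa$, $I$. -/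

import Mathlib

/-! ### Simplicial complexes in Euclidean space -/

/-- A finite simplicial complex in `ℝ^d` with vertex set `V`: an abstract simplicial complex
(a family of nonempty finite sets of vertices, closed under nonempty subsets and containing every
vertex) together with an injective map of the vertices to points of `ℝ^d`. Nothing else is required
of the way the complex lies in `ℝ^d`. -/
structure ComplexIn (V : Type) (d : ℕ) where
  faces : Finset (Finset V)
  pos : V ↪ EuclideanSpace ℝ (Fin d)
  nonempty_of_mem : ∀ σ ∈ faces, σ.Nonempty
  down_closed : ∀ σ ∈ faces, ∀ ρ ⊆ σ, ρ.Nonempty → ρ ∈ faces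
  vertex_mem : ∀ v, {v} ∈ faces

namespace ComplexIn

variable {V : Type} {d : ℕ}

/-- The convex hull of (the points of) a simplex. -/
def hull (K : ComplexIn V d) (σ : Finset V) : Set (EuclideanSpace ℝ (Fin d)) :=
  convexHull ℝ (K.pos '' (σ : Set V))

/-- Two simplices form an injective pair if their convex hulls meet in the empty set or in the
convex hull of a common face. -/
def InjectivePair (K : ComplexIn V d) (σ τ : Finset V) : Prop :=
  K.hull σ ∩ K.hull τ = ∅ ∨
    ∃ ρ ∈ K.faces, ρ ⊆ σ ∧ ρ ⊆ τ ∧ K.hull σ ∩ K.hull τ = K.hull ρ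

/-- A complex is embedded if all pairs of its simplices are injective pairs. -/
def Embedded (K : ComplexIn V d) : Prop :=
  ∀ σ ∈ K.faces, ∀ τ ∈ K.faces, K.InjectivePair σ τ

/-- The dimension of the complex, the largest dimension `σ.card - 1` of a simplex. -/
def dim (K : ComplexIn V d) : ℕ := K.faces.sup fun σ => σ.card - 1

/-- The `i`-skeleton: all simplices of dimension at most `i` (empty for `i = -1`). -/
def skeleton (K : ComplexIn V d) (i : ℤ) : Finset (Finset V) :=
  K.faces.filter fun σ => (σ.card : ℤ) - 1 ≤ i

/-- `s` is a direction (a unit vector) perpendicular to the simplex `σ`. -/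
def PerpDirection (K : ComplexIn V d) (σ : Finset V) (s : EuclideanSpace ℝ (Fin d)) : Prop :=
  ‖s‖ = 1 ∧ ∀ u ∈ σ, ∀ v ∈ σ, inner ℝ s (K.pos u) = inner ℝ s (K.pos v)

open Classical in
/-- The indegree of `σ` in direction `s`: the number of cofacets of `σ` in the complex that have no
vertex higher than `σ` with respect to `s`. -/
noncomputable def indegree (K : ComplexIn V d) (σ : Finset V) (s : EuclideanSpace ℝ (Fin d)) : ℕ :=
  (K.faces.filter fun τ => σ ⊆ τ ∧ τ.card = σ.card + 1 ∧
    ∀ v ∈ τ, ∀ u ∈ σ, inner ℝ s (K.pos v) ≤ inner ℝ s (K.pos u)).card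

/-- `v` is a candidate vertex of the `i`-simplex `σ`, for the property of being embedded: all proper
faces of `σ ∪ {v}` lie in the `i`-skeleton `K_i`, and `K_i` together with `σ ∪ {v}` is a subcomplex
of some embedded simplicial complex `L` in `ℝ^d` (on any vertex set). This depends on `K_i` only. -/
def IsCandidate [DecidableEq V] (K : ComplexIn V d) (σ : Finset V) (v : V) : Prop :=
  v ∉ σ ∧
  (∀ ρ, ρ ⊂ insert v σ → ρ.Nonempty → ρ ∈ K.skeleton ((σ.card : ℤ) - 1)) ∧
  ∃ (W : Type) (L : ComplexIn W d) (f : V ↪ W), L.Embedded ∧ (∀ u, L.pos (f u) = K.pos u) ∧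
    (∀ ρ ∈ K.skeleton ((σ.card : ℤ) - 1), ρ.map f ∈ L.faces) ∧ (insert v σ).map f ∈ L.faces

end ComplexIn

/-! ### A real RAM with an indegree oracle

Programs are finite texts over natural-number and real variables and random-access memory. All
arithmetic operations, tests and memory accesses on numbers have unit cost. Real arithmetic is exact;
there is no conversion between reals and natural numbers and no multiplication of natural numbers,
and the constants that a program may contain are integers. A memory cell is addressed by a block
(an array) and an offset in it. -/

namespace RealRAM

/-- Natural-number expressions. -/
inductive NatExp : Type
  | lit (k : ℕ)
  | var (x : ℕ)
  | load (block offset : NatExp)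
  | add (a b : NatExp)
  | sub (a b : NatExp)
  | half (a : NatExp)

/-- Real expressions. -/
inductive RealExp : Type
  | lit (k : ℤ)
  | var (x : ℕ)
  | load (block offset : NatExp)
  | add (a b : RealExp)
  | sub (a b : RealExp)
  | mul (a b : RealExp)
  | div (a b : RealExp)
  | sqrt (a : RealExp)

/-- Tests. -/
inductive Test : Type
  | natLe (a b : NatExp)
  | realLe (a b : RealExp)
  | not (t : Test)
  | and (t u : Test)

/-- Programs. -/
inductive Prog : Type
  | skip
  | setNat (x : ℕ) (e : NatExp)
  | setReal (x : ℕ) (e : RealExp)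
  | storeNat (block offset e : NatExp)
  | storeReal (block offset : NatExp) (e : RealExp)
  | seq (p q : Prog)
  | ite (t : Test) (p q : Prog)
  | loop (t : Test) (p : Prog)
  /-- Query the indegree of the simplex listed in the first `len` cells of a natural-number block, in
  the direction stored in the first `d` cells of a real block; put the answer into the variable `x`. -/
  | indeg (x : ℕ) (block len dir : NatExp)
  /-- Look up the candidate vertices of the listed simplex; write the 0/1-indicator of the set of
  candidates into the first `n` cells of the block `dest`. -/
  | cand (block len dest : NatExp)
  /-- Report the listed simplex as a simplex of the complex. -/
  | report (block len : NatExp)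

/-- Machine states; the vertices have the names `0, …, n - 1`, and `found` is the set of simplices
reported so far (the output of the program). -/
structure State (n : ℕ) where
  natVar : ℕ → ℕ
  realVar : ℕ → ℝ
  natMem : ℕ → ℕ → ℕ
  realMem : ℕ → ℕ → ℝ
  found : Finset (Finset (Fin n))

variable {n d : ℕ}

def NatExp.eval (s : State n) : NatExp → ℕ
  | lit k => k
  | var x => s.natVar x
  | load b o => s.natMem (b.eval s) (o.eval s)
  | add a b => a.eval s + b.eval s
  | sub a b => a.eval s - b.eval s
  | half a => a.eval s / 2

noncomputable def RealExp.eval (s : State n) : RealExp → ℝ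
  | lit k => (k : ℝ)
  | var x => s.realVar x
  | load b o => s.realMem (b.eval s) (o.eval s)
  | add a b => a.eval s + b.eval s
  | sub a b => a.eval s - b.eval s
  | mul a b => a.eval s * b.eval s
  | div a b => a.eval s / b.eval s
  | sqrt a => Real.sqrt (a.eval s)

def Test.Holds (s : State n) : Test → Prop
  | natLe a b => a.eval s ≤ b.eval s
  | realLe a b => a.eval s ≤ b.eval s
  | not t => ¬ t.Holds s
  | and t u => t.Holds s ∧ u.Holds s

/-- The number of operations in an expression, which is the time to evaluate it. -/
def NatExp.cost : NatExp → ℕ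
  | lit _ => 1
  | var _ => 1
  | load b o => b.cost + o.cost + 1
  | add a b => a.cost + b.cost + 1
  | sub a b => a.cost + b.cost + 1
  | half a => a.cost + 1

/-- The number of operations in an expression, which is the time to evaluate it. -/
def RealExp.cost : RealExp → ℕ
  | lit _ => 1
  | var _ => 1
  | load b o => b.cost + o.cost + 1
  | add a b => a.cost + b.cost + 1
  | sub a b => a.cost + b.cost + 1
  | mul a b => a.cost + b.cost + 1
  | div a b => a.cost + b.cost + 1
  | sqrt a => a.cost + 1

/-- The number of operations in an expression, which is the time to evaluate it. -/
def Test.cost : Test → ℕ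
  | natLe a b => a.cost + b.cost + 1
  | realLe a b => a.cost + b.cost + 1
  | not t => t.cost + 1
  | and t u => t.cost + u.cost + 1

/-- The simplex `σ` is listed in the first `len` cells of the block `b`. -/
def State.Lists (s : State n) (b len : ℕ) (σ : Finset (Fin n)) : Prop :=
  σ.image Fin.val = (Finset.range len).image (s.natMem b)

/-- The vector stored in the first `d` cells of the real block `b`. -/
noncomputable def State.vector (s : State n) (d b : ℕ) : EuclideanSpace ℝ (Fin d) :=
  WithLp.toLp 2 fun j : Fin d => s.realMem b j

def State.setNatVar (s : State n) (x v : ℕ) : State n :=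
  { s with natVar := Function.update s.natVar x v }

def State.setRealVar (s : State n) (x : ℕ) (v : ℝ) : State n :=
  { s with realVar := Function.update s.realVar x v }

def State.setNatCell (s : State n) (b o v : ℕ) : State n :=
  { s with natMem := Function.update s.natMem b (Function.update (s.natMem b) o v) }

def State.setRealCell (s : State n) (b o : ℕ) (v : ℝ) : State n :=
  { s with realMem := Function.update s.realMem b (Function.update (s.realMem b) o v) }

open Classical in
/-- Write the indicator of a set of vertices into the first `n` cells of the block `b`. -/
noncomputable def State.writeSet (s : State n) (b : ℕ) (S : Set (Fin n)) : State n :=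
  { s with natMem := Function.update s.natMem b fun k =>
      if h : k < n then (if (⟨k, h⟩ : Fin n) ∈ S then 1 else 0) else s.natMem b k }

/-- `Exec K p s s' t q`: run on the hidden complex `K`, the program `p` leads from the state `s` to
the state `s'`, with `t` elementary steps (not counting the time that the oracle needs to answer)
and `q` indegree queries. The complex `K` is accessible only through the two commands `indeg`
and `cand`. A program that issues an illegal command has no execution. Legal indegree queries
concern a simplex of `K` and a direction perpendicular to it; the candidates of an `i`-simplex
may be looked up only once the `i`-skeleton has been correctly reported. -/
inductive Exec (K : ComplexIn (Fin n) d) : Prog → State n → State n → ℕ → ℕ → Prop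
  | skip (s) : Exec K .skip s s 1 0
  | setNat (s x e) : Exec K (.setNat x e) s (s.setNatVar x (e.eval s)) (e.cost + 1) 0
  | setReal (s x e) : Exec K (.setReal x e) s (s.setRealVar x (e.eval s)) (e.cost + 1) 0
  | storeNat (s b o e) :
      Exec K (.storeNat b o e) s (s.setNatCell (b.eval s) (o.eval s) (e.eval s))
        (b.cost + o.cost + e.cost + 1) 0
  | storeReal (s b o e) :
      Exec K (.storeReal b o e) s (s.setRealCell (b.eval s) (o.eval s) (e.eval s))
        (b.cost + o.cost + e.cost + 1) 0
  | seq {p₁ p₂ s₁ s₂ s₃ t₁ t₂ q₁ q₂} : Exec K p₁ s₁ s₂ t₁ q₁ → Exec K p₂ s₂ s₃ t₂ q₂ →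
      Exec K (.seq p₁ p₂) s₁ s₃ (t₁ + t₂) (q₁ + q₂)
  | iteTrue {c p₁ p₂ s s' t q} : c.Holds s → Exec K p₁ s s' t q →
      Exec K (.ite c p₁ p₂) s s' (c.cost + 1 + t) q
  | iteFalse {c p₁ p₂ s s' t q} : ¬ c.Holds s → Exec K p₂ s s' t q →
      Exec K (.ite c p₁ p₂) s s' (c.cost + 1 + t) q
  | loopDone {c p s} : ¬ c.Holds s → Exec K (.loop c p) s s (c.cost + 1) 0
  | loopStep {c p s₁ s₂ s₃ t₁ t₂ q₁ q₂} : c.Holds s₁ → Exec K p s₁ s₂ t₁ q₁ →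
      Exec K (.loop c p) s₂ s₃ t₂ q₂ →
      Exec K (.loop c p) s₁ s₃ (c.cost + 1 + t₁ + t₂) (q₁ + q₂)
  | indeg (s x b l r) (σ : Finset (Fin n)) : s.Lists (b.eval s) (l.eval s) σ → σ ∈ K.faces →
      K.PerpDirection σ (s.vector d (r.eval s)) →
      Exec K (.indeg x b l r) s (s.setNatVar x (K.indegree σ (s.vector d (r.eval s))))
        (b.cost + l.cost + r.cost + 1) 1
  | cand (s b l t) (σ : Finset (Fin n)) : s.Lists (b.eval s) (l.eval s) σ → σ ∈ K.faces →
      s.found.filter (fun ρ => ρ.card ≤ σ.card) = K.faces.filter (fun ρ => ρ.card ≤ σ.card) →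
      Exec K (.cand b l t) s (s.writeSet (t.eval s) {v | K.IsCandidate σ v})
        (b.cost + l.cost + t.cost + l.eval s + n + 1) 0
  | report (s b l) (σ : Finset (Fin n)) : s.Lists (b.eval s) (l.eval s) σ →
      Exec K (.report b l) s { s with found := insert σ s.found }
        (b.cost + l.cost + l.eval s + 1) 0

/-- The initial state: the number `n` of vertices and the dimension `d` are in the natural-number
variables `0` and `1`, the coordinates of vertex `v` are in the first `d` cells of the real
block `v`, the vertices count as reported, and everything else is zero. -/
noncomputable def start (pos : Fin n → EuclideanSpace ℝ (Fin d)) : State n where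
  natVar x := if x = 0 then n else if x = 1 then d else 0
  realVar _ := 0
  natMem _ _ := 0
  realMem v j := if h : v < n ∧ j < d then pos ⟨v, h.1⟩ ⟨j, h.2⟩ else 0
  found := Finset.univ.image fun v => {v}

end RealRAM

/-! The complex is grown breadth first, starting from the empty simplex. When the turn of a simplex
`σ` comes, all faces of at most its dimension are known, so its candidates may be looked up; what
remains is to find the cofacets of `σ` that are not yet known.

Sweep. Suppose that `f` and `t` are affine functionals vanishing on `σ`, that `f` is positive on
every `w` for which `σ ∪ {w}` is an unknown simplex, and that the slopes `t / f` are distinct on the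
candidates with `f > 0`. For each `c`, the functional `t - c f` vanishes on `σ`, so its normalised
linear part is a legal direction (unless it is constant), and on those candidates it is nonpositive
exactly at the slopes up to `c`. An indegree query, minus the known cofacets on that side, therefore
counts the unknown cofacets up to slope `c`: a hyperplane rotates about `σ`. Binary search in the
sorted slopes finds each of them with at most `⌈log₂ n⌉` queries (`wp_findChild`).

Why `f` exists. The simplex `σ ∪ {w}` found in this sweep receives the functional `t - (t w / f w)
f`. It vanishes on `σ ∪ {w}` and is positive on all candidates that come later in the sweep, in
particular on the last vertices of all later siblings. An unknown cofacet of a simplex must come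
from such a later sibling, because otherwise one of its facets would have been processed already and
would have revealed it (`Reals.pos_of_unknown`).

Why `t` exists. In an embedded complex two different candidates of `σ` cannot lie on the same ray
modulo the affine hull of `σ` (`IsCandidate.separated`). Every expanded simplex carries functionals
`B 0, B 1, …` which, together with `f`, separate points modulo this hull (`Spans`). So the vectors
`(B j w / f w)_j` of the candidates are pairwise different (`Spans.exists_ne`), and `t = ∑ ε ^ j B
j` orders them lexicographically as soon as `ε` is small enough (`LexLt.sum_lt`). One elimination
step carries the system over to `σ ∪ {w}`; there `t` takes over the role of `B 0` (`Spans.insert`).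

Time. A functional is stored with its values at all vertices and its coefficients, so that a
combination of two of them costs `O(n + d)`. The vectors are sorted by a merge sort that remembers
common prefix lengths: coordinates found equal are never compared again, and sorting costs `O(n d +
n log n)`. The elimination, of cost `O(d (n + d))`, is carried out only after one query has shown
that `σ` has an unknown cofacet; such a `σ` has dimension less than that of the complex, which is
where the term in `d ^ 3` is charged. The empty simplex cannot be charged there; its coefficients
form a unit matrix, which avoids the quadratic term in `d`. -/

namespace RealRAM

variable {n d : ℕ}

/-! ### Weakest preconditions -/

/-- The program `p` has an execution from `s` whose final state, number of steps and number of
queries satisfy `Post`. -/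
def wp (K : ComplexIn (Fin n) d) (p : Prog) (s : State n) (Post : State n → ℕ → ℕ → Prop) : Prop :=
  ∃ s' t q, Exec K p s s' t q ∧ Post s' t q

section Rules

variable {K : ComplexIn (Fin n) d} {s : State n} {Post : State n → ℕ → ℕ → Prop}

theorem wp.mono {p : Prog} {Post' : State n → ℕ → ℕ → Prop} (h : wp K p s Post)
    (h' : ∀ s' t q, Post s' t q → Post' s' t q) : wp K p s Post' := by
  obtain ⟨s', t, q, he, hp⟩ := h
  exact ⟨s', t, q, he, h' _ _ _ hp⟩

theorem wp_skip : wp K .skip s Post ↔ Post s 1 0 := by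
  constructor
  · rintro ⟨s', t, q, he, hp⟩; cases he; exact hp
  · exact fun h => ⟨_, _, _, .skip s, h⟩

theorem wp_setNat {x e} :
    wp K (.setNat x e) s Post ↔ Post (s.setNatVar x (e.eval s)) (e.cost + 1) 0 := by
  constructor
  · rintro ⟨s', t, q, he, hp⟩; cases he; exact hp
  · exact fun h => ⟨_, _, _, .setNat s x e, h⟩

theorem wp_setReal {x e} :
    wp K (.setReal x e) s Post ↔ Post (s.setRealVar x (e.eval s)) (e.cost + 1) 0 := by
  constructor
  · rintro ⟨s', t, q, he, hp⟩; cases he; exact hp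
  · exact fun h => ⟨_, _, _, .setReal s x e, h⟩

theorem wp_storeNat {b o e} : wp K (.storeNat b o e) s Post ↔
    Post (s.setNatCell (b.eval s) (o.eval s) (e.eval s)) (b.cost + o.cost + e.cost + 1) 0 := by
  constructor
  · rintro ⟨s', t, q, he, hp⟩; cases he; exact hp
  · exact fun h => ⟨_, _, _, .storeNat s b o e, h⟩

theorem wp_storeReal {b o e} : wp K (.storeReal b o e) s Post ↔
    Post (s.setRealCell (b.eval s) (o.eval s) (e.eval s)) (b.cost + o.cost + e.cost + 1) 0 := by
  constructor
  · rintro ⟨s', t, q, he, hp⟩; cases he; exact hp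
  · exact fun h => ⟨_, _, _, .storeReal s b o e, h⟩

theorem wp_seq {p q} : wp K (.seq p q) s Post ↔
    wp K p s fun s₁ t₁ q₁ => wp K q s₁ fun s₂ t₂ q₂ => Post s₂ (t₁ + t₂) (q₁ + q₂) := by
  constructor
  · rintro ⟨s', t, q, he, hp⟩; cases he with | seq h₁ h₂ => exact ⟨_, _, _, h₁, _, _, _, h₂, hp⟩
  · rintro ⟨_, _, _, h₁, _, _, _, h₂, hp⟩; exact ⟨_, _, _, .seq h₁ h₂, hp⟩

theorem wp_ite {c p q} : wp K (.ite c p q) s Post ↔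
    (c.Holds s → wp K p s fun s' t q => Post s' (c.cost + 1 + t) q) ∧
    (¬ c.Holds s → wp K q s fun s' t q => Post s' (c.cost + 1 + t) q) := by
  constructor
  · rintro ⟨s', t, q, he, hp⟩
    cases he with
    | iteTrue hc h => exact ⟨fun _ => ⟨_, _, _, h, hp⟩, fun h' => absurd hc h'⟩
    | iteFalse hc h => exact ⟨fun h' => absurd h' hc, fun _ => ⟨_, _, _, h, hp⟩⟩
  · rintro ⟨h₁, h₂⟩
    by_cases hc : c.Holds s
    · obtain ⟨_, _, _, h, hp⟩ := h₁ hc; exact ⟨_, _, _, .iteTrue hc h, hp⟩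
    · obtain ⟨_, _, _, h, hp⟩ := h₂ hc; exact ⟨_, _, _, .iteFalse hc h, hp⟩

theorem wp_cand {b l t} (σ : Finset (Fin n)) (h₁ : s.Lists (b.eval s) (l.eval s) σ)
    (h₂ : σ ∈ K.faces)
    (h₃ : s.found.filter (fun ρ => ρ.card ≤ σ.card) = K.faces.filter (fun ρ => ρ.card ≤ σ.card))
    (h : Post (s.writeSet (t.eval s) {v | K.IsCandidate σ v})
      (b.cost + l.cost + t.cost + l.eval s + n + 1) 0) : wp K (.cand b l t) s Post :=
  ⟨_, _, _, .cand s b l t σ h₁ h₂ h₃, h⟩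

theorem wp_report {b l} (σ : Finset (Fin n)) (h₁ : s.Lists (b.eval s) (l.eval s) σ)
    (h : Post { s with found := insert σ s.found } (b.cost + l.cost + l.eval s + 1) 0) :
    wp K (.report b l) s Post :=
  ⟨_, _, _, .report s b l σ h₁, h⟩

theorem wp_indeg {x b l r} (σ : Finset (Fin n)) (h₁ : s.Lists (b.eval s) (l.eval s) σ)
    (h₂ : σ ∈ K.faces) (h₃ : K.PerpDirection σ (s.vector d (r.eval s)))
    (h : Post (s.setNatVar x (K.indegree σ (s.vector d (r.eval s))))
      (b.cost + l.cost + r.cost + 1) 1) : wp K (.indeg x b l r) s Post :=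
  ⟨_, _, _, .indeg s x b l r σ h₁ h₂ h₃, h⟩

/-- The loop rule: an invariant that carries a budget of steps and a budget of queries, from which
every round is paid. -/
theorem wp_loop {c : Test} {p : Prog} (Inv : State n → ℕ → ℕ → Prop)
    (hbody : ∀ s φ ψ, Inv s φ ψ → c.Holds s → wp K p s fun s' t q =>
      ∃ φ' ψ', Inv s' φ' ψ' ∧ φ' + t + c.cost + 1 ≤ φ ∧ ψ' + q ≤ ψ) {φ ψ : ℕ} (hs : Inv s φ ψ) :
    wp K (.loop c p) s fun s' t q =>
      ∃ φ' ψ', Inv s' φ' ψ' ∧ ¬ c.Holds s' ∧ t + φ' ≤ φ + c.cost + 1 ∧ q + ψ' ≤ ψ := by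
  -- Every round pays for its test, hence at least one step: the step budget decreases strictly and
  -- also proves termination.
  induction φ using Nat.strong_induction_on generalizing s ψ with
  | _ k ih =>
    by_cases hc : c.Holds s
    · obtain ⟨s₁, t₁, q₁, h₁, φ₁, ψ₁, i₁, hΦ, hΨ⟩ := hbody s _ _ hs hc
      obtain ⟨s₂, t₂, q₂, h₂, φ₂, ψ₂, i₂, hc₂, hΦ₂, hΨ₂⟩ := ih φ₁ (by omega) i₁
      exact ⟨s₂, _, _, .loopStep hc h₁ h₂, φ₂, ψ₂, i₂, hc₂, by omega, by omega⟩
    · exact ⟨s, _, _, .loopDone hc, _, _, hs, hc, by omega, by omega⟩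

end Rules

/-! ### Derived commands -/

/-- `a < b`. -/
abbrev Test.natLt (a b : NatExp) : Test := .not (.natLe b a)

/-- `for x in 0, …, y - 1 do p`, where `x` and `y` are variables. -/
def forLt (x y : ℕ) (p : Prog) : Prog :=
  .seq (.setNat x (.lit 0))
    (.loop (.natLt (.var x) (.var y)) (.seq p (.setNat x (.add (.var x) (.lit 1)))))

/-- A counting loop whose rounds take at most `T` steps and no queries. -/
theorem wp_forLt {K : ComplexIn (Fin n) d} {s : State n} {x y : ℕ} {p : Prog} (hxy : x ≠ y)
    (T : ℕ) (Inv : ℕ → State n → Prop) (h0 : Inv 0 (s.setNatVar x 0))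
    (hstep : ∀ k s', k < s.natVar y → Inv k s' → s'.natVar x = k → s'.natVar y = s.natVar y →
      wp K p s' fun s'' t q => s''.natVar x = k ∧ s''.natVar y = s.natVar y ∧
        Inv (k + 1) (s''.setNatVar x (k + 1)) ∧ t ≤ T ∧ q = 0) :
    wp K (forLt x y p) s fun s' t q => s'.natVar x = s.natVar y ∧ s'.natVar y = s.natVar y ∧
      Inv (s.natVar y) s' ∧ t ≤ s.natVar y * (T + 9) + 7 ∧ q = 0 := by
  rw [forLt, wp_seq, wp_setNat]
  -- The 9 extra steps of a round are the test (5) and the increment (4); the final 7 are the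
  -- initial assignment (2) and the failing test (5).
  refine (wp_loop (s := s.setNatVar x (NatExp.eval s (.lit 0)))
    (fun s' φ ψ => s'.natVar x ≤ s.natVar y ∧ s'.natVar y = s.natVar y ∧ Inv (s'.natVar x) s' ∧
      φ = (s.natVar y - s'.natVar x) * (T + 9) ∧ ψ = 0) ?_
    (φ := s.natVar y * (T + 9)) (ψ := 0) ?_).mono ?_
  · rintro s' φ ψ ⟨hx, hy, hi, rfl, rfl⟩ hc
    simp only [Test.Holds, NatExp.eval, not_le] at hc
    rw [wp_seq]
    refine (hstep _ s' (by omega) hi rfl hy).mono ?_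
    rintro s₁ t q ⟨h1, h2, h3, h4, h5⟩
    rw [wp_setNat]
    simp only [NatExp.eval, NatExp.cost, Test.cost, State.setNatVar, Function.update_self, h1] at h3 ⊢
    rw [Function.update_of_ne hxy.symm]
    refine ⟨_, _, ⟨by omega, h2, h3, rfl, rfl⟩, ?_, by omega⟩
    obtain ⟨e, he⟩ : ∃ e, s.natVar y - s'.natVar x = e + 1 := ⟨s.natVar y - s'.natVar x - 1, by omega⟩
    have : s.natVar y - (s'.natVar x + 1) = e := by omega
    rw [this, he, Nat.succ_mul]
    omega
  · simp only [State.setNatVar, NatExp.eval, Function.update_self, Function.update_of_ne hxy.symm]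
    exact ⟨Nat.zero_le _, trivial, h0, by simp, trivial⟩
  · rintro s' t q ⟨φ, ψ, ⟨h1, h2, h3, rfl, rfl⟩, h4, h5, h6⟩
    simp only [Test.Holds, NatExp.eval, not_le, not_lt, Test.cost, NatExp.cost] at h4 h5 ⊢
    have hx : s'.natVar x = s.natVar y := by omega
    rw [hx] at h3
    exact ⟨hx, h2, h3, by omega, by omega⟩

/-- The real block in variable `z` gets the entries of block `x` minus `c` times those of block `y`,
up to the length in variable `l`. -/
def axpy (z x y c l : ℕ) : Prog :=
  forLt 40 l (.storeReal (.var z) (.var 40)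
    (.sub (.load (.var x) (.var 40)) (.mul (.var c) (.load (.var y) (.var 40)))))

/-- Entry `k` is read just before it is overwritten, so the target block may coincide with a source.
The variables are below `40` to stay clear of the loop counter. -/
theorem wp_axpy {K : ComplexIn (Fin n) d} {s : State n} {z x y c l : ℕ} (hz : z < 40) (hx : x < 40)
    (hy : y < 40) (hl : l < 40) {Post : State n → ℕ → ℕ → Prop}
    (h : ∀ t, t ≤ s.natVar l * 21 + 7 →
      Post { s with
        natVar := Function.update s.natVar 40 (s.natVar l)
        realMem := Function.update s.realMem (s.natVar z) fun p => if p < s.natVar l then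
          s.realMem (s.natVar x) p - s.realVar c * s.realMem (s.natVar y) p
          else s.realMem (s.natVar z) p } t 0) :
    wp K (axpy z x y c l) s Post := by
  refine (wp_forLt (by omega) 12 (fun k s' => s' = { s with
        natVar := Function.update s.natVar 40 k
        realMem := Function.update s.realMem (s.natVar z) fun p => if p < k then
          s.realMem (s.natVar x) p - s.realVar c * s.realMem (s.natVar y) p
          else s.realMem (s.natVar z) p }) ?_ ?_).mono ?_
  · simp [State.setNatVar]
  · rintro k s' hk rfl - -
    rw [wp_storeReal]
    have e : ∀ w, w < 40 → Function.update s.natVar 40 k w = s.natVar w := fun w hw =>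
      Function.update_of_ne (by omega) _ _
    have key : ∀ w, (Function.update s.realMem (s.natVar z) fun p => if p < k then
          s.realMem (s.natVar x) p - s.realVar c * s.realMem (s.natVar y) p
          else s.realMem (s.natVar z) p) w k = s.realMem w k := by
      intro w
      by_cases hw : w = s.natVar z
      · subst hw; simp
      · rw [Function.update_of_ne hw]
    simp only [State.setRealCell, State.setNatVar, NatExp.eval, RealExp.eval, NatExp.cost, RealExp.cost,
      Function.update_self, e z hz, e x hx, e y hy, e l hl, key, Function.update_idem, true_and, and_true]
    refine ⟨?_, by norm_num⟩
    congr 2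
    funext p
    by_cases hp : p = k
    · subst hp; simp
    · rw [Function.update_of_ne hp]
      by_cases h1 : p < k
      · rw [if_pos h1, if_pos (by omega)]
      · rw [if_neg h1, if_neg (by omega)]
  · rintro s' t q ⟨-, -, rfl, ht, rfl⟩
    exact h t ht

end RealRAM

namespace ComplexIn

variable {V : Type} {d : ℕ}

/-! ### Geometry of embedded complexes -/

theorem subset_hull (K : ComplexIn V d) {σ : Finset V} {v : V} (hv : v ∈ σ) : K.pos v ∈ K.hull σ :=
  subset_convexHull ℝ _ ⟨v, hv, rfl⟩

/-- Simplices of an embedded complex are affinely independent. -/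
theorem Embedded.affineIndependent {K : ComplexIn V d} (hK : K.Embedded) {σ : Finset V}
    (hσ : σ ∈ K.faces) : AffineIndependent ℝ fun v : σ => K.pos v := by
  classical
  by_contra hn
  -- A Radon partition of dependent vertices gives two disjoint faces with a common point, whereas a
  -- common face would have a vertex in both.
  obtain ⟨I, x, hx, hx'⟩ := Convex.radon_partition hn
  set A : Finset V := σ.filter fun v => ∃ h : v ∈ σ, (⟨v, h⟩ : σ) ∈ I with hA
  set B : Finset V := σ.filter fun v => ∃ h : v ∈ σ, (⟨v, h⟩ : σ) ∉ I with hB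
  have h1 : (fun v : σ => K.pos v) '' I = K.pos '' (A : Set V) := by
    ext y; simp [hA]
  have h2 : (fun v : σ => K.pos v) '' Iᶜ = K.pos '' (B : Set V) := by
    ext y; simp [hB]
  rw [h1] at hx
  rw [h2] at hx'
  have ne (C : Finset V) (h : x ∈ convexHull ℝ (K.pos '' (C : Set V))) : C.Nonempty := by
    rw [Finset.nonempty_iff_ne_empty]; rintro rfl; simp at h
  have hAf := K.down_closed σ hσ A (Finset.filter_subset _ _) (ne A hx)
  have hBf := K.down_closed σ hσ B (Finset.filter_subset _ _) (ne B hx')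
  rcases hK A hAf B hBf with h | ⟨ρ, hρ, hρA, hρB, -⟩
  · exact (Set.eq_empty_iff_forall_notMem.1 h x) ⟨hx, hx'⟩
  · obtain ⟨v, hv⟩ := K.nonempty_of_mem ρ hρ
    have a := hρA hv
    have b := hρB hv
    simp only [hA, hB, Finset.mem_filter] at a b
    obtain ⟨_, _, a⟩ := a
    obtain ⟨_, _, b⟩ := b
    exact b a

/-- A vector is a combination of vertices as a weighted sum. -/
theorem mem_hull_of_sum (K : ComplexIn V d) {σ : Finset V} {g : V → ℝ} (hg : ∀ v ∈ σ, 0 ≤ g v)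
    (h1 : ∑ v ∈ σ, g v = 1) : ∑ v ∈ σ, g v • K.pos v ∈ K.hull σ :=
  (convex_convexHull ℝ _).sum_mem hg h1 fun _ hv => K.subset_hull hv

theorem exists_weights_of_mem_hull (K : ComplexIn V d) {σ : Finset V}
    {x : EuclideanSpace ℝ (Fin d)} (hx : x ∈ K.hull σ) :
    ∃ g : V → ℝ, ∑ v ∈ σ, g v = 1 ∧ ∑ v ∈ σ, g v • K.pos v = x := by
  classical
  have : K.hull σ = convexHull ℝ ((σ.image K.pos : Finset _) : Set (EuclideanSpace ℝ (Fin d))) := by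
    simp [hull]
  rw [this, Finset.convexHull_eq] at hx
  obtain ⟨w, -, h1, h2⟩ := hx
  rw [Finset.centerMass_eq_of_sum_1 _ _ h1] at h2
  refine ⟨fun v => w (K.pos v), ?_, ?_⟩
  · rw [← h1, Finset.sum_image (fun a _ b _ h => K.pos.injective h)]
  · rw [← h2, Finset.sum_image (fun a _ b _ h => K.pos.injective h)]
    simp

/-- Affine independence in coordinates. -/
theorem Embedded.eq_zero_of_sum {K : ComplexIn V d} (hK : K.Embedded) {σ : Finset V}
    (hσ : σ ∈ K.faces) {g : V → ℝ} (h0 : ∑ v ∈ σ, g v = 0) (h1 : ∑ v ∈ σ, g v • K.pos v = 0) :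
    ∀ v ∈ σ, g v = 0 := by
  classical
  have := (affineIndependent_iff.1 (hK.affineIndependent hσ)) Finset.univ (fun v => g v)
    (by rw [← h0]; exact Finset.sum_coe_sort σ g)
    (by rw [← h1]; exact Finset.sum_coe_sort σ fun v => g v • K.pos v)
  exact fun v hv => this ⟨v, hv⟩ (Finset.mem_univ _)

/-- If `σ ∪ {v}` is a simplex of an embedded complex that contains `ρ ⊆ σ ∪ {w}`, then no point lies
in both of them with positive weight on `v`. -/
theorem no_common_point [DecidableEq V] {L : ComplexIn V d} (hL : L.Embedded) {σ ρ : Finset V}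
    {v : V} (hvσ : insert v σ ∈ L.faces) (hρ : ρ ∈ L.faces) (hvρ : v ∉ ρ)
    {x : EuclideanSpace ℝ (Fin d)} (hx : x ∈ L.hull ρ) {g : V → ℝ} (hg : ∀ u ∈ insert v σ, 0 ≤ g u)
    (hgv : 0 < g v) (h1 : ∑ u ∈ insert v σ, g u = 1)
    (h2 : ∑ u ∈ insert v σ, g u • L.pos u = x) : False := by
  have hx' : x ∈ L.hull (insert v σ) := h2 ▸ L.mem_hull_of_sum hg h1
  rcases hL _ hvσ _ hρ with h | ⟨π, hπ, hπ1, hπ2, h⟩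
  · exact (Set.eq_empty_iff_forall_notMem.1 h x) ⟨hx', hx⟩
  have hxπ : x ∈ L.hull π := h ▸ ⟨hx', hx⟩
  obtain ⟨k, hk1, hk2⟩ := L.exists_weights_of_mem_hull hxπ
  have hvπ : v ∉ π := fun h => hvρ (hπ2 h)
  have e (M : Type) [AddCommMonoid M] (F : V → M) :
      ∑ u ∈ insert v σ, (if u ∈ π then F u else 0) = ∑ u ∈ π, F u := by
    rw [Finset.sum_ite_mem, Finset.inter_eq_right.2 hπ1]
  -- The weights of `x` in `insert v σ` and those in its face `π`, extended by zero, agree by affine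
  -- independence; as `v ∉ π`, the weight of `v` would vanish.
  have := hL.eq_zero_of_sum hvσ (g := fun u => g u - if u ∈ π then k u else 0)
    (by rw [Finset.sum_sub_distrib, e, h1, hk1, sub_self])
    (by simp only [sub_smul, ite_smul, zero_smul]; rw [Finset.sum_sub_distrib, e, h2, hk2, sub_self])
    v (Finset.mem_insert_self _ _)
  simp only [hvπ, if_false, sub_zero] at this
  exact hgv.ne' this

/-- A simplex `σ ∪ {v}` of an embedded complex and a vertex `w` on the same side of `σ`, such that
the proper faces of `σ ∪ {w}` lie in the complex as well: then `v` is in the simplex `σ ∪ {w}`. -/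
theorem nonpos_of_ray [DecidableEq V] {L : ComplexIn V d} (hL : L.Embedded) {σ : Finset V}
    {v w : V} (hvw : v ≠ w) (hv : v ∉ σ) (hw : w ∉ σ) (hvσ : insert v σ ∈ L.faces)
    (hwσ : ∀ ρ, ρ ⊂ insert w σ → ρ.Nonempty → ρ ∈ L.faces) {a b : ℝ} (ha : 0 < a) (hb : 0 < b)
    {c : V → ℝ} (h0 : b = a + ∑ u ∈ σ, c u)
    (h1 : b • L.pos w = a • L.pos v + ∑ u ∈ σ, c u • L.pos u) : ∀ u ∈ σ, c u ≤ 0 := by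
  by_contra! hc
  obtain ⟨u₀, hu₀, hcu₀⟩ := hc
  -- Moving the negative terms to the left gives `b w + ∑_N (-c u) u = a v + ∑ max (c u) 0 u`.
  -- Divided by the common total weight `Z`, this is a point of `N ∪ {w}` which has positive weight
  -- on `v` in `σ ∪ {v}`.
  set N := σ.filter fun u => c u < 0 with hN
  set Z := b + ∑ u ∈ N, -c u with hZ
  have hsp (M : Type) [AddCommGroup M] [Module ℝ M] (F : V → M) :
      ∑ u ∈ σ, c u • F u = ∑ u ∈ σ, (max (c u) 0) • F u - ∑ u ∈ N, (-c u) • F u := by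
    rw [hN, Finset.sum_filter, ← Finset.sum_sub_distrib]
    refine Finset.sum_congr rfl fun u _ => ?_
    split_ifs with h
    · rw [max_eq_right h.le]; simp
    · rw [max_eq_left (not_lt.1 h)]; simp
  have hZ0 : 0 < Z := add_pos_of_pos_of_nonneg hb
    (Finset.sum_nonneg fun u hu => by simp [hN] at hu; linarith [hu.2])
  have hZ2 : Z = a + ∑ u ∈ σ, max (c u) 0 := by
    have := hsp ℝ (fun _ => 1)
    simp only [smul_eq_mul, mul_one] at this
    rw [hZ, h0, this]; ring
  have hwN : w ∉ N := fun h => hw (Finset.mem_filter.1 h).1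
  -- The positive coefficient of `u₀` keeps it out of `N`, so `N ∪ {w}` is a proper face of `σ ∪
  -- {w}` and is available in `L`.
  have hss : insert w N ⊂ insert w σ := by
    refine Finset.ssubset_iff_subset_ne.2 ⟨Finset.insert_subset_insert _ (Finset.filter_subset _ _), fun h => ?_⟩
    have : u₀ ∈ insert w N := h ▸ Finset.mem_insert_of_mem hu₀
    rcases Finset.mem_insert.1 this with rfl | h'
    · exact hw hu₀
    · exact absurd (Finset.mem_filter.1 h').2 (by linarith)
  refine no_common_point (x := Z⁻¹ • (b • L.pos w + ∑ u ∈ N, (-c u) • L.pos u)) hL hvσ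
    (hwσ _ hss (Finset.insert_nonempty _ _)) ?_ ?_
    (g := fun u => Z⁻¹ * if u = v then a else max (c u) 0) ?_ ?_ ?_ ?_
  · intro h
    rcases Finset.mem_insert.1 h with h | h
    · exact hvw h
    · exact hv (Finset.mem_filter.1 h).1
  · have := L.mem_hull_of_sum (σ := insert w N) (g := fun u => Z⁻¹ * if u = w then b else -c u) ?_ ?_
    · rw [Finset.sum_insert hwN] at this
      rw [smul_add, Finset.smul_sum]
      convert this using 2
      · simp [mul_smul]
      · refine Finset.sum_congr rfl fun u hu => ?_
        rw [if_neg (by rintro rfl; exact hwN hu), mul_smul]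
    · intro u hu
      refine mul_nonneg (inv_nonneg.2 hZ0.le) ?_
      split_ifs with h
      · exact hb.le
      · have := (Finset.mem_insert.1 hu).resolve_left h
        simp [hN] at this; linarith [this.2]
    · rw [← Finset.mul_sum, Finset.sum_insert hwN, if_pos rfl,
        Finset.sum_congr rfl (g := fun u => -c u) fun u hu => if_neg (by rintro rfl; exact hwN hu), ← hZ,
        inv_mul_cancel₀ hZ0.ne']
  · intro u _
    refine mul_nonneg (inv_nonneg.2 hZ0.le) ?_
    split_ifs
    · exact ha.le
    · exact le_max_right _ _
  · simpa using mul_pos (inv_pos.2 hZ0) ha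
  · rw [← Finset.mul_sum, Finset.sum_insert hv, if_pos rfl,
      Finset.sum_congr rfl (g := fun u => max (c u) 0) fun u hu => if_neg (by rintro rfl; exact hv hu), ← hZ2,
      inv_mul_cancel₀ hZ0.ne']
  · rw [Finset.sum_insert hv, if_pos rfl, h1, hsp _ L.pos]
    rw [Finset.sum_congr rfl (g := fun u => Z⁻¹ • (max (c u) 0) • L.pos u) fun u hu => by
      rw [if_neg (by rintro rfl; exact hv hu), mul_smul], ← Finset.smul_sum, mul_smul]
    rw [← smul_add]
    congr 1
    abel

/-- The images of `v` and `w` in the quotient by the affine hull of `σ` do not span the same ray. -/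
def Separated (K : ComplexIn V d) (σ : Finset V) (v w : V) : Prop :=
  ∀ a b : ℝ, 0 < a → 0 < b → ∀ c : V → ℝ, b = a + ∑ u ∈ σ, c u →
    b • K.pos w ≠ a • K.pos v + ∑ u ∈ σ, c u • K.pos u

/-- Without vertices in `σ` the weight condition reads `b = a`, so that proportional points
coincide. -/
theorem separated_empty (K : ComplexIn V d) {v w : V} (h : v ≠ w) : K.Separated ∅ v w := by
  intro a b ha hb c h0 h1
  simp only [Finset.sum_empty, add_zero] at h0 h1
  subst h0
  exact h (K.pos.injective (smul_right_injective _ hb.ne' h1)).symm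

/-- Different candidate vertices of a simplex lie in different directions from it. -/
theorem IsCandidate.separated [DecidableEq V] {K : ComplexIn V d} {σ : Finset V}
    {v w : V} (hv : K.IsCandidate σ v) (hw : K.IsCandidate σ w) (hvw : v ≠ w) :
    K.Separated σ v w := by
  classical
  intro a b ha hb c h0 h1
  -- Only the embedded complex that witnesses `v` is used. It contains `σ ∪ {v}` and, through the
  -- skeleton, the proper faces of `σ ∪ {w}`, but perhaps not `σ ∪ {w}` itself.
  have key : ∀ {v w : V}, K.IsCandidate σ v → K.IsCandidate σ w → v ≠ w → ∀ {a b : ℝ}, 0 < a → 0 < b →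
      ∀ {c : V → ℝ}, b = a + ∑ u ∈ σ, c u → b • K.pos w = a • K.pos v + ∑ u ∈ σ, c u • K.pos u →
      ∀ u ∈ σ, c u ≤ 0 := by
    rintro v w ⟨hv, -, W, L, f, hL, hpos, hsk, hvσ⟩ ⟨hw, hpf, -⟩ hvw a b ha hb c h0 h1 u hu
    have := nonpos_of_ray (L := L) hL (σ := σ.map f) (v := f v) (w := f w) (f.injective.ne hvw)
      (by simpa) (by simpa) (by simpa [Finset.map_insert] using hvσ) ?_ ha hb
      (c := fun x => if h : ∃ u, f u = x then c h.choose else 0) ?_ ?_ (f u) (by simpa)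
    · simpa using this
    · intro ρ hρ hne
      rw [← Finset.map_insert] at hρ
      obtain ⟨ρ', hρ', rfl⟩ := Finset.subset_map_iff.1 hρ.1
      exact hsk _ (hpf _ (Finset.map_ssubset_map.1 hρ) (by simpa using hne))
    · simpa using h0
    · simpa [hpos] using h1
  have h2 := key hv hw hvw ha hb h0 h1
  -- Solving the same relation for `v` reverses all signs. Both inequalities together give `c = 0`,
  -- hence `a = b`, and the two vertices coincide.
  have h3 := key hw hv hvw.symm hb ha (c := fun u => -c u) (by rw [h0]; simp) (by rw [h1]; simp)
  have h4 : ∀ u ∈ σ, c u = 0 := fun u hu => le_antisymm (h2 u hu) (by linarith [h3 u hu])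
  rw [Finset.sum_eq_zero h4, add_zero] at h0
  rw [Finset.sum_eq_zero (fun u hu => by rw [h4 u hu, zero_smul]), add_zero, h0] at h1
  exact hvw (K.pos.injective (smul_right_injective _ ha.ne' h1)).symm

end ComplexIn

namespace ComplexIn

variable {n d : ℕ} {K : ComplexIn (Fin n) d}

/-! ### Affine functionals, given by their values at the vertices and their coefficients -/

/-- `f v` for `v < n` are the values at the vertices of an affine functional on `ℝ^d`, the
coefficients of which are `f (n + j)` for `j < d`. -/
def Affine (K : ComplexIn (Fin n) d) (f : ℕ → ℝ) : Prop :=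
  ∃ a, ∀ v : Fin n, f v = a + ∑ j : Fin d, f (n + j) * K.pos v j

theorem Affine.congr {f g : ℕ → ℝ} (hf : K.Affine f) (h : ∀ p < n + d, g p = f p) : K.Affine g := by
  obtain ⟨a, ha⟩ := hf
  refine ⟨a, fun v => ?_⟩
  rw [h v (by omega), ha]
  congr 1
  exact Finset.sum_congr rfl fun j _ => by rw [h (n + j) (by omega)]

theorem Affine.sub_mul {f g : ℕ → ℝ} (hf : K.Affine f) (hg : K.Affine g) (c : ℝ) :
    K.Affine fun p => f p - c * g p := by
  obtain ⟨a, ha⟩ := hf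
  obtain ⟨b, hb⟩ := hg
  refine ⟨a - c * b, fun v => ?_⟩
  beta_reduce
  rw [ha, hb, mul_add, Finset.mul_sum, add_sub_add_comm, ← Finset.sum_sub_distrib]
  congr 1
  exact Finset.sum_congr rfl fun j _ => by ring

theorem Affine.sum {ι : Type} (S : Finset ι) {f : ι → ℕ → ℝ} (hf : ∀ i ∈ S, K.Affine (f i))
    (c : ι → ℝ) : K.Affine fun p => ∑ i ∈ S, c i * f i p := by
  classical
  induction S using Finset.induction_on with
  | empty => exact ⟨0, fun v => by simp⟩
  | insert i S hi ih =>
    refine ((ih fun j hj => hf j (Finset.mem_insert_of_mem hj)).sub_mul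
      (hf i (Finset.mem_insert_self _ _)) (-c i)).congr fun p _ => ?_
    rw [Finset.sum_insert hi]; ring

/-- The linear part of an affine functional. -/
noncomputable def coeffVec (n d : ℕ) (f : ℕ → ℝ) : EuclideanSpace ℝ (Fin d) :=
  WithLp.toLp 2 fun j : Fin d => f (n + j)

theorem Affine.inner_coeffVec {f : ℕ → ℝ} (hf : K.Affine f) (v w : Fin n) :
    inner ℝ (coeffVec n d f) (K.pos v) - inner ℝ (coeffVec n d f) (K.pos w) = f v - f w := by
  obtain ⟨a, ha⟩ := hf
  rw [ha, ha]
  simp [coeffVec, PiLp.inner_apply, mul_comm]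

theorem norm_coeffVec (f : ℕ → ℝ) : ‖coeffVec n d f‖ = √(∑ j ∈ Finset.range d, f (n + j) ^ 2) := by
  rw [EuclideanSpace.norm_eq, ← Fin.sum_univ_eq_sum_range (fun j => f (n + j) ^ 2)]
  simp [coeffVec]

/-- The vertices `w` outside of `σ` such that `σ ∪ {w}` is a simplex. -/
def link (K : ComplexIn (Fin n) d) (σ : Finset (Fin n)) : Finset (Fin n) :=
  Finset.univ.filter fun w => w ∉ σ ∧ insert w σ ∈ K.faces

theorem mem_link {σ : Finset (Fin n)} {w : Fin n} : w ∈ K.link σ ↔ w ∉ σ ∧ insert w σ ∈ K.faces := by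
  simp [link]

/-- Differences of `f` are inner products with its coefficient vector, and normalising does not
affect their signs. A vertex with `f w ≠ 0` shows that this vector is not zero, since `f` vanishes
on `σ`. -/
theorem Affine.query {f : ℕ → ℝ} (hf : K.Affine f) {σ : Finset (Fin n)} (hσ : σ.Nonempty)
    (h0 : ∀ u ∈ σ, f u = 0) {w : Fin n} (hw : f w ≠ 0) {s : EuclideanSpace ℝ (Fin d)}
    (hs : s = (√(∑ j ∈ Finset.range d, f (n + j) ^ 2))⁻¹ • coeffVec n d f) :
    K.PerpDirection σ s ∧ K.indegree σ s = ((K.link σ).filter fun w : Fin n => f w ≤ 0).card := by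
  obtain ⟨u, hu⟩ := hσ
  rw [← norm_coeffVec] at hs
  have hne : coeffVec n d f ≠ 0 := by
    intro h
    have := hf.inner_coeffVec w u
    rw [h, h0 u hu] at this
    simp at this
    exact hw this.symm
  have hpos : 0 < ‖coeffVec n d f‖ := norm_pos_iff.2 hne
  have hle : ∀ v v' : Fin n, inner ℝ s (K.pos v) ≤ inner ℝ s (K.pos v') ↔ f v ≤ f v' := by
    intro v v'
    have := hf.inner_coeffVec v v'
    rw [hs, real_inner_smul_left, real_inner_smul_left, mul_le_mul_iff_right₀ (inv_pos.2 hpos)]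
    constructor <;> intro h <;> linarith
  refine ⟨⟨?_, ?_⟩, ?_⟩
  · rw [hs, norm_smul, norm_inv, norm_norm, inv_mul_cancel₀ hpos.ne']
  · intro v hv v' hv'
    exact le_antisymm ((hle _ _).2 (by rw [h0 v hv, h0 v' hv'])) ((hle _ _).2 (by rw [h0 v hv, h0 v' hv']))
  · classical
    unfold indegree
    symm
    refine Finset.card_bij (fun w _ => insert w σ) ?_ ?_ ?_
    · intro v hv
      simp only [Finset.mem_filter, mem_link] at hv ⊢
      obtain ⟨⟨hvσ, hvf⟩, hv0⟩ := hv
      refine ⟨by convert hvf, Finset.subset_insert _ _, Finset.card_insert_of_notMem hvσ, ?_⟩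
      intro x hx y hy
      rw [hle, h0 y hy]
      rcases Finset.mem_insert.1 hx with rfl | hx
      · exact hv0
      · exact (h0 x hx).le
    · intro v hv v' hv' h
      simp only [Finset.mem_filter, mem_link] at hv hv'
      have : v ∈ insert v' σ := h ▸ Finset.mem_insert_self v σ
      exact (Finset.mem_insert.1 this).resolve_right hv.1.1
    · intro τ hτ
      simp only [Finset.mem_filter] at hτ
      obtain ⟨hτ, hστ, hc, hall⟩ := hτ
      obtain ⟨v, hv, rfl⟩ : ∃ v, v ∉ σ ∧ insert v σ = τ := by
        have h1 : (τ \ σ).card = 1 := by rw [Finset.card_sdiff_of_subset hστ]; omega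
        obtain ⟨v, hv⟩ := Finset.card_eq_one.1 h1
        have hv' : v ∈ τ \ σ := hv ▸ Finset.mem_singleton_self v
        refine ⟨v, (Finset.mem_sdiff.1 hv').2, ?_⟩
        rw [Finset.insert_eq, ← hv, Finset.sdiff_union_of_subset hστ]
      refine ⟨v, ?_, rfl⟩
      simp only [Finset.mem_filter, mem_link]
      refine ⟨⟨hv, by convert hτ⟩, ?_⟩
      have := hall v (Finset.mem_insert_self _ _) u hu
      rwa [hle, h0 u hu] at this

/-- The functionals `f, B 0, …, B (m - 1)` have no common zeros, among the combinations of vertices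
in homogeneous coordinates, outside of the span of `σ`. -/
def Spans (K : ComplexIn (Fin n) d) (σ : Finset (Fin n)) (f : ℕ → ℝ) (B : ℕ → ℕ → ℝ) (m : ℕ) :
    Prop :=
  ∀ g : Fin n → ℝ, ∑ v, g v * f v = 0 → (∀ j < m, ∑ v, g v * B j v = 0) →
    ∃ h : Fin n → ℝ, (∀ v ∉ σ, h v = 0) ∧ ∑ v, g v = ∑ v, h v ∧
      ∑ v, g v • K.pos v = ∑ v, h v • K.pos v

theorem Spans.congr {σ : Finset (Fin n)} {f f' : ℕ → ℝ} {B B' : ℕ → ℕ → ℝ} {m : ℕ}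
    (hs : K.Spans σ f B m) (hf : ∀ p < n, f' p = f p) (hB : ∀ j < m, ∀ p < n, B' j p = B j p) :
    K.Spans σ f' B' m := by
  intro g h1 h2
  refine hs g ?_ fun j hj => ?_
  · rw [← h1]; exact Finset.sum_congr rfl fun v _ => by rw [hf v v.2]
  · rw [← h2 j hj]; exact Finset.sum_congr rfl fun v _ => by rw [hB j hj v v.2]

/-- The constant `1` and the coordinates are the homogeneous coordinates themselves, so only the
zero combination is annihilated. -/
theorem spans_empty {f : ℕ → ℝ} {B : ℕ → ℕ → ℝ} (hf : ∀ v : Fin n, f v = 1)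
    (hB : ∀ (j : Fin d) (v : Fin n), B j v = K.pos v j) : K.Spans ∅ f B d := by
  intro g h1 h2
  refine ⟨fun _ => 0, fun _ _ => rfl, ?_, ?_⟩
  · simpa [hf] using h1
  · ext j
    have := h2 j j.2
    simpa [hB] using this

/-- Subtracting multiples of `f` makes all functionals vanish at `u`. The index `0` can be dropped
because `B 0` occurs in `t` with coefficient `ε ^ 0 = 1` and is recovered from `t` and the other `B
j`; this works for every `ε`. -/
theorem Spans.insert {σ : Finset (Fin n)} {f : ℕ → ℝ} {B : ℕ → ℕ → ℝ} {m : ℕ}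
    (hs : K.Spans σ f B m) {u : Fin n} (hu : f u ≠ 0) (ε : ℝ) {t : ℕ → ℝ}
    (ht : ∀ v : Fin n, t v = ∑ j ∈ Finset.range m, ε ^ j * B j v) :
    K.Spans (insert u σ) (fun p => t p - t u / f u * f p)
      (fun j p => B (j + 1) p - B (j + 1) u / f u * f p) (m - 1) := by
  intro g h1 h2
  set c := (∑ v, g v * f v) / f u with hc
  set g' : Fin n → ℝ := fun v => g v - if v = u then c else 0 with hg'
  -- Duality: correcting the functionals by `f` amounts to correcting the combination `g` by a
  -- multiple of the vertex `u`.
  have key (φ : ℕ → ℝ) : ∑ v, g' v * φ v = ∑ v, g v * (φ v - φ u / f u * f v) := by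
    have e1 : ∑ v, g' v * φ v = ∑ v, g v * φ v - c * φ u := by
      simp only [hg', _root_.sub_mul, Finset.sum_sub_distrib, ite_mul, zero_mul, Finset.sum_ite_eq',
        Finset.mem_univ, if_true]
    have e2 : ∑ v, g v * (φ v - φ u / f u * f v) = ∑ v, g v * φ v - φ u / f u * ∑ v, g v * f v := by
      rw [Finset.mul_sum, ← Finset.sum_sub_distrib]
      exact Finset.sum_congr rfl fun v _ => by ring
    rw [e1, e2, hc]; ring
  have h3 : ∑ v, g' v * f v = 0 := by
    rw [key]
    refine Finset.sum_eq_zero fun v _ => ?_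
    rw [div_self hu]; ring
  have h4 : ∑ v, g' v * t v = 0 := by rw [key, h1]
  have h5 : ∀ j, 0 < j → j < m → ∑ v, g' v * B j v = 0 := by
    intro j hj0 hj
    obtain ⟨i, rfl⟩ : ∃ i, j = i + 1 := ⟨j - 1, by omega⟩
    rw [key (B (i + 1))]
    exact h2 i (by omega)
  have h6 : ∀ j < m, ∑ v, g' v * B j v = 0 := by
    intro j hj
    rcases Nat.eq_zero_or_pos j with rfl | hj0
    -- All terms of `t` with positive index vanish on `g'`, so the vanishing of `t` is that of `B
    -- 0`.
    · have : ∑ v, g' v * t v = ∑ j ∈ Finset.range m, ε ^ j * ∑ v, g' v * B j v := by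
        simp only [ht, Finset.mul_sum]
        rw [Finset.sum_comm]
        exact Finset.sum_congr rfl fun _ _ => Finset.sum_congr rfl fun _ _ => by ring
      rw [h4, Finset.sum_eq_single_of_mem 0 (by simpa using hj) (fun i hi hi0 => by
        rw [h5 i (Nat.pos_of_ne_zero hi0) (by simpa using hi), mul_zero])] at this
      simpa using this.symm
    · exact h5 j hj0 hj
  obtain ⟨h, k1, k2, k3⟩ := hs g' h3 h6
  refine ⟨fun v => h v + if v = u then c else 0, ?_, ?_, ?_⟩
  · intro v hv
    simp only [Finset.mem_insert, not_or] at hv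
    simp [k1 v hv.2, hv.1]
  · simp only [hg', Finset.sum_sub_distrib] at k2
    rw [Finset.sum_add_distrib, ← k2]; ring
  · simp only [hg', sub_smul, Finset.sum_sub_distrib] at k3
    simp only [add_smul]
    rw [Finset.sum_add_distrib, ← k3]; abel

/-- If all quotients agreed, `w / f w - v / f v` would be annihilated by all functionals and would
lie in the span of `σ`: exactly the relation that `Separated` excludes. -/
theorem Spans.exists_ne {σ : Finset (Fin n)} {f : ℕ → ℝ} {B : ℕ → ℕ → ℝ} {m : ℕ}
    (hs : K.Spans σ f B m) {v w : Fin n} (hv : 0 < f v) (hw : 0 < f w)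
    (hvw : K.Separated σ v w) : ∃ j < m, B j v / f v ≠ B j w / f w := by
  by_contra! hcon
  have hsum (M : Type) [AddCommGroup M] [Module ℝ M] (F : Fin n → M) :
      ∑ x, ((if x = w then (f w)⁻¹ else 0) - if x = v then (f v)⁻¹ else 0) • F x =
        (f w)⁻¹ • F w - (f v)⁻¹ • F v := by
    simp [sub_smul, ite_smul]
  have hsum' (F : Fin n → ℝ) :
      ∑ x, ((if x = w then (f w)⁻¹ else 0) - if x = v then (f v)⁻¹ else 0) * F x =
        (f w)⁻¹ * F w - (f v)⁻¹ * F v := hsum ℝ F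
  obtain ⟨h, h1, h2, h3⟩ := hs (fun x => (if x = w then (f w)⁻¹ else 0) - if x = v then (f v)⁻¹ else 0)
    (by rw [hsum', inv_mul_cancel₀ hv.ne', inv_mul_cancel₀ hw.ne', sub_self])
    (fun j hj => by
      rw [hsum' fun x => B j x, inv_mul_eq_div, inv_mul_eq_div, hcon j hj, sub_self])
  rw [hsum] at h3
  have h2' := hsum' fun _ => 1
  simp only [mul_one] at h2'
  rw [h2'] at h2
  have e (M : Type) [AddCommGroup M] [Module ℝ M] (F : Fin n → M) :
      ∑ x, h x • F x = ∑ x ∈ σ, h x • F x :=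
    (Finset.sum_subset (Finset.subset_univ σ) fun x _ hx => by rw [h1 x hx, zero_smul]).symm
  have e1 := e ℝ fun _ => 1
  simp only [smul_eq_mul, mul_one] at e1
  refine hvw _ _ (inv_pos.2 hv) (inv_pos.2 hw) h ?_ ?_
  · rw [← e1, ← h2]; ring
  · rw [← e _ K.pos, ← h3]; abel

/-! ### Lexicographic comparison -/

/-- `x` precedes `y` in the lexicographic order, and `h < m` is the first place where they differ. -/
def LexLt (m h : ℕ) (x y : ℕ → ℝ) : Prop :=
  h < m ∧ (∀ l < h, x l = y l) ∧ x h < y h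

/-- Up to place `k` the list `x` still agrees with `o`, so at `k` the comparison of `o` with `y` is
that of `x` with `y`. This decides a comparison from prefix lengths alone. -/
theorem LexLt.of_lt {m h k : ℕ} {o x y : ℕ → ℝ} (hx : LexLt m h o x) (hy : LexLt m k o y)
    (hk : k < h) : LexLt m k x y :=
  ⟨hy.1, fun l hl => (hx.2.1 l (by omega)).symm.trans (hy.2.1 l hl), hx.2.1 k hk ▸ hy.2.2⟩

/-- The terms after place `h` contribute at least `-ε ^ (h + 1) ∑ (1 + δ ^ 2) / 2`, by `-δ ≤ (1 + δ
^ 2) / 2`. The assumption on `ε` makes this loss at most half of the leading term `ε ^ h δ h`. -/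
theorem LexLt.sum_lt {m h : ℕ} {x y : ℕ → ℝ} (hxy : LexLt m h x y) {ε : ℝ} (h0 : 0 < ε)
    (h1 : ε ≤ 1) (hε : ε * ∑ l ∈ Finset.range m, (1 + (y l - x l) ^ 2) ≤ y h - x h) :
    ∑ l ∈ Finset.range m, ε ^ l * x l < ∑ l ∈ Finset.range m, ε ^ l * y l := by
  obtain ⟨hm, heq, hlt⟩ := hxy
  set δ : ℕ → ℝ := fun l => y l - x l with hδ
  have hδh : 0 < δ h := sub_pos.2 hlt
  have key : ∀ l ∈ Finset.range m,
      (if l = h then ε ^ h * δ h else 0) - ε ^ (h + 1) * ((1 + δ l ^ 2) / 2) ≤ ε ^ l * δ l := by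
    intro l hl
    have hp : 0 < ε ^ (h + 1) := pow_pos h0 _
    have hq : 0 ≤ ε ^ (h + 1) * ((1 + δ l ^ 2) / 2) := by positivity
    rcases lt_trichotomy l h with hlh | rfl | hlh
    · have : δ l = 0 := by simp [hδ, heq l hlh]
      rw [if_neg hlh.ne, this]
      nlinarith
    · rw [if_pos rfl]; linarith
    · rw [if_neg hlh.ne']
      have h3 : ε ^ l ≤ ε ^ (h + 1) := pow_le_pow_of_le_one h0.le h1 hlh
      have h4 : 0 < ε ^ l := pow_pos h0 _
      have h5 : -δ l ≤ (1 + δ l ^ 2) / 2 := by nlinarith [sq_nonneg (δ l + 1)]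
      have h6 : 0 ≤ (1 + δ l ^ 2) / 2 := by positivity
      nlinarith [mul_le_mul_of_nonneg_right h3 h6, mul_le_mul_of_nonneg_left h5 h4.le]
  have := Finset.sum_le_sum key
  rw [Finset.sum_sub_distrib, Finset.sum_ite_eq', if_pos (Finset.mem_range.2 hm), ← Finset.mul_sum,
    ← Finset.sum_div] at this
  have h7 : ∑ l ∈ Finset.range m, ε ^ l * δ l =
      ∑ l ∈ Finset.range m, ε ^ l * y l - ∑ l ∈ Finset.range m, ε ^ l * x l := by
    rw [← Finset.sum_sub_distrib]
    exact Finset.sum_congr rfl fun l _ => by simp [hδ]; ring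
  have h8 : 0 < ε ^ h := pow_pos h0 _
  rw [h7, pow_succ] at this
  nlinarith [mul_le_mul_of_nonneg_left hε h8.le]

end ComplexIn

namespace RealRAM

open ComplexIn

variable {n d : ℕ}

attribute [local simp] NatExp.eval RealExp.eval Test.Holds NatExp.cost RealExp.cost Test.cost
  State.setNatVar State.setRealVar State.setNatCell State.setRealCell wp_skip wp_setNat wp_setReal
  wp_storeNat wp_storeReal wp_seq

/-! ### Merge sort for the lexicographic order

The sorted lists store, for every entry, the length of the common prefix with the preceding entry. -/

/-- The coordinate in variable `h` of the vertex in variable `a`. -/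
def keyExp (a h : ℕ) : RealExp :=
  .div (.load (.add (.add (.var 9) (.lit 1)) (.var h)) (.var a)) (.load (.var 9) (.var a))

/-- The coordinates by which the vertices are compared. -/
noncomputable def State.key (s : State n) (w h : ℕ) : ℝ :=
  s.realMem (s.natVar 9 + 1 + h) w / s.realMem (s.natVar 9) w

/-- Determine the first place, not before variable `33`, where the vertices in the variables
`34` and `35` differ. -/
def matchLoop : Prog :=
  .loop (.and (.realLe (keyExp 34 33) (keyExp 35 33)) (.realLe (keyExp 35 33) (keyExp 34 33)))
    (.setNat 33 (.add (.var 33) (.lit 1)))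

/-- The loop needs no bound check, as a difference is known to exist before place `m`. Each
coordinate found equal costs at most 60 steps, later paid by the growth of a stored prefix length.
-/
theorem wp_matchLoop {K : ComplexIn (Fin n) d} {s : State n} {m : ℕ} {h a b : ℕ}
    (hh : s.natVar 33 = h) (ha : s.natVar 34 = a) (hb : s.natVar 35 = b)
    (heq : ∀ l < h, s.key a l = s.key b l) (hne : ∃ l < m, s.key a l ≠ s.key b l)
    {Post : State n → ℕ → ℕ → Prop}
    (hpost : ∀ k t, h ≤ k → k < m → (∀ l < k, s.key a l = s.key b l) → s.key a k ≠ s.key b k →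
      t ≤ 60 * (k - h) + 60 →
      Post { s with natVar := Function.update s.natVar 33 k } t 0) :
    wp K matchLoop s Post := by
  classical
  subst ha hb
  obtain ⟨k, hk, hkmin⟩ : ∃ k, s.key (s.natVar 34) k ≠ s.key (s.natVar 35) k ∧
      ∀ l < k, s.key (s.natVar 34) l = s.key (s.natVar 35) l := by
    obtain ⟨l, -, hl⟩ := hne
    have hex : ∃ k, s.key (s.natVar 34) k ≠ s.key (s.natVar 35) k := ⟨l, hl⟩
    exact ⟨Nat.find hex, Nat.find_spec hex, fun l' h' => not_not.1 (Nat.find_min hex h')⟩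
  have hhk : h ≤ k := by
    by_contra hcon
    exact hk (heq k (by omega))
  have hkm : k < m := by
    obtain ⟨l, hl, hl'⟩ := hne
    by_contra hcon
    exact hl' (hkmin l (by omega))
  refine (wp_loop (fun s' φ ψ => ∃ i, i ≤ k ∧ φ = 60 * (k - i) ∧ ψ = 0 ∧
    s' = { s with natVar := Function.update s.natVar 33 i }) ?_ (φ := 60 * (k - h)) (ψ := 0)
    ⟨h, hhk, rfl, rfl, ?_⟩).mono ?_
  · rintro s' φ ψ ⟨i, hi, rfl, rfl, rfl⟩ hc
    simp [keyExp] at hc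
    have : i ≠ k := by
      rintro rfl
      exact hk (le_antisymm hc.1 hc.2)
    rw [wp_setNat]
    refine ⟨_, _, ⟨i + 1, by omega, rfl, rfl, ?_⟩, ?_, by omega⟩
    · simp
    · simp [keyExp]; omega
  · subst hh
    simp
  · rintro s' t q ⟨φ, ψ, ⟨i, hi, rfl, rfl, rfl⟩, hc, ht, hq⟩
    simp [keyExp] at hc ht
    obtain rfl : q = 0 := by omega
    have : i = k := by
      by_contra hcon
      have := hkmin i (by omega)
      unfold State.key at this
      rw [this] at hc
      simp at hc
    subst this
    exact hpost i t hhk hkm hkmin hk (by omega)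

/-- The state of one of the two lists in a merge: its remaining entries are those in the places from
`i` to `e`, and `l` is the length of the common prefix of the first of them with the last output `o`,
if there is one. -/
structure Half (key : ℕ → ℕ → ℝ) (m : ℕ) (src sl : ℕ → ℕ) (started : Prop) (o i e l : ℕ) : Prop where
  le : i ≤ e
  chain : ∀ q, i < q → q < e → LexLt m (sl q) (key (src (q - 1))) (key (src q))
  head : i < e → started → LexLt m l (key o) (key (src i))
  zero : i < e → ¬ started → l = 0

/-! ### One input list of a merge and its share of the prefix-length potential -/

section Half

variable {key : ℕ → ℕ → ℝ} {m : ℕ} {src sl : ℕ → ℕ} {st : Prop} {o i e l : ℕ}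

theorem Half.take (h : Half key m src sl st o i e l) (hi : i < e) :
    Half key m src sl True (src i) (i + 1) e (sl (i + 1)) :=
  ⟨hi, fun q h1 h2 => h.chain q (by omega) h2, fun h1 _ => by simpa using h.chain (i + 1) (by omega) h1,
    fun _ h2 => absurd trivial h2⟩

theorem Half.other (h : Half key m src sl st o i e l) {l' o' : ℕ}
    (hl : i < e → LexLt m l' (key o') (key (src i))) : Half key m src sl True o' i e l' :=
  ⟨h.le, h.chain, fun h1 _ => hl h1, fun _ h2 => absurd trivial h2⟩

theorem Half.le_m (h : Half key m src sl st o i e l) (hi : i < e) : l ≤ m := by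
  by_cases hs : st
  · exact (h.head hi hs).1.le
  · exact (h.zero hi hs).trans_le (Nat.zero_le _)

/-- The sum of the common prefix lengths of the remaining entries. -/
def rest (sl : ℕ → ℕ) (i e l : ℕ) : ℕ :=
  if i < e then l + ∑ q ∈ Finset.Ico (i + 1) e, sl q else 0

/-- The prefix length of an entry is handed on to the output list, so that an output by itself
leaves the total potential unchanged. -/
theorem rest_take (hi : i < e) : rest sl i e l = l + rest sl (i + 1) e (sl (i + 1)) := by
  unfold rest
  rw [if_pos hi]
  split_ifs with h
  · rw [Finset.sum_eq_sum_Ico_succ_bot h]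
  · rw [Finset.Ico_eq_empty (by omega), Finset.sum_empty]

theorem rest_zero (h : i < e → sl i = 0) : rest sl i e 0 = ∑ q ∈ Finset.Ico i e, sl q := by
  unfold rest
  split_ifs with hi
  · rw [Finset.sum_eq_sum_Ico_succ_bot hi, h hi]
  · rw [Finset.Ico_eq_empty hi, Finset.sum_empty]

theorem rest_of_not_lt (h : ¬ i < e) : rest sl i e l = 0 := if_neg h

theorem rest_add (hi : i < e) (k : ℕ) : rest sl i e (l + k) = rest sl i e l + k := by
  unfold rest
  rw [if_pos hi, if_pos hi]
  ring

theorem Half.rest_le (h : Half key m src sl st o i e l) : rest sl i e l ≤ (e - i) * m := by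
  unfold rest
  split_ifs with hi
  · have : ∑ q ∈ Finset.Ico (i + 1) e, sl q ≤ (Finset.Ico (i + 1) e).card * m :=
      Finset.sum_le_card_nsmul _ _ _ fun q hq => by
        rw [Finset.mem_Ico] at hq
        exact (h.chain q (by omega) hq.2).1.le
    rw [Nat.card_Ico] at this
    have h2 := h.le_m hi
    obtain ⟨x, hx⟩ : ∃ x, e - i = x + 1 := ⟨e - i - 1, by omega⟩
    have : e - (i + 1) = x := by omega
    rw [hx, Nat.succ_mul]
    simp_all
    omega
  · exact Nat.zero_le _

end Half

/-- The sorted runs have length `w`. -/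
def Runs (key : ℕ → ℕ → ℝ) (m w r : ℕ) (src sl : ℕ → ℕ) : Prop :=
  ∀ q < r, (w ∣ q → sl q = 0) ∧ (¬ w ∣ q → LexLt m (sl q) (key (src (q - 1))) (key (src q)))

/-- The invariant of the merge of the two runs that begin at `b`. -/
structure Merging (key : ℕ → ℕ → ℝ) (m w r : ℕ) (src sl out ol : ℕ → ℕ) (b k i ie j je la lb pot : ℕ) :
    Prop where
  dvd : 2 * w ∣ b
  br : b < r
  ie_eq : ie = min (b + w) r
  je_eq : je = min (b + 2 * w) r
  k_eq : k + ie = i + j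
  bi : b ≤ i
  ij : ie ≤ j
  runs : Runs key m (2 * w) k out ol
  left : Half key m src sl (b < k) (out (k - 1)) i ie la
  right : Half key m src sl (b < k) (out (k - 1)) j je lb
  image : (Finset.range k).image out = (Finset.range i).image src ∪ (Finset.Ico ie j).image src
  pot_eq : pot = ∑ q ∈ Finset.range k, ol q + rest sl i ie la + rest sl j je lb +
    ∑ q ∈ Finset.Ico je r, sl q

/-- The invariant between two merges. -/
structure Between (key : ℕ → ℕ → ℝ) (m w r : ℕ) (src sl out ol : ℕ → ℕ) (k pot : ℕ) : Prop where
  dvd : 2 * w ∣ k ∨ k = r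
  kr : k ≤ r
  runs : Runs key m (2 * w) k out ol
  image : (Finset.range k).image out = (Finset.range k).image src
  pot_eq : pot = ∑ q ∈ Finset.range k, ol q + ∑ q ∈ Finset.Ico k r, sl q

/-! ### Combinatorial invariants of a merge -/

section Merging

variable {key : ℕ → ℕ → ℝ} {m w r : ℕ} {src sl out ol : ℕ → ℕ} {b k i ie j je la lb pot : ℕ}

theorem Runs.sum_le (h : Runs key m w r src sl) {S : Finset ℕ} (hS : ∀ q ∈ S, q < r) :
    ∑ q ∈ S, sl q ≤ S.card * m :=
  Finset.sum_le_card_nsmul _ _ _ fun q hq => by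
    by_cases hd : w ∣ q
    · rw [(h q (hS q hq)).1 hd]; exact Nat.zero_le _
    · exact ((h q (hS q hq)).2 hd).1.le

/-- Each of the `r` entries is counted once, in the output, a remaining half or the untouched rest,
with a prefix length of at most `m`. This caps all coordinate comparisons by `r * m`. -/
theorem Merging.pot_le (h : Merging key m w r src sl out ol b k i ie j je la lb pot)
    (hsrc : Runs key m w r src sl) : pot ≤ r * m := by
  have h1 := h.runs.sum_le (S := Finset.range k) (by simp)
  have h2 := h.left.rest_le
  have h3 := h.right.rest_le
  have h4 := hsrc.sum_le (S := Finset.Ico je r) (by simp)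
  rw [Finset.card_range] at h1
  rw [Nat.card_Ico] at h4
  have e1 := h.ie_eq
  have e2 := h.je_eq
  have e3 := h.k_eq
  have e4 := h.left.le
  have e5 := h.right.le
  have e6 := h.ij
  have : r * m = k * m + (ie - i) * m + (je - j) * m + (r - je) * m := by
    rw [← Nat.add_mul, ← Nat.add_mul, ← Nat.add_mul]
    congr 1
    omega
  rw [h.pot_eq]
  omega

theorem Between.start (h : Between key m w r src sl out ol k pot) (hsrc : Runs key m w r src sl)
    (hw : 0 < w) (hk : k < r) : Merging key m w r src sl out ol k k k (min (k + w) r)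
      (min (k + w) r) (min (k + 2 * w) r) 0 0 pot := by
  have hd : 2 * w ∣ k := h.dvd.resolve_right hk.ne
  have hwk : w ∣ k := (Dvd.intro_left 2 rfl).trans hd
  -- Strictly inside a run there is no multiple of `w`, so the entries there have genuine prefix
  -- lengths; the entry at the start of a run stores `0`.
  have nd : ∀ x q, w ∣ x → x < q → q < x + w → ¬ w ∣ q := by
    intro x q hx h1 h2 hq
    have := Nat.le_of_dvd (by omega) (Nat.dvd_sub hq hx)
    omega
  refine ⟨hd, hk, rfl, rfl, by omega, le_rfl, le_rfl, h.runs,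
    ⟨by omega, ?_, fun _ h => absurd h (lt_irrefl _), fun _ _ => rfl⟩,
    ⟨by omega, ?_, fun _ h => absurd h (lt_irrefl _), fun _ _ => rfl⟩, ?_, ?_⟩
  · intro q h1 h2
    exact (hsrc q (by omega)).2 (nd k q hwk h1 (by omega))
  · intro q h1 h2
    exact (hsrc q (by omega)).2 (nd (k + w) q (hwk.add (dvd_refl w)) (by omega) (by omega))
  · simpa using h.image
  · rw [rest_zero fun _ => (hsrc k hk).1 hwk, rest_zero ?_, h.pot_eq, add_assoc, add_assoc,
      Finset.sum_Ico_consecutive _ (by omega) (by omega), Finset.sum_Ico_consecutive _ (by omega) (by omega)]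
    intro hlt
    rw [min_eq_left (by omega)]
    exact (hsrc _ (by omega)).1 (hwk.add (dvd_refl w))

theorem Merging.finish (h : Merging key m w r src sl out ol b k i ie j je la lb pot) (hk : k = je) :
    Between key m w r src sl out ol k pot := by
  obtain ⟨h1, h2, h3, h4, h5, h6, h7, h8, h9, h10, h11, h12⟩ := h
  have e4 := h9.le
  have e5 := h10.le
  -- The counting identity `k + ie = i + j` with `k = je` forces both lists to be exhausted.
  obtain rfl : i = ie := by omega
  obtain rfl : j = k := by omega
  refine ⟨?_, by omega, h8, ?_, ?_⟩
  · rcases le_total (b + 2 * w) r with hle | hle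
    · left
      rw [show j = b + 2 * w by omega]
      exact h1.add (dvd_refl _)
    · right; omega
  · rw [h11, ← Finset.image_union]
    congr 1
    ext x
    simp only [Finset.mem_union, Finset.mem_range, Finset.mem_Ico]
    omega
  · rw [h12, rest, if_neg (by omega), rest, if_neg (by omega), hk]; simp

/-- Position `k` is either the start `b` of the merged run, where the length `0` is required, or
lies strictly between two multiples of `2 * w`, where it continues the chain. -/
theorem Merging.runs_take (h : Merging key m w r src sl out ol b k i ie j je la lb pot)
    (hk : k < je) {x l : ℕ} (h0 : ¬ b < k → l = 0)
    (hl : b < k → LexLt m l (key (out (k - 1))) (key x)) :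
    Runs key m (2 * w) (k + 1) (Function.update out k x) (Function.update ol k l) := by
  intro q hq
  rcases Nat.lt_succ_iff_lt_or_eq.1 hq with hq | rfl
  · rw [Function.update_of_ne (by omega), Function.update_of_ne (by omega), Function.update_of_ne (by omega)]
    exact h.runs q hq
  · rw [Function.update_self, Function.update_self]
    have hbk : b ≤ q := by have := h.k_eq; have := h.bi; have := h.ij; omega
    rcases hbk.eq_or_lt with rfl | hbk
    · exact ⟨fun _ => h0 (lt_irrefl _), fun hn => absurd h.dvd hn⟩
    · rw [Function.update_of_ne (by omega)]
      refine ⟨fun hd => ?_, fun _ => hl hbk⟩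
      have := Nat.le_of_dvd (by omega) (Nat.dvd_sub hd h.dvd)
      have := h.je_eq
      omega

theorem sum_range_update (ol : ℕ → ℕ) (k l : ℕ) :
    ∑ q ∈ Finset.range (k + 1), Function.update ol k l q = ∑ q ∈ Finset.range k, ol q + l := by
  rw [Finset.sum_range_succ, Function.update_self]
  congr 1
  exact Finset.sum_congr rfl fun q hq => Function.update_of_ne (by simp at hq; omega) _ _

theorem image_range_update (out : ℕ → ℕ) (k x : ℕ) :
    (Finset.range (k + 1)).image (Function.update out k x) = insert x ((Finset.range k).image out) := by
  rw [Finset.range_add_one, Finset.image_insert, Function.update_self]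
  congr 1
  exact Finset.image_congr fun q hq => Function.update_of_ne (by simp at hq; omega) _ _

/-- Only the head of the other list needs a new prefix length, with respect to the entry just
output. The potential increases by exactly the growth of this length. -/
theorem Merging.take_left (h : Merging key m w r src sl out ol b k i ie j je la lb pot) (hi : i < ie)
    {lb' : ℕ} (hlb : lb ≤ lb') (hj : j < je → LexLt m lb' (key (src i)) (key (src j))) :
    Merging key m w r src sl (Function.update out k (src i)) (Function.update ol k la) b (k + 1)
      (i + 1) ie j je (sl (i + 1)) lb' (if j < je then pot + (lb' - lb) else pot) := by
  have hr := h.runs_take (x := src i) (l := la) (by have := h.k_eq; have := h.right.le; omega)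
    (h.left.zero hi) (h.left.head hi)
  obtain ⟨h1, h2, h3, h4, h5, h6, h7, h8, h9, h10, h11, h12⟩ := h
  have hb : (b < k + 1) = True := by simp; omega
  refine ⟨h1, h2, h3, h4, by omega, by omega, h7, hr, ?_, ?_, ?_, ?_⟩
  · rw [hb]; simpa using h9.take hi
  · rw [hb]; simpa using h10.other hj
  · rw [image_range_update, h11, Finset.range_add_one, Finset.image_insert, Finset.insert_union]
  · rw [sum_range_update, h12, rest_take hi]
    split_ifs with hlt
    · obtain ⟨e, rfl⟩ := Nat.exists_eq_add_of_le hlb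
      rw [rest_add hlt]
      omega
    · rw [rest_of_not_lt hlt, rest_of_not_lt hlt]
      omega

theorem Merging.take_right (h : Merging key m w r src sl out ol b k i ie j je la lb pot) (hj : j < je)
    {la' : ℕ} (hla : la ≤ la') (hi : i < ie → LexLt m la' (key (src j)) (key (src i))) :
    Merging key m w r src sl (Function.update out k (src j)) (Function.update ol k lb) b (k + 1)
      i ie (j + 1) je la' (sl (j + 1)) (if i < ie then pot + (la' - la) else pot) := by
  have hr := h.runs_take (x := src j) (l := lb) (by have := h.k_eq; have := h.left.le; omega)
    (h.right.zero hj) (h.right.head hj)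
  obtain ⟨h1, h2, h3, h4, h5, h6, h7, h8, h9, h10, h11, h12⟩ := h
  have hb : (b < k + 1) = True := by simp; omega
  refine ⟨h1, h2, h3, h4, by omega, by omega, by omega, hr, ?_, ?_, ?_, ?_⟩
  · rw [hb]; simpa using h9.other hi
  · rw [hb]; simpa using h10.take hj
  · rw [image_range_update, h11, ← Finset.insert_Ico_right_eq_Ico_add_one h7, Finset.image_insert, Finset.union_insert]
  · rw [sum_range_update, h12, rest_take (i := j) hj]
    split_ifs with hlt
    · obtain ⟨e, rfl⟩ := Nat.exists_eq_add_of_le hla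
      rw [rest_add hlt]
      omega
    · rw [rest_of_not_lt hlt, rest_of_not_lt hlt]
      omega

end Merging

end RealRAM

/-! ### The merge sort as a program, with its running time -/

namespace RealRAM

open ComplexIn

variable {n d : ℕ}

attribute [local simp] NatExp.eval RealExp.eval Test.Holds NatExp.cost RealExp.cost Test.cost
  State.setNatVar State.setRealVar State.setNatCell State.setRealCell wp_skip wp_setNat wp_setReal
  wp_storeNat wp_storeReal wp_seq

/-- Output the first entry of the left list. -/
def takeLeft : Prog :=
  .seq (.storeNat (.var 22) (.var 25) (.load (.var 20) (.var 26))) <|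
  .seq (.storeNat (.var 23) (.var 25) (.var 30)) <|
  .seq (.setNat 30 (.load (.var 21) (.add (.var 26) (.lit 1)))) <|
  .setNat 26 (.add (.var 26) (.lit 1))

/-- Output the first entry of the right list. -/
def takeRight : Prog :=
  .seq (.storeNat (.var 22) (.var 25) (.load (.var 20) (.var 28))) <|
  .seq (.storeNat (.var 23) (.var 25) (.var 31)) <|
  .seq (.setNat 31 (.load (.var 21) (.add (.var 28) (.lit 1)))) <|
  .setNat 28 (.add (.var 28) (.lit 1))

/-- Start the merge of the next two runs. -/
def newPair : Prog :=
  .seq (.setNat 26 (.var 25)) <|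
  -- With truncated subtraction, `a - (a - r)` is the minimum of `a` and `r`.
  .seq (.setNat 27 (.sub (.add (.var 25) (.var 24)) (.sub (.add (.var 25) (.var 24)) (.var 11)))) <|
  .seq (.setNat 28 (.var 27)) <|
  .seq (.setNat 29 (.sub (.add (.var 27) (.var 24)) (.sub (.add (.var 27) (.var 24)) (.var 11)))) <|
  .seq (.setNat 30 (.lit 0)) <|
  .setNat 31 (.lit 0)

/-- Compare the first entries of the two lists, which have equally long common prefixes with the
last output, and output the smaller one. -/
def compareStep : Prog :=
  .seq (.setNat 34 (.load (.var 20) (.var 26))) <|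
  .seq (.setNat 35 (.load (.var 20) (.var 28))) <|
  .seq (.setNat 33 (.var 30)) <|
  .seq matchLoop <|
  .ite (.realLe (keyExp 34 33) (keyExp 35 33))
    (.seq (.setNat 31 (.var 33)) takeLeft) (.seq (.setNat 30 (.var 33)) takeRight)

/-- Output the smallest of the remaining entries of the two lists. -/
def mergeStep : Prog :=
  .ite (.natLt (.var 26) (.var 27))
    (.ite (.natLt (.var 28) (.var 29))
      (.ite (.natLt (.var 31) (.var 30)) takeLeft
        (.ite (.natLt (.var 30) (.var 31)) takeRight compareStep))
      takeLeft)
    takeRight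

/-- Merge all pairs of neighbouring runs. -/
def mergePass : Prog :=
  .seq (.setNat 25 (.lit 0)) <| .seq (.setNat 29 (.lit 0)) <|
  .loop (.natLt (.var 25) (.var 11)) <|
    .seq (.ite (.natLe (.var 29) (.var 25)) newPair .skip) <|
    .seq mergeStep <| .setNat 25 (.add (.var 25) (.lit 1))

/-- Sort the vertices in the first cells of block `4`, the number of which is in variable `11`. -/
def mergeSort : Prog :=
  .seq (.setNat 20 (.lit 4)) <| .seq (.setNat 21 (.lit 5)) <|
  .seq (.setNat 22 (.lit 6)) <| .seq (.setNat 23 (.lit 7)) <|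
  .seq (.setNat 24 (.lit 1)) <|
  .loop (.natLt (.var 24) (.var 11)) <|
    .seq mergePass <|
    .seq (.setNat 25 (.var 20)) <| .seq (.setNat 26 (.var 21)) <|
    .seq (.setNat 20 (.var 22)) <| .seq (.setNat 21 (.var 23)) <|
    .seq (.setNat 22 (.var 25)) <| .seq (.setNat 23 (.var 26)) <|
    .setNat 24 (.add (.var 24) (.var 24))

/-- The state during a merge pass. -/
def passState (s : State n) (ν out ol : ℕ → ℕ) : State n :=
  { s with
    natVar := ν
    natMem := Function.update (Function.update s.natMem (s.natVar 22) out) (s.natVar 23) ol }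

/-- The four blocks of the merge sort are different. -/
structure Buffers (s : State n) : Prop where
  h02 : s.natVar 20 ≠ s.natVar 22
  h03 : s.natVar 20 ≠ s.natVar 23
  h12 : s.natVar 21 ≠ s.natVar 22
  h13 : s.natVar 21 ≠ s.natVar 23
  h23 : s.natVar 22 ≠ s.natVar 23

/-! ### Cost of one output step, of a pass and of the whole sort -/

section Pass

variable {K : ComplexIn (Fin n) d} {s : State n} {ν out ol : ℕ → ℕ} {Post : State n → ℕ → ℕ → Prop}

theorem wp_takeLeft (hs : Buffers s) (hν : ∀ x < 25, ν x = s.natVar x)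
    (h : Post (passState s
      (Function.update (Function.update ν 30 (s.natMem (s.natVar 21) (ν 26 + 1))) 26 (ν 26 + 1))
      (Function.update out (ν 25) (s.natMem (s.natVar 20) (ν 26)))
      (Function.update ol (ν 25) (ν 30))) 20 0) :
    wp K takeLeft (passState s ν out ol) Post := by
  obtain ⟨h1, h2, h3, h4, h5⟩ := hs
  convert h using 1
  simp [takeLeft, passState, hν, h1, h2, h3, h4, h5, h5.symm, Function.update_comm]

theorem wp_takeRight (hs : Buffers s) (hν : ∀ x < 25, ν x = s.natVar x)
    (h : Post (passState s
      (Function.update (Function.update ν 31 (s.natMem (s.natVar 21) (ν 28 + 1))) 28 (ν 28 + 1))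
      (Function.update out (ν 25) (s.natMem (s.natVar 20) (ν 28)))
      (Function.update ol (ν 25) (ν 31))) 20 0) :
    wp K takeRight (passState s ν out ol) Post := by
  obtain ⟨h1, h2, h3, h4, h5⟩ := hs
  convert h using 1
  simp [takeRight, passState, hν, h1, h2, h3, h4, h5, h5.symm, Function.update_comm]

variable {m w r : ℕ} {b pot : ℕ} {T : Finset ℕ}

/-- What is known about the state after an output step. -/
def Stepped (s : State n) (m w r b pot c : ℕ) (ν : ℕ → ℕ) (s' : State n) (t q : ℕ) : Prop :=
  ∃ ν' out' ol' pot', s' = passState s ν' out' ol' ∧ (∀ x < 26, ν' x = ν x) ∧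
    Merging s.key m w r (s.natMem (s.natVar 20)) (s.natMem (s.natVar 21)) out' ol' b (ν 25 + 1)
      (ν' 26) (ν' 27) (ν' 28) (ν' 29) (ν' 30) (ν' 31) pot' ∧ ν' 29 = ν 29 ∧
    t ≤ c + 60 * (pot' - pot) ∧ pot ≤ pot' ∧ q = 0

/-- Here the growth of the other head's prefix length is turned into the time allowance: 60 steps
per unit of potential. -/
theorem stepped_left
    (hM : Merging s.key m w r (s.natMem (s.natVar 20)) (s.natMem (s.natVar 21)) out ol b (ν 25)
      (ν 26) (ν 27) (ν 28) (ν 29) (ν 30) (ν 31) pot) (hi : ν 26 < ν 27) {ν₁ : ℕ → ℕ}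
    (hν₁ : ∀ x < 31, ν₁ x = ν x) (hlb : ν 31 ≤ ν₁ 31)
    (hj : ν 28 < ν 29 → LexLt m (ν₁ 31) (s.key (s.natMem (s.natVar 20) (ν 26)))
      (s.key (s.natMem (s.natVar 20) (ν 28)))) {t c : ℕ}
    (ht : t ≤ c + 60 * (if ν 28 < ν 29 then ν₁ 31 - ν 31 else 0)) :
    Stepped s m w r b pot c ν (passState s
      (Function.update (Function.update ν₁ 30 (s.natMem (s.natVar 21) (ν₁ 26 + 1))) 26 (ν₁ 26 + 1))
      (Function.update out (ν₁ 25) (s.natMem (s.natVar 20) (ν₁ 26)))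
      (Function.update ol (ν₁ 25) (ν₁ 30))) t 0 := by
  refine ⟨_, _, _, if ν 28 < ν 29 then pot + (ν₁ 31 - ν 31) else pot, rfl, ?_, ?_, ?_, ?_, ?_, rfl⟩
  · intro x hx
    rw [Function.update_of_ne (by omega), Function.update_of_ne (by omega), hν₁ x (by omega)]
  · have := hM.take_left hi hlb hj
    simpa [hν₁] using this
  · simp [hν₁]
  · split_ifs at ht ⊢ <;> omega
  · split_ifs at ht ⊢ <;> omega

theorem stepped_right
    (hM : Merging s.key m w r (s.natMem (s.natVar 20)) (s.natMem (s.natVar 21)) out ol b (ν 25)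
      (ν 26) (ν 27) (ν 28) (ν 29) (ν 30) (ν 31) pot) (hj : ν 28 < ν 29) {ν₁ : ℕ → ℕ}
    (hν₁ : ∀ x < 30, ν₁ x = ν x) (hν₁' : ν₁ 31 = ν 31) (hla : ν 30 ≤ ν₁ 30)
    (hi : ν 26 < ν 27 → LexLt m (ν₁ 30) (s.key (s.natMem (s.natVar 20) (ν 28)))
      (s.key (s.natMem (s.natVar 20) (ν 26)))) {t c : ℕ}
    (ht : t ≤ c + 60 * (if ν 26 < ν 27 then ν₁ 30 - ν 30 else 0)) :
    Stepped s m w r b pot c ν (passState s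
      (Function.update (Function.update ν₁ 31 (s.natMem (s.natVar 21) (ν₁ 28 + 1))) 28 (ν₁ 28 + 1))
      (Function.update out (ν₁ 25) (s.natMem (s.natVar 20) (ν₁ 28)))
      (Function.update ol (ν₁ 25) (ν₁ 31))) t 0 := by
  refine ⟨_, _, _, if ν 26 < ν 27 then pot + (ν₁ 30 - ν 30) else pot, rfl, ?_, ?_, ?_, ?_, ?_, rfl⟩
  · intro x hx
    rw [Function.update_of_ne (by omega), Function.update_of_ne (by omega), hν₁ x (by omega)]
  · have := hM.take_right hj hla hi
    simpa [hν₁, hν₁'] using this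
  · simp [hν₁]
  · split_ifs at ht ⊢ <;> omega
  · split_ifs at ht ⊢ <;> omega

/-- Both heads follow the last output. The head with the longer common prefix with it is the smaller
one, and the shorter length remains valid for the other. Equal lengths only show agreement up to
there. Before the first output both lengths are `0`. -/
theorem Merging.lt_of_lcp_lt
    (hM : Merging s.key m w r (s.natMem (s.natVar 20)) (s.natMem (s.natVar 21)) out ol b (ν 25)
      (ν 26) (ν 27) (ν 28) (ν 29) (ν 30) (ν 31) pot) (hi : ν 26 < ν 27) (hj : ν 28 < ν 29) :
    (ν 31 < ν 30 → LexLt m (ν 31) (s.key (s.natMem (s.natVar 20) (ν 26)))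
      (s.key (s.natMem (s.natVar 20) (ν 28)))) ∧
    (ν 30 < ν 31 → LexLt m (ν 30) (s.key (s.natMem (s.natVar 20) (ν 28)))
      (s.key (s.natMem (s.natVar 20) (ν 26)))) ∧
    (ν 30 = ν 31 → ∀ l < ν 30, s.key (s.natMem (s.natVar 20) (ν 26)) l =
      s.key (s.natMem (s.natVar 20) (ν 28)) l) := by
  by_cases hb : b < ν 25
  · have h1 := hM.left.head hi hb
    have h2 := hM.right.head hj hb
    exact ⟨h1.of_lt h2, h2.of_lt h1, fun h l hl => (h1.2.1 l hl).symm.trans (h2.2.1 l (h ▸ hl))⟩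
  · have h1 := hM.left.zero hi hb
    have h2 := hM.right.zero hj hb
    exact ⟨fun h => by omega, fun h => by omega, fun _ l hl => by omega⟩

/-- The comparison resumes at the common prefix length. The first difference `k` becomes the stored
length of the larger head, since the smaller one is now the last output. -/
theorem wp_compareStep (hs : Buffers s) (hν : ∀ x < 25, ν x = s.natVar x)
    (hM : Merging s.key m w r (s.natMem (s.natVar 20)) (s.natMem (s.natVar 21)) out ol b (ν 25)
      (ν 26) (ν 27) (ν 28) (ν 29) (ν 30) (ν 31) pot)
    (hi : ν 26 < ν 27) (hj : ν 28 < ν 29) (hl : ν 30 = ν 31)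
    (hd : ∃ l < m, s.key (s.natMem (s.natVar 20) (ν 26)) l ≠
      s.key (s.natMem (s.natVar 20) (ν 28)) l) :
    wp K compareStep (passState s ν out ol) (Stepped s m w r b pot 150 ν) := by
  have hkey : ∀ ν' out' ol', ν' 9 = ν 9 → (passState s ν' out' ol').key = s.key := by
    intro ν' out' ol' h9
    funext x l
    simp [State.key, passState, h9, hν]
  unfold compareStep
  simp only [wp_seq, wp_setNat]
  set ν₁ : ℕ → ℕ := Function.update (Function.update (Function.update ν 34
    (s.natMem (s.natVar 20) (ν 26))) 35 (s.natMem (s.natVar 20) (ν 28))) 33 (ν 30) with hν₁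
  have hst : (((passState s ν out ol).setNatVar 34 (NatExp.eval (passState s ν out ol)
      (.load (.var 20) (.var 26)))).setNatVar 35 (NatExp.eval ((passState s ν out ol).setNatVar 34
        (NatExp.eval (passState s ν out ol) (.load (.var 20) (.var 26)))) (.load (.var 20) (.var 28)))).setNatVar 33
        (NatExp.eval (((passState s ν out ol).setNatVar 34 (NatExp.eval (passState s ν out ol)
      (.load (.var 20) (.var 26)))).setNatVar 35 (NatExp.eval ((passState s ν out ol).setNatVar 34
        (NatExp.eval (passState s ν out ol) (.load (.var 20) (.var 26)))) (.load (.var 20) (.var 28)))) (.var 30)) =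
      passState s ν₁ out ol := by
    simp [passState, hν₁, hν, hs.h02, hs.h03]
  rw [hst]
  obtain ⟨-, -, heq⟩ := hM.lt_of_lcp_lt hi hj
  have hk1 := hkey ν₁ out ol (by simp [hν₁])
  refine wp_matchLoop (m := m) (h := ν 30) (a := s.natMem (s.natVar 20) (ν 26))
    (b := s.natMem (s.natVar 20) (ν 28)) (by simp [passState, hν₁]) (by simp [passState, hν₁])
    (by simp [passState, hν₁]) (by rw [hk1]; exact heq hl) (by rw [hk1]; exact hd) ?_
  intro k t hk hkm hagree hne ht
  rw [hk1] at hagree hne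
  have hst2 : ({ passState s ν₁ out ol with
      natVar := Function.update (passState s ν₁ out ol).natVar 33 k } : State n) =
      passState s (Function.update ν₁ 33 k) out ol := rfl
  rw [hst2, wp_ite]
  have hc : Test.Holds (passState s (Function.update ν₁ 33 k) out ol)
      (.realLe (keyExp 34 33) (keyExp 35 33)) ↔
      s.key (s.natMem (s.natVar 20) (ν 26)) k ≤ s.key (s.natMem (s.natVar 20) (ν 28)) k := by
    simp [keyExp, State.key, passState, hν₁, hν]
  rw [hc]
  constructor
  · intro hle
    simp only [wp_seq, wp_setNat]
    have hst3 : (passState s (Function.update ν₁ 33 k) out ol).setNatVar 31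
        (NatExp.eval (passState s (Function.update ν₁ 33 k) out ol) (.var 33)) =
        passState s (Function.update (Function.update ν₁ 33 k) 31 k) out ol := by
      simp [passState]
    rw [hst3]
    refine wp_takeLeft hs ?_ ?_
    · intro x hx
      simp [hν₁, hν x hx, show x ≠ 31 by omega, show x ≠ 33 by omega,
        show x ≠ 34 by omega, show x ≠ 35 by omega]
    · refine stepped_left hM hi ?_ ?_ ?_ ?_
      · intro x hx
        simp [hν₁, show x ≠ 31 by omega, show x ≠ 33 by omega,
          show x ≠ 34 by omega, show x ≠ 35 by omega]
      · simp; omega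
      · intro _
        simp only [Function.update_self]
        exact ⟨hkm, hagree, lt_of_le_of_ne hle hne⟩
      · rw [if_pos hj]
        simp [keyExp, ← hl]; omega
  · intro hle
    simp only [wp_seq, wp_setNat]
    have hst3 : (passState s (Function.update ν₁ 33 k) out ol).setNatVar 30
        (NatExp.eval (passState s (Function.update ν₁ 33 k) out ol) (.var 33)) =
        passState s (Function.update (Function.update ν₁ 33 k) 30 k) out ol := by
      simp [passState]
    rw [hst3]
    refine wp_takeRight hs ?_ ?_
    · intro x hx
      simp [hν₁, hν x hx, show x ≠ 30 by omega, show x ≠ 33 by omega,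
        show x ≠ 34 by omega, show x ≠ 35 by omega]
    · refine stepped_right hM hj ?_ ?_ ?_ ?_ ?_
      · intro x hx
        simp [hν₁, show x ≠ 30 by omega, show x ≠ 33 by omega,
          show x ≠ 34 by omega, show x ≠ 35 by omega]
      · simp [hν₁]
      · simp; omega
      · intro _
        simp only [Function.update_self]
        exact ⟨hkm, fun l hl => (hagree l hl).symm, not_le.1 hle⟩
      · rw [if_pos hi]
        simp [keyExp]; omega

theorem wp_mergeStep (hs : Buffers s) (hν : ∀ x < 25, ν x = s.natVar x)
    (hM : Merging s.key m w r (s.natMem (s.natVar 20)) (s.natMem (s.natVar 21)) out ol b (ν 25)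
      (ν 26) (ν 27) (ν 28) (ν 29) (ν 30) (ν 31) pot)
    (hk : ν 25 < ν 29)
    (hd : ∀ x y, x < r → y < r → x ≠ y →
      ∃ l < m, s.key (s.natMem (s.natVar 20) x) l ≠ s.key (s.natMem (s.natVar 20) y) l) :
    wp K mergeStep (passState s ν out ol) (Stepped s m w r b pot 180 ν) := by
  have e1 := hM.ie_eq
  have e2 := hM.je_eq
  have e3 := hM.k_eq
  have e4 := hM.left.le
  have e5 := hM.right.le
  have e6 := hM.ij
  unfold mergeStep
  rw [wp_ite]
  constructor
  · intro hi
    have hi : ν 26 < ν 27 := by simpa [passState] using hi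
    rw [wp_ite]
    constructor
    · intro hj
      have hj : ν 28 < ν 29 := by simpa [passState] using hj
      obtain ⟨h1, h2, -⟩ := hM.lt_of_lcp_lt hi hj
      rw [wp_ite]
      constructor
      · intro hl
        have hl : ν 31 < ν 30 := by simpa [passState] using hl
        exact wp_takeLeft hs hν (stepped_left hM hi (fun _ _ => rfl) le_rfl (fun _ => h1 hl) (by simp))
      · intro hl
        have hl : ν 30 ≤ ν 31 := by simpa [passState] using hl
        rw [wp_ite]
        constructor
        · intro hl
          have hl : ν 30 < ν 31 := by simpa [passState] using hl
          exact wp_takeRight hs hν (stepped_right hM hj (fun _ _ => rfl) rfl le_rfl (fun _ => h2 hl) (by simp))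
        · intro hl'
          have hl' : ν 31 ≤ ν 30 := by simpa [passState] using hl'
          refine (wp_compareStep hs hν hM hi hj (le_antisymm hl hl') (hd _ _ (by omega) (by omega) (by omega))).mono ?_
          rintro s' t q ⟨ν', out', ol', pot', h1, h2, h3, h4, h5, h6, h7⟩
          exact ⟨ν', out', ol', pot', h1, h2, h3, h4, by simp; omega, h6, h7⟩
    · intro hj
      have hj : ¬ ν 28 < ν 29 := by simpa [passState] using hj
      exact wp_takeLeft hs hν (stepped_left hM hi (fun _ _ => rfl) le_rfl (fun h => absurd h hj) (by simp))
  · intro hi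
    have hi : ¬ ν 26 < ν 27 := by simpa [passState] using hi
    exact wp_takeRight hs hν (stepped_right hM (by omega) (fun _ _ => rfl) rfl le_rfl
      (fun h => absurd h hi) (by simp))

theorem wp_newPair (hν : ∀ x < 25, ν x = s.natVar x)
    (h : ∀ ν', (∀ x < 26, ν' x = ν x) → ν' 26 = ν 25 → ν' 27 = min (ν 25 + s.natVar 24) (s.natVar 11) →
      ν' 28 = min (ν 25 + s.natVar 24) (s.natVar 11) →
      ν' 29 = min (ν 25 + 2 * s.natVar 24) (s.natVar 11) → ν' 30 = 0 → ν' 31 = 0 →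
      ∀ t ≤ 50, Post (passState s ν' out ol) t 0) :
    wp K newPair (passState s ν out ol) Post := by
  simp [newPair, passState, hν]
  refine h _ ?_ ?_ ?_ ?_ ?_ ?_ ?_ _ ?_
  · intro x hx
    simp [show x ≠ 26 by omega, show x ≠ 27 by omega, show x ≠ 28 by omega,
      show x ≠ 29 by omega, show x ≠ 30 by omega, show x ≠ 31 by omega]
  all_goals simp
  all_goals omega

/-- The term `r * m - ∑ ol` on both sides lets unused comparison budget pass from one pass to the
next, so that coordinate comparisons are paid once for the whole sort. -/
theorem wp_mergePass (hs : Buffers s) (h11 : s.natVar 11 = r) (h24 : s.natVar 24 = w) (hw : 0 < w)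
    (hruns : Runs s.key m w r (s.natMem (s.natVar 20)) (s.natMem (s.natVar 21)))
    (hd : ∀ x y, x < r → y < r → x ≠ y →
      ∃ l < m, s.key (s.natMem (s.natVar 20) x) l ≠ s.key (s.natMem (s.natVar 20) y) l)
    (h : ∀ ν out ol t, (∀ x < 25, ν x = s.natVar x) → Runs s.key m (2 * w) r out ol →
      (Finset.range r).image out = (Finset.range r).image (s.natMem (s.natVar 20)) →
      t + 60 * (r * m - ∑ q ∈ Finset.range r, ol q) ≤
        250 * r + 60 * (r * m - ∑ q ∈ Finset.range r, s.natMem (s.natVar 21) q) + 30 →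
      Post (passState s ν out ol) t 0) :
    wp K mergePass s Post := by
  unfold mergePass
  simp only [wp_seq, wp_setNat]
  have hst : ((s.setNatVar 25 (NatExp.eval s (.lit 0))).setNatVar 29
      (NatExp.eval (s.setNatVar 25 (NatExp.eval s (.lit 0))) (.lit 0))) =
      passState s (Function.update (Function.update s.natVar 25 0) 29 0)
        (s.natMem (s.natVar 22)) (s.natMem (s.natVar 23)) := by
    simp [passState]
  rw [hst]
  set src := s.natMem (s.natVar 20) with hsrc
  set sl := s.natMem (s.natVar 21) with hsl
  -- The budget is 250 for every entry still to be output and 60 for every unit of potential below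
  -- `r * m`. Equality of the variables `25` and `29` means that no merge is under way.
  refine (wp_loop (fun s' φ ψ => ∃ ν out ol pot, s' = passState s ν out ol ∧
    (∀ x < 25, ν x = s.natVar x) ∧ pot ≤ r * m ∧ φ = 250 * (r - ν 25) + 60 * (r * m - pot) ∧ ψ = 0 ∧
    ((ν 25 = ν 29 ∧ Between s.key m w r src sl out ol (ν 25) pot) ∨
      (ν 25 < ν 29 ∧ ∃ b, Merging s.key m w r src sl out ol b (ν 25)
      (ν 26) (ν 27) (ν 28) (ν 29) (ν 30) (ν 31) pot))) ?_
    (φ := 250 * r + 60 * (r * m - ∑ q ∈ Finset.range r, sl q)) (ψ := 0) ?_).mono ?_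
  · rintro s' φ ψ ⟨ν, out, ol, pot, rfl, hν, hpot, rfl, rfl, hinv⟩ hc
    have hkr : ν 25 < r := by simpa [passState, hν, h11] using hc
    rw [wp_seq]
    have step : ∀ ν' b pot' c, (∀ x < 26, ν' x = ν x) → pot' = pot → ν' 25 < ν' 29 → c ≤ 54 →
        Merging s.key m w r src sl out ol b (ν' 25)
          (ν' 26) (ν' 27) (ν' 28) (ν' 29) (ν' 30) (ν' 31) pot' →
        wp K (mergeStep.seq (.setNat 25 ((NatExp.var 25).add (.lit 1)))) (passState s ν' out ol)
          fun s₂ t₂ q₂ => ∃ φ' ψ', (∃ ν out ol pot, s₂ = passState s ν out ol ∧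
            (∀ x < 25, ν x = s.natVar x) ∧ pot ≤ r * m ∧ φ' = 250 * (r - ν 25) + 60 * (r * m - pot) ∧
            ψ' = 0 ∧ ((ν 25 = ν 29 ∧ Between s.key m w r src sl out ol (ν 25) pot) ∨
            (ν 25 < ν 29 ∧ ∃ b, Merging s.key m w r src sl out ol b (ν 25)
            (ν 26) (ν 27) (ν 28) (ν 29) (ν 30) (ν 31) pot))) ∧
            φ' + (c + t₂) + Test.cost (.natLt (.var 25) (.var 11)) + 1 ≤
              250 * (r - ν 25) + 60 * (r * m - pot) ∧ ψ' + (0 + q₂) ≤ 0 := by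
      intro ν' b pot' c hν' hpot' hlt hc hM
      subst hpot'
      have hν'' : ∀ x < 25, ν' x = s.natVar x := fun x hx => (hν' x (by omega)).trans (hν x hx)
      rw [wp_seq]
      refine (wp_mergeStep hs hν'' hM hlt hd).mono ?_
      rintro s₁ t q ⟨ν₁, out₁, ol₁, pot₁, rfl, g2, g3, g4, g5, g6, rfl⟩
      have hle := g3.pot_le hruns
      rw [wp_setNat]
      have e25 : ν₁ 25 = ν 25 := by rw [g2 25 (by omega), hν' 25 (by omega)]
      have e25' : ν' 25 = ν 25 := hν' 25 (by omega)
      rw [e25'] at g3 hlt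
      refine ⟨_, _, ⟨Function.update ν₁ 25 (ν₁ 25 + 1), out₁, ol₁, pot₁, ?_, ?_, hle, rfl, rfl, ?_⟩, ?_, ?_⟩
      · simp [passState]
      · intro x hx
        rw [Function.update_of_ne (by omega), g2 x (by omega), hν'' x hx]
      · simp only [Function.update_self, e25, Function.update_of_ne (show (26 : ℕ) ≠ 25 by decide),
          Function.update_of_ne (show (27 : ℕ) ≠ 25 by decide),
          Function.update_of_ne (show (28 : ℕ) ≠ 25 by decide),
          Function.update_of_ne (show (29 : ℕ) ≠ 25 by decide),
          Function.update_of_ne (show (30 : ℕ) ≠ 25 by decide),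
          Function.update_of_ne (show (31 : ℕ) ≠ 25 by decide)]
        rcases Nat.lt_or_ge (ν 25 + 1) (ν₁ 29) with hlt' | hge
        · exact Or.inr ⟨hlt', b, g3⟩
        · have : ν 25 + 1 = ν₁ 29 := by omega
          exact Or.inl ⟨this, g3.finish this⟩
      · simp [e25]
        omega
      · simp
    rw [wp_ite]
    constructor
    · intro hle
      have hle : ν 29 ≤ ν 25 := by simpa [passState] using hle
      obtain ⟨heq, hB⟩ : ν 25 = ν 29 ∧ Between s.key m w r src sl out ol (ν 25) pot := by
        rcases hinv with h | ⟨h, -⟩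
        · exact h
        · omega
      refine wp_newPair hν ?_
      intro ν' g0 g1 g2 g3 g4 g5 g6 t ht
      have e25 : ν' 25 = ν 25 := g0 25 (by omega)
      refine step ν' (ν 25) pot _ g0 rfl (by rw [e25, g4, h11, h24]; omega) (by simp; omega) ?_
      rw [e25, g1, g2, g3, g4, g5, g6, h11, h24]
      exact hB.start hruns hw hkr
    · intro hle
      have hle : ν 25 < ν 29 := by simpa [passState] using hle
      obtain ⟨-, b, hM⟩ := hinv.resolve_left (fun h => by omega)
      rw [wp_skip]
      exact step ν b pot _ (fun _ _ => rfl) rfl hle (by simp) hM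
  · refine ⟨_, _, _, ∑ q ∈ Finset.range r, sl q, rfl, ?_, ?_, ?_, rfl, Or.inl ⟨?_, ?_⟩⟩
    · intro x hx
      rw [Function.update_of_ne (by omega), Function.update_of_ne (by omega)]
    · simpa using hruns.sum_le (S := Finset.range r) (by simp)
    · simp
    · simp
    · refine ⟨by simp, by simp, fun q hq => by simp at hq, by simp, ?_⟩
      simp
  · rintro s' t q ⟨φ, ψ, ⟨ν, out, ol, pot, rfl, hν, hpot, rfl, rfl, hinv⟩, hc, ht, hq⟩
    have hkr : r ≤ ν 25 := by simpa [passState, hν, h11] using hc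
    obtain rfl : q = 0 := by omega
    have hB : Between s.key m w r src sl out ol r pot := by
      rcases hinv with ⟨h1, h2⟩ | ⟨h1, b, h2⟩
      · have := h2.kr
        rwa [show ν 25 = r by omega] at h2
      · have := h2.je_eq
        omega
    have hp := hB.pot_eq
    simp only [Finset.Ico_self, Finset.sum_empty, add_zero] at hp
    have := h ν out ol (1 + 1 + (1 + 1 + t)) hν hB.runs hB.image (by
      rw [← hp]
      simp at ht ⊢
      omega)
    simpa using this

end Pass

end RealRAM

namespace RealRAM

open ComplexIn

variable {n d : ℕ}

attribute [local simp] NatExp.eval RealExp.eval Test.Holds NatExp.cost RealExp.cost Test.cost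
  State.setNatVar State.setRealVar State.setNatCell State.setRealCell wp_skip wp_setNat wp_setReal
  wp_storeNat wp_storeReal wp_seq

theorem injOn_of_card_image {r : ℕ} {f : ℕ → ℕ} (h : ((Finset.range r).image f).card = r) {x y : ℕ}
    (hx : x < r) (hy : y < r) (hxy : f x = f y) : x = y := by
  have := Finset.card_image_iff.1 (h.trans (Finset.card_range r).symm)
  exact this (by simpa using hx) (by simpa using hy) hxy

/-- There are `⌈log₂ r⌉` passes of linear cost, and the prefix lengths never lose what they gained:
together `r log r + r m` rather than `r m log r`. -/
theorem wp_mergeSort {K : ComplexIn (Fin n) d} {s : State n} {m r : ℕ} {T : Finset ℕ}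
    (h11 : s.natVar 11 = r) (h0 : ∀ q < r, s.natMem 5 q = 0)
    (hT : (Finset.range r).image (s.natMem 4) = T) (hcard : T.card = r)
    (hd : ∀ x ∈ T, ∀ y ∈ T, x ≠ y → ∃ l < m, s.key x l ≠ s.key y l)
    {Post : State n → ℕ → ℕ → Prop}
    (h : ∀ ν μ t, (∀ x < 20, ν x = s.natVar x) → (∀ b, b < 4 ∨ 7 < b → μ b = s.natMem b) →
      ν 20 = 4 ∨ ν 20 = 6 → (Finset.range r).image (μ (ν 20)) = T →
      (∀ q, 0 < q → q < r → LexLt m (μ (ν 21) q) (s.key (μ (ν 20) (q - 1))) (s.key (μ (ν 20) q))) →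
      t ≤ Nat.clog 2 r * (250 * r + 60) + 60 * (r * m) + 60 →
      Post { s with natVar := ν, natMem := μ } t 0) :
    wp K mergeSort s Post := by
  unfold mergeSort
  simp only [wp_seq, wp_setNat]
  set s₀ : State n := ((((s.setNatVar 20 4).setNatVar 21 5).setNatVar 22 6).setNatVar 23 7).setNatVar 24 1
    with hs₀
  change wp K _ s₀ _
  refine (wp_loop (s := s₀) (fun s' φ ψ => ∃ ν μ e, s' = { s with natVar := ν, natMem := μ } ∧
    (∀ x < 20, ν x = s.natVar x) ∧ (∀ b, b < 4 ∨ 7 < b → μ b = s.natMem b) ∧ ν 24 = 2 ^ e ∧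
    ((ν 20 = 4 ∧ ν 21 = 5 ∧ ν 22 = 6 ∧ ν 23 = 7) ∨ (ν 20 = 6 ∧ ν 21 = 7 ∧ ν 22 = 4 ∧ ν 23 = 5)) ∧
    Runs s.key m (2 ^ e) r (μ (ν 20)) (μ (ν 21)) ∧ (Finset.range r).image (μ (ν 20)) = T ∧
    φ = (Nat.clog 2 r - e) * (250 * r + 60) + 60 * (r * m - ∑ q ∈ Finset.range r, μ (ν 21) q) ∧ ψ = 0)
    ?_ (φ := Nat.clog 2 r * (250 * r + 60) + 60 * (r * m)) (ψ := 0) ?_).mono ?_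
  · rintro s' φ ψ ⟨ν, μ, e, rfl, hν, hμ, h24, hbuf, hruns, himg, rfl, rfl⟩ hc
    have hlt : 2 ^ e < r := by simpa [h24, hν, h11] using hc
    have hkey : ∀ ν' μ', ν' 9 = ν 9 →
        State.key ({ s with natVar := ν', natMem := μ' } : State n) = s.key := by
      intro ν' μ' h9
      funext x l
      simp [State.key, h9, hν]
    rw [wp_seq]
    refine wp_mergePass (r := r) (w := 2 ^ e) (m := m) ?_ (by simpa [hν] using h11) h24 (by positivity) ?_ ?_ ?_
    · constructor <;> rcases hbuf with ⟨h1, h2, h3, h4⟩ | ⟨h1, h2, h3, h4⟩ <;> simp [h1, h2, h3, h4]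
    · rw [hkey _ _ rfl]; exact hruns
    · rw [hkey _ _ rfl]
      intro x y hx hy hxy
      refine hd _ ?_ _ ?_ fun h => hxy (injOn_of_card_image (by rw [himg, hcard]) hx hy h)
      · rw [← himg]; exact Finset.mem_image_of_mem _ (by simpa using hx)
      · rw [← himg]; exact Finset.mem_image_of_mem _ (by simpa using hy)
    · intro ν' out ol t hν' hruns' himg' ht
      rw [hkey _ _ rfl] at hruns'
      have hν'' : ∀ x < 25, ν' x = ν x := hν'
      simp only [wp_seq, wp_setNat]
      have e1 : ∀ M : ℕ → ℕ → ℕ, Function.update (Function.update M (ν 22) out) (ν 23) ol (ν 22) = out := by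
        intro M
        rw [Function.update_of_ne (by omega), Function.update_self]
      have hle : e < Nat.clog 2 r := (Nat.lt_clog_iff_pow_lt (by norm_num)).2 hlt
      refine ⟨_, _, ⟨Function.update (Function.update (Function.update (Function.update
        (Function.update (Function.update (Function.update ν' 25 (ν 20)) 26 (ν 21)) 20 (ν 22)) 21 (ν 23))
        22 (ν 20)) 23 (ν 21)) 24 (2 ^ (e + 1)),
        Function.update (Function.update μ (ν 22) out) (ν 23) ol, e + 1, ?_, ?_, ?_, ?_, ?_, ?_, ?_, rfl, rfl⟩,
        ?_, ?_⟩
      · simp [passState, hν'', h24]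
        congr 1
        ring
      · intro x hx
        simp [show x ≠ 20 by omega, show x ≠ 21 by omega, show x ≠ 22 by omega, show x ≠ 23 by omega,
          show x ≠ 24 by omega, show x ≠ 25 by omega, show x ≠ 26 by omega, hν'' x (by omega), hν x hx]
      · intro b hb
        rw [Function.update_of_ne (by omega), Function.update_of_ne (by omega), hμ b hb]
      · simp
      · simp; omega
      · simp [e1, pow_succ']
        exact hruns'
      · simp [e1]
        exact himg'.trans himg
      · simp
        obtain ⟨x, hx⟩ : ∃ x, Nat.clog 2 r - e = x + 1 := ⟨Nat.clog 2 r - e - 1, by omega⟩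
        have : Nat.clog 2 r - (e + 1) = x := by omega
        rw [hx, this, Nat.succ_mul x]
        simp only at ht
        omega
      · simp
  · refine ⟨_, _, 0, rfl, ?_, fun _ _ => rfl, ?_, ?_, ?_, ?_, ?_, rfl⟩
    · intro x hx
      simp [show x ≠ 20 by omega, show x ≠ 21 by omega, show x ≠ 22 by omega, show x ≠ 23 by omega,
          show x ≠ 24 by omega]
    · simp
    · simp
    · intro q hq
      simp [h0 q hq]
    · simpa [hs₀] using hT
    · have h5 : ∑ q ∈ Finset.range r, s.natMem 5 q = 0 :=
        Finset.sum_eq_zero fun q hq => h0 q (by simpa using hq)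
      simp [h5]
  · rintro s' t q ⟨φ, ψ, ⟨ν, μ, e, rfl, hν, hμ, h24, hbuf, hruns, himg, rfl, rfl⟩, hc, ht, hq⟩
    have hlt : r ≤ 2 ^ e := by simpa [h24, hν, h11] using hc
    obtain rfl : q = 0 := by omega
    refine h ν μ _ hν hμ (hbuf.imp And.left And.left) himg ?_ ?_
    -- The run length has reached `r`, so no positive position is the start of a run.
    · intro q hq hqr
      exact (hruns q hqr).2 fun hdvd => by
        have := Nat.le_of_dvd hq hdvd
        omega
    · simp at ht ⊢
      omega

end RealRAM

namespace RealRAM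

open ComplexIn

variable {n d : ℕ}

attribute [local simp] NatExp.eval RealExp.eval Test.Holds NatExp.cost RealExp.cost Test.cost
  State.setNatVar State.setRealVar State.setNatCell State.setRealCell wp_skip wp_setNat wp_setReal
  wp_storeNat wp_storeReal wp_seq

/-! ### Indegree queries -/

/-- The coefficient of the coordinate in variable `40` of the functional in the block in variable
`6`. -/
def coeffExp : RealExp := .load (.var 6) (.add (.var 0) (.var 40))

/-- Query the cofacets of the current simplex on which the functional in the block in variable `6` is
not positive, and subtract the number of those that are already known. -/
def query : Prog :=
  .seq (.setReal 2 (.lit 0)) <|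
  .seq (forLt 40 1 (.setReal 2 (.add (.var 2) (.mul coeffExp coeffExp)))) <|
  .seq (.setReal 2 (.sqrt (.var 2))) <|
  .seq (forLt 40 1 (.storeReal (.var 7) (.var 40) (.div coeffExp (.var 2)))) <|
  .seq (.indeg 17 (.var 2) (.var 8) (.var 7)) <|
  forLt 40 0 <|
    .ite (.and (.not (.natLe (.load (.var 2) (.add (.var 0) (.var 40))) (.lit 0)))
        (.realLe (.load (.var 6) (.var 40)) (.lit 0)))
      (.setNat 17 (.sub (.var 17) (.lit 1))) .skip

/-- The vertices outside of `σ` which form an unknown simplex with `σ`, according to a table. -/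
def unknown (K : ComplexIn (Fin n) d) (σ : Finset (Fin n)) (up : ℕ → ℕ) : Finset (Fin n) :=
  (K.link σ).filter fun w : Fin n => up (n + w) = 0

/-- The table of known cofacets removes their share from the indegree, so that the answer counts
exactly the unknown ones in the half-space. -/
theorem wp_query {K : ComplexIn (Fin n) d} {s : State n} (h0 : s.natVar 0 = n) (h1 : s.natVar 1 = d)
    (h67 : s.natVar 7 ≠ s.natVar 6) {σ : Finset (Fin n)}
    (hl : s.Lists (s.natVar 2) (s.natVar 8) σ) (hσ : σ ∈ K.faces)
    (hf : K.Affine (s.realMem (s.natVar 6))) (hv : ∀ u ∈ σ, s.realMem (s.natVar 6) u = 0)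
    (hne : ∃ w : Fin n, s.realMem (s.natVar 6) w ≠ 0)
    (hup : ∀ w : Fin n, s.natMem (s.natVar 2) (n + w) ≠ 0 → w ∈ K.link σ)
    {Post : State n → ℕ → ℕ → Prop}
    (h : ∀ ν ρ δ t, (∀ x < 40, x ≠ 17 → ν x = s.natVar x) → (∀ x ≠ 2, ρ x = s.realVar x) →
      ν 17 = ((unknown K σ (s.natMem (s.natVar 2))).filter
        fun w : Fin n => s.realMem (s.natVar 6) w ≤ 0).card →
      t ≤ 70 * (n + d) + 60 →
      Post { s with natVar := ν, realVar := ρ, realMem := Function.update s.realMem (s.natVar 7) δ } t 1) :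
    wp K query s Post := by
  classical
  set f := s.realMem (s.natVar 6) with hfdef
  set N2 := √(∑ j ∈ Finset.range d, f (n + j) ^ 2) with hN2
  unfold query
  rw [wp_seq, wp_setReal, wp_seq]
  refine (wp_forLt (by norm_num) 20 (fun k s' => s' = { s with
    natVar := Function.update s.natVar 40 k
    realVar := Function.update s.realVar 2 (∑ j ∈ Finset.range k, f (n + j) ^ 2) }) ?_ ?_).mono ?_
  · simp
  · rintro k s' hk rfl - -
    simp [coeffExp, h0, Finset.sum_range_succ, ← hfdef, pow_two]
  rintro s' t1 q ⟨-, -, rfl, ht1, rfl⟩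
  rw [wp_seq, wp_setReal, wp_seq]
  have e1 : ((s.setRealVar 2 (RealExp.eval s (.lit 0))).natVar 1) = d := h1
  rw [e1] at ht1 ⊢
  refine (wp_forLt (by norm_num) 20 (fun k s' => s' = { s with
    natVar := Function.update s.natVar 40 k
    realVar := Function.update s.realVar 2 N2
    realMem := Function.update s.realMem (s.natVar 7) fun j => if j < k then f (n + j) / N2 else
      s.realMem (s.natVar 7) j }) ?_ ?_).mono ?_
  · simp [hN2]
  · rintro k s' hk rfl - -
    simp [coeffExp, h0, h67.symm, ← hfdef]
    congr 1
    funext p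
    by_cases hp : p = k
    · subst hp; simp
    · rw [Function.update_of_ne hp]
      by_cases h1 : p < k
      · rw [if_pos h1, if_pos (by omega)]
      · rw [if_neg h1, if_neg (by omega)]
  rintro s' t2 q ⟨-, -, rfl, ht2, rfl⟩
  simp only [State.setRealVar, Function.update_of_ne (show (1 : ℕ) ≠ 40 by decide), h1] at ht2 ⊢
  rw [wp_seq]
  set δ : ℕ → ℝ := fun j => if j < d then f (n + j) / N2 else s.realMem (s.natVar 7) j with hδ
  set s1 : State n := { s with
    natVar := Function.update s.natVar 40 d
    realVar := Function.update s.realVar 2 N2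
    realMem := Function.update s.realMem (s.natVar 7) δ } with hs1
  have hvec : s1.vector d (s.natVar 7) = N2⁻¹ • coeffVec n d f := by
    ext j
    simp [State.vector, coeffVec, hs1, hδ]
    ring
  obtain ⟨w, hw⟩ := hne
  obtain ⟨hq1, hq2⟩ := hf.query (K.nonempty_of_mem σ hσ) hv hw hvec
  refine wp_indeg σ (by simpa [hs1, State.Lists] using hl) hσ (by simpa [hs1] using hq1) ?_
  have e3 : NatExp.eval s1 (.var 7) = s.natVar 7 := by simp [hs1]
  rw [e3, hq2]
  set X := ((K.link σ).filter fun w : Fin n => f w ≤ 0).card with hX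
  refine (wp_forLt (by norm_num) 20 (fun k s' => s' = { s1 with
    natVar := Function.update (Function.update s1.natVar 40 k) 17 (X - ((Finset.range k).filter
      fun w => s.natMem (s.natVar 2) (n + w) ≠ 0 ∧ f w ≤ 0).card) }) ?_ ?_).mono ?_
  · simp [Function.update_comm]
  · rintro k s' hk rfl - -
    rw [wp_ite]
    simp only [Finset.range_add_one, Finset.filter_insert]
    constructor
    · intro hc
      have hc : s.natMem (s.natVar 2) (n + k) ≠ 0 ∧ f k ≤ 0 := by
        simpa [hs1, h0, h67.symm, ← hfdef, Nat.pos_iff_ne_zero] using hc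
      rw [if_pos hc, Finset.card_insert_of_notMem (by simp)]
      simp [Function.update_comm, Nat.sub_sub]
    · intro hc
      have hc : ¬ (s.natMem (s.natVar 2) (n + k) ≠ 0 ∧ f k ≤ 0) := by
        simpa [hs1, h0, h67.symm, ← hfdef, Nat.pos_iff_ne_zero] using hc
      rw [if_neg hc]
      simp [Function.update_comm]
  · rintro s' t3 q ⟨-, -, rfl, ht3, rfl⟩
    have e4 : (s1.setNatVar 17 X).natVar 0 = n := by simp [hs1, h0]
    rw [e4] at ht3 ⊢
    -- Known cofacets belong to the link, so the truncated subtractions are exact.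
    have hcount : X = ((Finset.range n).filter
        fun w => s.natMem (s.natVar 2) (n + w) ≠ 0 ∧ f w ≤ 0).card +
        ((unknown K σ (s.natMem (s.natVar 2))).filter fun w : Fin n => f w ≤ 0).card := by
      have e5 : ((Finset.range n).filter fun w => s.natMem (s.natVar 2) (n + w) ≠ 0 ∧ f w ≤ 0).card =
          (((K.link σ).filter fun w : Fin n => f w ≤ 0).filter
            fun w : Fin n => ¬ s.natMem (s.natVar 2) (n + w) = 0).card := by
        symm
        refine Finset.card_bij (fun w _ => (w : ℕ)) ?_ (fun _ _ _ _ h => Fin.ext h) ?_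
        · intro w hw
          simp only [Finset.mem_filter, Finset.mem_range] at hw ⊢
          exact ⟨w.2, hw.2, hw.1.2⟩
        · intro w hw
          simp only [Finset.mem_filter, Finset.mem_range] at hw
          refine ⟨⟨w, hw.1⟩, ?_, rfl⟩
          simp only [Finset.mem_filter]
          exact ⟨⟨hup ⟨w, hw.1⟩ hw.2.1, hw.2.2⟩, hw.2.1⟩
      have e6 : ((unknown K σ (s.natMem (s.natVar 2))).filter fun w : Fin n => f w ≤ 0).card =
          (((K.link σ).filter fun w : Fin n => f w ≤ 0).filter
            fun w : Fin n => s.natMem (s.natVar 2) (n + w) = 0).card := by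
        rw [unknown, Finset.filter_comm]
      rw [e5, e6, hX, add_comm, Finset.card_filter_add_card_filter_not]
    have := h (Function.update (Function.update s1.natVar 40 n) 17 (X - ((Finset.range n).filter
      fun w => s.natMem (s.natVar 2) (n + w) ≠ 0 ∧ f w ≤ 0).card)) s1.realVar δ
    simp only [hs1] at this ⊢
    refine this _ ?_ ?_ ?_ ?_
    · intro x hx hx'
      simp [hx', show x ≠ 40 by omega]
    · intro x hx
      simp [hx]
    · rw [Function.update_self]; omega
    · simp at ht1 ht2 ht3 ⊢
      omega

end RealRAM

namespace RealRAM

open ComplexIn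

variable {n d : ℕ}

attribute [local simp] NatExp.eval RealExp.eval Test.Holds NatExp.cost RealExp.cost Test.cost
  State.setNatVar State.setRealVar State.setNatCell State.setRealCell wp_skip wp_setNat wp_setReal
  wp_storeNat wp_storeReal wp_seq

/-! ### Preparation of the search in a simplex -/

/-- One elimination step: the functionals of a simplex from those of its parent. -/
noncomputable def eliminate (f : ℕ → ℝ) (B : ℕ → ℕ → ℝ) (u : ℕ) (j p : ℕ) : ℝ :=
  B (j + 1) p - B (j + 1) u / f u * f p

/-- The real memory in which the first `k` functionals of the simplex with the real block `rb` have
been computed from those of its parent with the real block `pb`. -/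
noncomputable def elimMem (mem : ℕ → ℕ → ℝ) (rb pb u N k : ℕ) : ℕ → ℕ → ℝ := fun b =>
  if rb < b ∧ b < rb + 1 + k then
    fun p => if p < N then eliminate (mem pb) (fun j => mem (pb + 1 + j)) u (b - (rb + 1)) p else mem b p
  else mem b

/-- Compute the functionals of the current simplex from those of its parent. -/
def materialize : Prog :=
  -- The last listed vertex is the one that was added to the parent; the facet opposite to it, in
  -- cell `2 n + len - 1`, is the parent.
  .seq (.setNat 30 (.load (.var 2)
    (.sub (.add (.add (.var 0) (.var 0)) (.var 8)) (.lit 1)))) <|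
  .seq (.setNat 31 (.load (.lit 3) (.var 30))) <|
  .seq (.setNat 32 (.load (.var 2) (.sub (.var 8) (.lit 1)))) <|
  forLt 33 10 <|
    .seq (.setNat 34 (.add (.add (.var 9) (.lit 1)) (.var 33))) <|
    -- The offset `2` skips the functional `f` of the parent and its `B 0`, which the elimination
    -- drops.
    .seq (.setNat 35 (.add (.add (.var 31) (.lit 2)) (.var 33))) <|
    .seq (.setReal 1 (.div (.load (.var 35) (.var 32)) (.load (.var 31) (.var 32)))) <|
    axpy 34 35 31 1 19

/-- The blocks of the parent end before those of the simplex, so the sources survive all writes. -/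
theorem wp_materialize {K : ComplexIn (Fin n) d} {s : State n} {rb pb m N u : ℕ}
    (hrb : s.natVar 9 = rb) (hm : s.natVar 10 = m) (hN : s.natVar 19 = N)
    (hpb : s.natMem 3 (s.natMem (s.natVar 2) (s.natVar 0 + s.natVar 0 + s.natVar 8 - 1)) = pb)
    (hu : s.natMem (s.natVar 2) (s.natVar 8 - 1) = u) (hdis : pb + m + 1 ≤ rb)
    {Post : State n → ℕ → ℕ → Prop}
    (h : ∀ ν ρ t, (∀ x < 30, ν x = s.natVar x) → (∀ x ≠ 1, ρ x = s.realVar x) →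
      t ≤ m * (21 * N + 50) + 40 →
      Post { s with natVar := ν, realVar := ρ, realMem := elimMem s.realMem rb pb u N m } t 0) : wp K materialize s Post := by
  unfold materialize
  simp only [wp_seq, wp_setNat]
  set s1 : State n := ((s.setNatVar 30 _).setNatVar 31 _).setNatVar 32 _ with hs1
  have e30 : s1 = { s with natVar := s1.natVar } := rfl
  have e31 : ∀ x < 30, s1.natVar x = s.natVar x := by
    intro x hx
    simp [hs1, show x ≠ 30 by omega, show x ≠ 31 by omega, show x ≠ 32 by omega]
  have e32 : s1.natVar 31 = pb := by simp [hs1, hpb]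
  have e33 : s1.natVar 32 = u := by simp [hs1, hu]
  clear_value s1
  refine (wp_forLt (by norm_num) (21 * N + 40) (fun k s' => ∃ ν ρ, (∀ x < 33, ν x = s1.natVar x) ∧
    (∀ x ≠ 1, ρ x = s.realVar x) ∧
    s' = { s with natVar := ν, realVar := ρ, realMem := elimMem s.realMem rb pb u N k }) ?_ ?_).mono ?_
  · refine ⟨Function.update s1.natVar 33 0, s.realVar, ?_, fun _ _ => rfl, ?_⟩
    · intro x hx
      rw [Function.update_of_ne (by omega)]
    · rw [e30]
      simp
      funext b
      rw [elimMem, if_neg (by omega)]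
  · rintro k s' hk ⟨ν, ρ, hν, hρ, rfl⟩ h33 -
    have h33 : ν 33 = k := h33
    have hkm : k < m := by rwa [e31 10 (by norm_num), hm] at hk
    have hν' : ∀ x < 30, ν x = s.natVar x := fun x hx => (hν x (by omega)).trans (e31 x hx)
    have m9 := (hν' 9 (by norm_num)).trans hrb
    have m31 := (hν 31 (by norm_num)).trans e32
    have m32 := (hν 32 (by norm_num)).trans e33
    simp only [wp_seq, wp_setNat, wp_setReal]
    refine wp_axpy (by norm_num) (by norm_num) (by norm_num) (by norm_num) ?_
    intro t ht
    simp [hν' 19, hN] at ht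
    refine ⟨?_, ?_, ⟨Function.update (Function.update (Function.update (Function.update ν 34 (rb + 1 + k))
      35 (pb + 2 + k)) 40 N) 33 (k + 1), Function.update ρ 1 (s.realMem (pb + 1 + (k + 1)) u / s.realMem pb u),
      ?_, ?_, ?_⟩, ?_, ?_⟩
    · simp [h33]
    · simp [hν' 10, e31 10]
    · intro x hx
      simp [show x ≠ 33 by omega, show x ≠ 34 by omega, show x ≠ 35 by omega, show x ≠ 40 by omega, hν x hx]
    · intro x hx
      simp [hx, hρ x hx]
    · have b3 : pb + 1 + (k + 1) = pb + 2 + k := by omega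
      have a1 : elimMem s.realMem rb pb u N k pb = s.realMem pb := if_neg (by omega)
      have a2 : elimMem s.realMem rb pb u N k (pb + 2 + k) = s.realMem (pb + 2 + k) := if_neg (by omega)
      have a3 : elimMem s.realMem rb pb u N k (rb + 1 + k) = s.realMem (rb + 1 + k) := if_neg (by omega)
      simp [m9, m31, m32, h33, hν' 19, hN, a1, a2, a3, b3]
      funext b
      by_cases hb : b = rb + 1 + k
      · subst hb
        rw [Function.update_self, elimMem, if_pos (by omega)]
        funext p
        simp [eliminate, b3]
      · rw [Function.update_of_ne hb]
        unfold elimMem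
        by_cases hb' : rb < b ∧ b < rb + 1 + k
        · rw [if_pos hb', if_pos (by omega)]
        · rw [if_neg hb', if_neg (by omega)]
    · simp; omega
    · simp
  · rintro s' t q ⟨-, -, ⟨ν, ρ, hν, hρ, rfl⟩, ht, rfl⟩
    rw [e31 10 (by norm_num), hm] at ht ⊢
    refine h ν ρ _ (fun x hx => (hν x (by omega)).trans (e31 x hx)) hρ ?_
    simp at ht ⊢
    rw [show 21 * N + 40 + 9 = 21 * N + 49 by omega] at ht
    have : m * (21 * N + 49) ≤ m * (21 * N + 50) := Nat.mul_le_mul_left _ (by omega)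
    omega

/-- The difference of two keys. -/
def diffExp (a b h : ℕ) : RealExp := .sub (keyExp b h) (keyExp a h)

/-- Put into the real variable `0` a positive number that is small enough for the order of the
sorted vertices. -/
def chooseEps : Prog :=
  .seq (.setReal 0 (.lit 1)) <|
  .seq (.setNat 30 (.sub (.var 11) (.lit 1))) <|
  forLt 31 30 <|
    .seq (.setNat 32 (.load (.var 20) (.var 31))) <|
    .seq (.setNat 33 (.load (.var 20) (.add (.var 31) (.lit 1)))) <|
    .seq (.setNat 34 (.load (.var 21) (.add (.var 31) (.lit 1)))) <|
    .seq (.setReal 2 (.lit 0)) <|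
    -- Real variable `2` sums `1 + δ ^ 2`, a bound for `2 |δ|` that needs no absolute values.
    .seq (forLt 35 10
      (.setReal 2 (.add (.var 2) (.add (.lit 1) (.mul (diffExp 32 33 35) (diffExp 32 33 35)))))) <|
    .seq (.setReal 3 (.div (diffExp 32 33 34) (.var 2))) <|
    .ite (.realLe (.var 3) (.var 0)) (.setReal 0 (.var 3)) .skip

/-- The result is the minimum of `1` and, over consecutive vertices, of the gap at the first
difference divided by the sum of `1 + δ ^ 2`. This meets the hypothesis of `LexLt.sum_lt` for all
these pairs at once. -/
theorem wp_chooseEps {K : ComplexIn (Fin n) d} {s : State n} {r m : ℕ} {o l : ℕ → ℕ}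
    (hr : s.natVar 11 = r) (hm : s.natVar 10 = m) (ho : s.natMem (s.natVar 20) = o)
    (hl : s.natMem (s.natVar 21) = l)
    (hlex : ∀ q, 0 < q → q < r → LexLt m (l q) (s.key (o (q - 1))) (s.key (o q)))
    {Post : State n → ℕ → ℕ → Prop}
    (h : ∀ ν ρ t, (∀ x < 30, ν x = s.natVar x) → (∀ x, x ≠ 0 → x ≠ 2 → x ≠ 3 → ρ x = s.realVar x) →
      0 < ρ 0 → ρ 0 ≤ 1 →
      (∀ q, 0 < q → q < r → ρ 0 * ∑ i ∈ Finset.range m, (1 + (s.key (o q) i - s.key (o (q - 1)) i) ^ 2) ≤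
        s.key (o q) (l q) - s.key (o (q - 1)) (l q)) →
      t ≤ r * (80 * m + 120) + 30 →
      Post { s with natVar := ν, realVar := ρ } t 0) : wp K chooseEps s Post := by
  set W : ℕ → ℕ → ℝ := fun k m => ∑ i ∈ Finset.range m, (1 + (s.key (o (k + 1)) i - s.key (o k) i) ^ 2)
    with hW
  unfold chooseEps
  rw [wp_seq, wp_setReal, wp_seq, wp_setNat]
  refine (wp_forLt (by norm_num) (80 * m + 100) (fun k s' => ∃ ν ρ, (∀ x < 31, x ≠ 30 → ν x = s.natVar x) ∧
    (∀ x, x ≠ 0 → x ≠ 2 → x ≠ 3 → ρ x = s.realVar x) ∧ 0 < ρ 0 ∧ ρ 0 ≤ 1 ∧ (∀ q < k, ρ 0 * W q m ≤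
        s.key (o (q + 1)) (l (q + 1)) - s.key (o q) (l (q + 1))) ∧
    s' = { s with natVar := ν, realVar := ρ }) ?_ ?_).mono ?_
  · refine ⟨_, _, ?_, ?_, ?_, ?_, fun q hq => absurd hq (Nat.not_lt_zero q), rfl⟩
    · intro x hx hx'
      simp [hx', show x ≠ 31 by omega]
    · intro x hx _ _
      simp [hx]
    · simp
    · simp
  · rintro k s' hk ⟨ν, ρ, hν, hρ, hpos, hle, hq, rfl⟩ h31 h30
    have h31 : ν 31 = k := h31
    have hkr : k + 1 < r := by simp [hr] at hk; omega
    have hk0 := hlex (k + 1) (by omega) hkr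
    rw [Nat.add_sub_cancel] at hk0
    have m20 : s.natMem (ν 20) = o := by rw [hν 20 (by norm_num) (by norm_num), ho]
    have m21 : s.natMem (ν 21) = l := by rw [hν 21 (by norm_num) (by norm_num), hl]
    have m9 : ν 9 = s.natVar 9 := hν 9 (by norm_num) (by norm_num)
    have m10 : ν 10 = m := (hν 10 (by norm_num) (by norm_num)).trans hm
    simp only [wp_seq, wp_setNat, wp_setReal]
    set ν1 : ℕ → ℕ := Function.update (Function.update (Function.update ν 32 (o k)) 33 (o (k + 1))) 34 (l (k + 1))
      with hν1
    refine (wp_forLt (by norm_num) 70 (fun i s' => s' = { s with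
      natVar := Function.update ν1 35 i
      realVar := Function.update ρ 2 (W k i) }) ?_ ?_).mono ?_
    · simp [hν1, hW, m20, m21, h31]
    · rintro i s' hi rfl - -
      rw [wp_setReal]
      refine ⟨?_, ?_, ?_, ?_, rfl⟩
      · simp
      · simp [hν1]
      · simp [hν1, hW, diffExp, keyExp, m9, Finset.sum_range_succ, State.key, pow_two]
      · simp [diffExp, keyExp]
    · rintro s' t q ⟨-, -, rfl, ht, rfl⟩
      simp only [State.setRealVar, State.setNatVar, Function.update_of_ne (show (10 : ℕ) ≠ 32 by decide),
        Function.update_of_ne (show (10 : ℕ) ≠ 33 by decide), Function.update_of_ne (show (10 : ℕ) ≠ 34 by decide),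
        m10] at ht ⊢
      have hWpos : 0 < W k m := by
        refine Finset.sum_pos (fun i _ => by positivity) ⟨0, ?_⟩
        have := hk0.1
        simp; omega
      set e : ℝ := (s.key (o (k + 1)) (l (k + 1)) - s.key (o k) (l (k + 1))) / W k m with he
      have hepos : 0 < e := div_pos (sub_pos.2 hk0.2.2) hWpos
      have hee : e * W k m = s.key (o (k + 1)) (l (k + 1)) - s.key (o k) (l (k + 1)) :=
        div_mul_cancel₀ _ hWpos.ne'
      have heval : RealExp.eval ({ s with
          natVar := Function.update ν1 35 m
          realVar := Function.update ρ 2 (W k m) } : State n) ((diffExp 32 33 34).div (.var 2)) = e := by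
        simp [hν1, diffExp, keyExp, m9, State.key, he]
      have hWnn : ∀ q, 0 ≤ W q m := fun q => Finset.sum_nonneg fun i _ => by positivity
      rw [wp_ite]
      simp only [heval, wp_setReal, wp_skip]
      have hνx : ∀ x < 31, x ≠ 30 → Function.update (Function.update ν1 35 m) 31 (k + 1) x = s.natVar x := by
        intro x hx hx'
        simp [hν1, show x ≠ 31 by omega, show x ≠ 32 by omega, show x ≠ 33 by omega, show x ≠ 34 by omega,
          show x ≠ 35 by omega, hν x hx hx']
      have n31 : Function.update ν1 35 m 31 = k := by simp [hν1, h31]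
      have n30 : Function.update ν1 35 m 30 = s.natVar 11 - 1 := by simpa [hν1] using h30
      constructor
      · intro hc
        have hc : e ≤ ρ 0 := by simpa using hc
        refine ⟨n31, ?_, ⟨_, Function.update (Function.update (Function.update ρ 2 (W k m)) 3 e) 0 e, hνx, ?_, ?_, ?_, ?_, ?_⟩, ?_, ?_⟩
        · simpa using n30
        · intro x h1 h2 h3
          simp [h1, h2, h3, hρ x h1 h2 h3]
        · simpa using hepos
        · simpa using hc.trans hle
        · intro q hq'
          rw [Function.update_self]
          rcases Nat.lt_succ_iff_lt_or_eq.1 hq' with h' | rfl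
          · exact (mul_le_mul_of_nonneg_right hc (hWnn q)).trans (hq q h')
          · exact hee.le
        · simp
        · simp [diffExp, keyExp]; omega
        · simp
      · intro hc
        have hc : ρ 0 ≤ e := by simpa using (not_le.1 (by simpa using hc)).le
        refine ⟨n31, ?_, ⟨_, Function.update (Function.update ρ 2 (W k m)) 3 e, hνx, ?_, ?_, ?_, ?_, ?_⟩, ?_, ?_⟩
        · simpa using n30
        · intro x h1 h2 h3
          simp [h2, h3, hρ x h1 h2 h3]
        · simpa using hpos
        · simpa using hle
        · intro q hq'
          rcases Nat.lt_succ_iff_lt_or_eq.1 hq' with h' | rfl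
          · simpa using hq q h'
          · simpa using (mul_le_mul_of_nonneg_right hc (hWnn q)).trans hee.le
        · simp
        · simp [diffExp, keyExp]; omega
        · simp
  · rintro s' t q ⟨-, -, ⟨ν, ρ, hν, hρ, hpos, hle, hq, rfl⟩, ht, rfl⟩
    simp [hr] at ht hq
    refine h ν ρ _ (fun x hx => hν x (by omega) (by omega)) hρ hpos hle ?_ ?_
    · intro q h0 hqr
      obtain ⟨q, rfl⟩ : ∃ q', q = q' + 1 := ⟨q - 1, by omega⟩
      exact hq q (by omega)
    · have h1 : (r - 1) * (80 * m + 100 + 9) ≤ r * (80 * m + 120) := Nat.mul_le_mul (by omega) (by omega)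
      simp
      omega

/-- Compute the functional with strictly increasing slopes on the sorted vertices, in the block in
variable `5`. At the root, most coefficients of the functionals are zero and are skipped. -/
def combine : Prog :=
  .seq (forLt 40 19 (.storeReal (.var 5) (.var 40) (.lit 0))) <|
  .seq (.ite (.natLe (.var 8) (.lit 0)) (.setNat 18 (.var 0)) (.setNat 18 (.var 19))) <|
  -- The variable holds `-ε ^ k`, because `axpy` subtracts.
  .seq (.setReal 2 (.lit (-1))) <|
  forLt 30 10 <|
    .seq (.setNat 31 (.add (.add (.var 9) (.lit 1)) (.var 30))) <|
    .seq (axpy 5 5 31 2 18) <|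
    .seq (.ite (.natLe (.var 8) (.lit 0))
      (.storeReal (.var 5) (.add (.var 0) (.var 30)) (.sub (.lit 0) (.var 2))) .skip) <|
    .setReal 2 (.mul (.var 2) (.var 0))

/-- At the empty simplex `B k` has the `k`-th unit vector as coefficients, so a single coefficient
is written per round and a round costs `O(n)`. Otherwise the root would cost `d ^ 2` steps, which
the claimed bound does not allow for a complex consisting of vertices only. -/
theorem wp_combine {K : ComplexIn (Fin n) d} {s : State n} {rb m tb len : ℕ}
    (h0 : s.natVar 0 = n) (h5 : s.natVar 5 = tb) (h8 : s.natVar 8 = len) (h19 : s.natVar 19 = n + d)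
    (hrb : s.natVar 9 = rb) (hm : s.natVar 10 = m) (htb : tb < rb)
    (hroot : len = 0 → ∀ j < m, ∀ i < d, s.realMem (rb + 1 + j) (n + i) = if i = j then 1 else 0)
    {Post : State n → ℕ → ℕ → Prop}
    (h : ∀ ν ρ τ t, (∀ x < 30, x ≠ 18 → ν x = s.natVar x) → (∀ x, x ≠ 2 → ρ x = s.realVar x) →
      (∀ p < n + d, τ p = ∑ j ∈ Finset.range m, s.realVar 0 ^ j * s.realMem (rb + 1 + j) p) →
      t ≤ m * (21 * (if len = 0 then n else n + d) + 60) + 20 * (n + d) + 50 →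
      Post { s with natVar := ν, realVar := ρ, realMem := Function.update s.realMem tb τ } t 0) :
    wp K combine s Post := by
  set ε := s.realVar 0 with hε
  set P := if len = 0 then n else n + d with hP
  unfold combine
  rw [wp_seq]
  refine (wp_forLt (by norm_num) 11 (fun k s' => s' = { s with
    natVar := Function.update s.natVar 40 k
    realMem := Function.update s.realMem tb fun p => if p < k then 0 else s.realMem tb p }) ?_ ?_).mono ?_
  · simp
  · rintro k s' hk rfl - -
    simp [h5]
    congr 1
    funext p
    by_cases hp : p = k
    · subst hp; simp
    · rw [Function.update_of_ne hp]
      by_cases h1 : p < k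
      · rw [if_pos h1, if_pos (by omega)]
      · rw [if_neg h1, if_neg (by omega)]
  rintro s' t1 q ⟨-, -, rfl, ht1, rfl⟩
  rw [h19] at ht1 ⊢
  rw [wp_seq]
  set s1 : State n := { s with
    natVar := Function.update s.natVar 40 (n + d)
    realMem := Function.update s.realMem tb fun p => if p < n + d then 0 else s.realMem tb p } with hs1
  have hite : ∀ Post : State n → ℕ → ℕ → Prop, (∀ t ≤ 20, Post (s1.setNatVar 18 P) t 0) →
      wp K (.ite (.natLe (.var 8) (.lit 0)) (.setNat 18 (.var 0)) (.setNat 18 (.var 19))) s1 Post := by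
    intro Post hp
    rw [wp_ite]
    constructor
    · intro hc
      have hc : len = 0 := by simpa [hs1, h8] using hc
      have := hp 6 (by norm_num)
      simpa [hs1, h0, hP, hc] using this
    · intro hc
      have hc : ¬ len = 0 := by simpa [hs1, h8] using hc
      have := hp 6 (by norm_num)
      simpa [hs1, h19, hP, hc] using this
  refine hite _ fun t2 ht2 => ?_
  rw [wp_seq, wp_setReal]
  refine (wp_forLt (by norm_num) (21 * P + 40) (fun k s' => ∃ ν ρ τ, (∀ x < 30, x ≠ 18 → ν x = s.natVar x) ∧
    ν 18 = P ∧ (∀ x, x ≠ 2 → ρ x = s.realVar x) ∧ ρ 2 = -ε ^ k ∧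
    (∀ p < n + d, τ p = ∑ j ∈ Finset.range k, ε ^ j * s.realMem (rb + 1 + j) p) ∧
    s' = { s with natVar := ν, realVar := ρ, realMem := Function.update s.realMem tb τ }) ?_ ?_).mono ?_
  · refine ⟨_, _, _, ?_, ?_, ?_, ?_, ?_, rfl⟩
    · intro x hx hx'
      simp [hs1, hx', show x ≠ 30 by omega, show x ≠ 40 by omega]
    · simp
    · intro x hx
      simp [hs1, hx]
    · simp
    · intro p hp
      simp [hp]
  · rintro k s' hk ⟨ν, ρ, τ, hν, h18, hρ, hρ2, hτ, rfl⟩ h30 -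
    have h30 : ν 30 = k := h30
    have hkm : k < m := by simpa [hs1, hm] using hk
    rw [wp_seq, wp_setNat, wp_seq]
    refine wp_axpy (by norm_num) (by norm_num) (by norm_num) (by norm_num) ?_
    intro t ht
    simp [h18] at ht
    have m5 : ν 5 = tb := by rw [hν 5 (by norm_num) (by norm_num), h5]
    have m9 : ν 9 = rb := by rw [hν 9 (by norm_num) (by norm_num), hrb]
    have m8 : ν 8 = len := by rw [hν 8 (by norm_num) (by norm_num), h8]
    have m0 : ν 0 = n := by rw [hν 0 (by norm_num) (by norm_num), h0]
    have m10 : ν 10 = s.natVar 10 := hν 10 (by norm_num) (by norm_num)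
    have hne : rb + 1 + k ≠ tb := by omega
    have hρ0 : ρ 0 = ε := hρ 0 (by norm_num)
    rw [wp_seq, wp_ite]
    have hνx : ∀ x < 30, x ≠ 18 →
        Function.update (Function.update (Function.update ν 31 (rb + 1 + k)) 40 P) 30 (k + 1) x = s.natVar x := by
      intro x hx hx'
      simp [show x ≠ 30 by omega, show x ≠ 31 by omega, show x ≠ 40 by omega, hν x hx hx']
    have hρx : ∀ x, x ≠ 2 → Function.update ρ 2 (ρ 2 * ρ 0) x = s.realVar x := by
      intro x hx
      rw [Function.update_of_ne hx, hρ x hx]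
    constructor
    · intro hc
      have hc : len = 0 := by simpa [m8] using hc
      have hPn : P = n := by simp [hP, hc]
      rw [wp_storeReal, wp_setReal]
      refine ⟨by simp [h30], by simp [hs1, m10], ⟨_, _, Function.update
        (fun p => if p < P then τ p - ρ 2 * s.realMem (rb + 1 + k) p else τ p) (n + k) (-ρ 2), hνx, ?_, hρx, ?_, ?_, ?_⟩, ?_, ?_⟩
      · simp [h18]
      · simp [hρ0, hρ2, pow_succ]
      · intro p hp
        rw [Finset.sum_range_succ]
        by_cases hpn : p < n
        · rw [Function.update_of_ne (by omega), if_pos (by omega), hτ p hp, hρ2]; ring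
        · obtain ⟨i, rfl⟩ : ∃ i, p = n + i := ⟨p - n, by omega⟩
          by_cases hik : i = k
          · subst hik
            rw [Function.update_self, hρ2, hroot hc i hkm i (by omega), if_pos rfl,
              Finset.sum_eq_zero fun j hj => by
                have : j < i := by simpa using hj
                rw [hroot hc j (by omega) i (by omega), if_neg (by omega), mul_zero]]
            ring
          · rw [Function.update_of_ne (by omega), if_neg (by omega), hτ _ hp,
              hroot hc k hkm i (by omega), if_neg hik, mul_zero, add_zero]
      · simp [m5, m9, m0, h30, h18, hne]
      · simp; omega
      · simp
    · intro hc
      have hc : ¬ len = 0 := by simpa [m8] using hc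
      have hPn : P = n + d := by simp [hP, hc]
      rw [wp_skip, wp_setReal]
      refine ⟨by simp [h30], by simp [hs1, m10], ⟨_, _,
        (fun p => if p < P then τ p - ρ 2 * s.realMem (rb + 1 + k) p else τ p), hνx, ?_, hρx, ?_, ?_, ?_⟩, ?_, ?_⟩
      · simp [h18]
      · simp [hρ0, hρ2, pow_succ]
      · intro p hp
        rw [Finset.sum_range_succ]
        simp only
        rw [if_pos (by omega), hτ p hp, hρ2]; ring
      · simp [m5, m9, h30, h18, hne]
      · simp; omega
      · simp
  · rintro s' t q ⟨-, -, ⟨ν, ρ, τ, hν, h18, hρ, hρ2, hτ, rfl⟩, ht, rfl⟩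
    simp [hs1, hm] at ht hτ
    refine h ν ρ τ _ hν hρ hτ ?_
    simp
    have : m * (21 * P + 40 + 9) ≤ m * (21 * P + 60) := Nat.mul_le_mul_left _ (by omega)
    omega

end RealRAM

namespace RealRAM

open ComplexIn

variable {n d : ℕ}

attribute [local simp] NatExp.eval RealExp.eval Test.Holds NatExp.cost RealExp.cost Test.cost
  State.setNatVar State.setRealVar State.setNatCell State.setRealCell wp_skip wp_setNat wp_setReal
  wp_storeNat wp_storeReal wp_seq

/-! ### Search for the cofacets of a simplex -/

/-- Binary search for the first unknown cofacet between the places in the variables `14` and `15`. -/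
def searchLoop : Prog :=
  .loop (.natLt (.add (.var 14) (.lit 1)) (.var 15)) <|
    .seq (.setNat 30 (.half (.add (.var 14) (.var 15)))) <|
    .seq (.setNat 31 (.load (.var 20) (.sub (.var 30) (.lit 1)))) <|
    .seq (.setReal 1 (.div (.load (.var 5) (.var 31)) (.load (.var 9) (.var 31)))) <|
    .seq (axpy 6 5 9 1 19) <|
    .seq query <|
    .ite (.natLe (.var 17) (.lit 0)) (.setNat 14 (.var 30)) (.setNat 15 (.var 30))

/-- Put the place of the first unknown cofacet into variable `14`. -/
def findChild : Prog :=
  .seq (.setNat 14 (.var 13)) <| .seq (.setNat 15 (.var 11)) <|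
  -- If no more places are left than there are unknown cofacets, the first place must be one of them
  -- and no query is made. At the empty simplex, where queries are illegal, this is always the case.
  .ite (.natLe (.sub (.var 11) (.var 13)) (.var 12)) .skip searchLoop

/-- The state is ready for a search among the cofacets of the simplex `σ`: the vertices in the places
before `r` of the list `o` are sorted by their slopes `t / f`. -/
structure Ready (K : ComplexIn (Fin n) d) (s : State n) (σ : Finset (Fin n)) (p rb r : ℕ) (o : ℕ → ℕ)
    (f t : ℕ → ℝ) : Prop where
  h0 : s.natVar 0 = n
  h1 : s.natVar 1 = d
  h2 : s.natVar 2 = p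
  h5 : s.natVar 5 = n
  h6 : s.natVar 6 = n + 1
  h7 : s.natVar 7 = n + 2
  h8 : s.natVar 8 = σ.card
  h9 : s.natVar 9 = rb
  h11 : s.natVar 11 = r
  h19 : s.natVar 19 = n + d
  h20 : s.natMem (s.natVar 20) = o
  rb_le : n + 3 ≤ rb
  f_eq : s.realMem rb = f
  t_eq : s.realMem n = t
  f_affine : K.Affine f
  t_affine : K.Affine t
  f_zero : ∀ v ∈ σ, f v = 0
  t_zero : ∀ v ∈ σ, t v = 0
  o_lt : ∀ i < r, o i < n
  f_pos : ∀ i < r, 0 < f (o i)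
  slopes : ∀ i j, i < j → j < r → t (o i) / f (o i) < t (o j) / f (o j)
  lists : s.Lists p σ.card σ
  up : ∀ w : Fin n, s.natMem p (n + w) ≠ 0 → w ∈ K.link σ

/-- The functional through place `i` is positive at all later places. This drives the binary search
and also gives the functional of a new simplex its sign on what remains. -/
theorem Ready.sub_pos {K : ComplexIn (Fin n) d} {s : State n} {σ : Finset (Fin n)} {p rb r : ℕ}
    {o : ℕ → ℕ} {f t : ℕ → ℝ} (h : Ready K s σ p rb r o f t) {i j : ℕ} (hij : i < j) (hj : j < r) :
    0 < t (o j) - t (o i) / f (o i) * f (o j) := by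
  have h1 := h.slopes i j hij hj
  have h2 := h.f_pos j hj
  rw [lt_div_iff₀ h2] at h1
  linarith

theorem Ready.sub_nonpos {K : ComplexIn (Fin n) d} {s : State n} {σ : Finset (Fin n)} {p rb r : ℕ}
    {o : ℕ → ℕ} {f t : ℕ → ℝ} (h : Ready K s σ p rb r o f t) {i j : ℕ} (hij : j ≤ i) (hi : i < r) :
    t (o j) - t (o i) / f (o i) * f (o j) ≤ 0 := by
  rcases hij.eq_or_lt with rfl | hlt
  · rw [div_mul_cancel₀ _ (h.f_pos j hi).ne', sub_self]
  · have h1 := h.slopes j i hlt hi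
    have h2 := h.f_pos j (hlt.trans hi)
    rw [div_lt_iff₀ h2] at h1
    linarith

theorem wp_congr_state {K : ComplexIn (Fin n) d} {s s' : State n} {p : Prog}
    {Post : State n → ℕ → ℕ → Prop} (h : s = s') (hp : wp K p s' Post) : wp K p s Post :=
  h ▸ hp

/-- The half-open interval between the variables `14` and `15` always contains the place of an
unknown cofacet, and no unknown cofacet lies before it. An interval of length one is the answer. -/
theorem wp_findChild {K : ComplexIn (Fin n) d} {s : State n} {σ : Finset (Fin n)} {p rb r lo N : ℕ}
    {o : ℕ → ℕ} {f t : ℕ → ℝ} (hs : Ready K s σ p rb r o f t) (h12 : s.natVar 12 = N)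
    (h13 : s.natVar 13 = lo) (hσ : σ ∈ K.faces ∨ r - lo ≤ N)
    (hN : (unknown K σ (s.natMem p)).card = N) (hN0 : 0 < N)
    (hU : ∀ w ∈ unknown K σ (s.natMem p), ∃ i, lo ≤ i ∧ i < r ∧ o i = w)
    {Post : State n → ℕ → ℕ → Prop}
    (h : ∀ ν ρ δ ε t q, (∀ x < 30, x ≠ 14 → x ≠ 15 → x ≠ 17 → ν x = s.natVar x) →
      (∀ (w : Fin n), w ∈ unknown K σ (s.natMem p) → ∃ i, ν 14 ≤ i ∧ i < r ∧ o i = w) →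
      lo ≤ ν 14 → ν 14 < r → (∃ w ∈ unknown K σ (s.natMem p), o (ν 14) = w) →
      t ≤ Nat.clog 2 r * (100 * (n + d) + 130) + 30 → q ≤ Nat.clog 2 r →
      Post { s with
        natVar := ν, realVar := ρ
        realMem := Function.update (Function.update s.realMem (n + 1) δ) (n + 2) ε } t q) :
    wp K findChild s Post := by
  have hlo : lo < r := by
    obtain ⟨w, hw⟩ := Finset.card_pos.1 (hN.symm ▸ hN0)
    obtain ⟨i, h1, h2, -⟩ := hU w hw
    omega
  have hid : Function.update (Function.update s.realMem (n + 1) (s.realMem (n + 1))) (n + 2)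
      (s.realMem (n + 2)) = s.realMem := by simp
  unfold findChild
  rw [wp_seq, wp_setNat, wp_seq, wp_setNat, wp_ite]
  set s1 : State n := (s.setNatVar 14 _).setNatVar 15 _ with hs1
  have e1 : s1 = { s with natVar := Function.update (Function.update s.natVar 14 lo) 15 r } := by
    simp [hs1, h13, hs.h11]
  constructor
  · intro hc
    have hc : r - lo ≤ N := by simpa [e1, h12, h13, hs.h11] using hc
    rw [wp_skip, e1]
    have := h (Function.update (Function.update s.natVar 14 lo) 15 r) s.realVar (s.realMem (n + 1))
      (s.realMem (n + 2)) 11 0 ?_ ?_ ?_ ?_ ?_ ?_ ?_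
    · rw [hid] at this
      exact this
    · intro x _ h14 h15 _
      simp [h14, h15]
    · intro w hw
      simpa using hU w hw
    · simp
    · simpa using hlo
    · simp only [Function.update_of_ne (show (14 : ℕ) ≠ 15 by decide), Function.update_self]
      -- Pigeonhole: if place `lo` were not that of an unknown cofacet, `N` of them would occupy
      -- fewer than `N` places.
      by_contra! hcon
      have hsub : (unknown K σ (s.natMem p)).image Fin.val ⊆ (Finset.Ico (lo + 1) r).image o := by
        intro x hx
        obtain ⟨w, hw, rfl⟩ := Finset.mem_image.1 hx
        obtain ⟨i, h1, h2, h3⟩ := hU w hw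
        have : i ≠ lo := by rintro rfl; exact hcon w hw h3
        exact Finset.mem_image.2 ⟨i, by simp; omega, h3⟩
      have h1 := Finset.card_le_card hsub
      rw [Finset.card_image_of_injective _ Fin.val_injective, hN] at h1
      have h2 := h1.trans Finset.card_image_le
      rw [Nat.card_Ico] at h2
      omega
    · omega
    · exact Nat.zero_le _
  · intro hc
    have hc : ¬ r - lo ≤ N := by simpa [e1, h12, h13, hs.h11] using hc
    have hσ := hσ.resolve_right hc
    rw [e1]
    set G := 100 * (n + d) + 130 with hG
    refine (wp_loop (fun s' φ ψ => ∃ ν ρ δ ε, s' = { s with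
        natVar := ν, realVar := ρ
        realMem := Function.update (Function.update s.realMem (n + 1) δ) (n + 2) ε } ∧
      (∀ x < 30, x ≠ 14 → x ≠ 15 → x ≠ 17 → ν x = s.natVar x) ∧ lo ≤ ν 14 ∧ ν 14 < ν 15 ∧ ν 15 ≤ r ∧
      (∀ w ∈ unknown K σ (s.natMem p), ∃ i, ν 14 ≤ i ∧ i < r ∧ o i = w) ∧
      (∃ w ∈ unknown K σ (s.natMem p), ∃ i, ν 14 ≤ i ∧ i < ν 15 ∧ o i = w) ∧
      φ = Nat.clog 2 (ν 15 - ν 14) * G ∧ ψ = Nat.clog 2 (ν 15 - ν 14)) ?_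
      (φ := Nat.clog 2 (r - lo) * G) (ψ := Nat.clog 2 (r - lo)) ?_).mono ?_
    · rintro s' φ ψ ⟨ν, ρ, δ, ε, rfl, hν, hla, hab, hbr, hU', ⟨w, hw, i, hi1, hi2, hi3⟩, rfl, rfl⟩ hc
      have hc : ν 14 + 1 < ν 15 := by simpa using hc
      set a := ν 14 with ha
      set b := ν 15 with hb
      set mid := (a + b) / 2 with hmid
      have h1m : a + 1 ≤ mid := by omega
      have h2m : mid < b := by omega
      -- Both halves have length at most the half of `b - a` rounded up, so a round lowers the
      -- rounded-up logarithm by one and pays for its single query.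
      have hclog : Nat.clog 2 (b - a) = Nat.clog 2 ((b - a + 1) / 2) + 1 := by
        rw [Nat.clog_of_two_le (by norm_num) (by omega), show b - a + 2 - 1 = b - a + 1 by omega]
      have m0 : ν 0 = n := (hν 0 (by norm_num) (by norm_num) (by norm_num) (by norm_num)).trans hs.h0
      have m1 : ν 1 = d := (hν 1 (by norm_num) (by norm_num) (by norm_num) (by norm_num)).trans hs.h1
      have m2 : ν 2 = p := (hν 2 (by norm_num) (by norm_num) (by norm_num) (by norm_num)).trans hs.h2
      have m5 : ν 5 = n := (hν 5 (by norm_num) (by norm_num) (by norm_num) (by norm_num)).trans hs.h5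
      have m6 : ν 6 = n + 1 := (hν 6 (by norm_num) (by norm_num) (by norm_num) (by norm_num)).trans hs.h6
      have m7 : ν 7 = n + 2 := (hν 7 (by norm_num) (by norm_num) (by norm_num) (by norm_num)).trans hs.h7
      have m8 : ν 8 = σ.card := (hν 8 (by norm_num) (by norm_num) (by norm_num) (by norm_num)).trans hs.h8
      have m9 : ν 9 = rb := (hν 9 (by norm_num) (by norm_num) (by norm_num) (by norm_num)).trans hs.h9
      have m19 : ν 19 = n + d := (hν 19 (by norm_num) (by norm_num) (by norm_num) (by norm_num)).trans hs.h19
      have m20 : s.natMem (ν 20) = o := by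
        rw [hν 20 (by norm_num) (by norm_num) (by norm_num) (by norm_num), hs.h20]
      have hrb := hs.rb_le
      have nrb1 : rb ≠ n + 1 := by omega
      have nrb2 : rb ≠ n + 2 := by omega
      -- With the slope at place `mid - 1`, the functional is nonpositive on the list exactly at the
      -- places before `mid`; its positive value at `mid` shows that it is not zero.
      set x0 := o (mid - 1) with hx0
      set c := t x0 / f x0 with hc0
      set g : ℕ → ℝ := fun p => if p < n + d then t p - c * f p else δ p with hg
      have gval : ∀ v : Fin n, g v = t v - c * f v := fun v => if_pos (by omega)
      rw [wp_seq, wp_setNat, wp_seq, wp_setNat, wp_seq, wp_setReal, wp_seq]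
      refine wp_axpy (by norm_num) (by norm_num) (by norm_num) (by norm_num) ?_
      intro t1 ht1
      rw [wp_seq]
      set s2 : State n := { s with
        natVar := Function.update (Function.update (Function.update ν 30 mid) 31 x0) 40 (n + d)
        realVar := Function.update ρ 1 c
        realMem := Function.update (Function.update s.realMem (n + 1) g) (n + 2) ε } with hs2
      refine wp_congr_state (s' := s2) ?_ ?_
      · have b2 : Function.update (Function.update s.realMem (n + 1) δ) (n + 2) ε rb = s.realMem rb := by
          simp [nrb1, nrb2]
        simp [hs2, m5, m6, m9, m19, m20, b2, hs.f_eq, hs.t_eq, ← ha, ← hb, ← hmid, ← hx0, ← hc0, ← hg]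
        rw [Function.update_comm (by omega), Function.update_idem]
      have g6 : s2.realMem (s2.natVar 6) = g := by simp [hs2, m6]
      have p2 : s2.natMem (s2.natVar 2) = s.natMem p := by simp [hs2, m2]
      have hxm : ∀ i < r, g (o i) = t (o i) - c * f (o i) := fun i hi =>
        gval ⟨o i, hs.o_lt i hi⟩
      refine wp_query (σ := σ) (by simp [hs2, m0]) (by simp [hs2, m1]) (by simp [hs2, m6, m7]) ?_ hσ ?_ ?_ ?_ ?_ ?_
      · have := hs.lists
        rw [State.Lists] at this ⊢
        rw [p2, this]
        simp [hs2, m8]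
      · rw [g6]
        exact (hs.t_affine.sub_mul hs.f_affine c).congr fun p hp => if_pos hp
      · intro u hu
        rw [g6, gval, hs.t_zero u hu, hs.f_zero u hu]; ring
      · refine ⟨⟨o mid, hs.o_lt _ (by omega)⟩, ?_⟩
        rw [g6]
        show g (o mid) ≠ 0
        rw [hxm _ (by omega)]
        exact (hs.sub_pos (by omega) (by omega)).ne'
      · intro w
        rw [p2]
        exact hs.up w
      intro ν' ρ' δ' tq hν' hρ' h17 htq
      rw [g6, p2] at h17
      have k14 : ν' 14 = a := by rw [hν' 14 (by norm_num) (by norm_num)]; simp [hs2, ha]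
      have k15 : ν' 15 = b := by rw [hν' 15 (by norm_num) (by norm_num)]; simp [hs2, hb]
      have k30 : ν' 30 = mid := by rw [hν' 30 (by norm_num) (by norm_num)]; simp [hs2]
      have kx : ∀ x < 30, x ≠ 14 → x ≠ 15 → x ≠ 17 → ν' x = s.natVar x := by
        intro x h1 h2 h3 h4
        rw [hν' x (by omega) h4]
        simp [hs2, show x ≠ 30 by omega, show x ≠ 31 by omega, show x ≠ 40 by omega, hν x h1 h2 h3 h4]
      have hmem : Function.update s2.realMem (s2.natVar 7) δ' =
          Function.update (Function.update s.realMem (n + 1) g) (n + 2) δ' := by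
        simp [hs2, m7]
      rw [hmem]
      simp [m19] at ht1
      have hclog1 : Nat.clog 2 (mid - a) ≤ Nat.clog 2 ((b - a + 1) / 2) :=
        Nat.clog_mono_right _ (by omega)
      have hclog2 : Nat.clog 2 (b - mid) ≤ Nat.clog 2 ((b - a + 1) / 2) :=
        Nat.clog_mono_right _ (by omega)
      have hG1 := Nat.mul_le_mul_right G hclog1
      have hG2 := Nat.mul_le_mul_right G hclog2
      rw [wp_ite]
      constructor
      · intro hc17
        have hc17 : ν' 17 = 0 := by simpa using hc17
        rw [hc17] at h17
        have hnone := Finset.filter_eq_empty_iff.1 (Finset.card_eq_zero.1 h17.symm)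
        have hge : ∀ i < r, ∀ w ∈ unknown K σ (s.natMem p), o i = w → mid ≤ i := by
          intro i hi w hw hiw
          by_contra! hlt
          refine hnone hw ?_
          rw [← hiw, hxm i hi]
          exact hs.sub_nonpos (by omega) (by omega)
        rw [wp_setNat]
        refine ⟨_, _, ⟨Function.update ν' 14 mid, ρ', g, δ', ?_, ?_, ?_, ?_, ?_, ?_, ?_, rfl, rfl⟩, ?_, ?_⟩
        · simp [hs2, k30]
        · intro x h1 h2 h3 h4
          rw [Function.update_of_ne h2, kx x h1 h2 h3 h4]
        · simp; omega
        · simp [k15]; omega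
        · simp [k15]; omega
        · intro w hw
          obtain ⟨i, h1, h2, h3⟩ := hU' w hw
          exact ⟨i, by simpa using hge i h2 w hw h3, h2, h3⟩
        · exact ⟨w, hw, i, by simpa using hge i (by omega) w hw hi3, by simpa [k15] using hi2, hi3⟩
        · simp [k15]
          rw [hclog, Nat.succ_mul]
          omega
        · simp [k15]
          omega
      · intro hc17
        have hc17 : 0 < ν' 17 := by simpa [Nat.pos_iff_ne_zero] using hc17
        rw [h17] at hc17
        obtain ⟨w', hw'⟩ := Finset.card_pos.1 hc17
        rw [Finset.mem_filter] at hw'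
        obtain ⟨hw', hgw'⟩ := hw'
        obtain ⟨i', hi1', hi2', hi3'⟩ := hU' w' hw'
        have hlt : i' < mid := by
          by_contra! hge
          rw [← hi3', hxm i' hi2'] at hgw'
          exact absurd hgw' (not_le.2 (hs.sub_pos (by omega) hi2'))
        rw [wp_setNat]
        refine ⟨_, _, ⟨Function.update ν' 15 mid, ρ', g, δ', ?_, ?_, ?_, ?_, ?_, ?_, ?_, rfl, rfl⟩, ?_, ?_⟩
        · simp [hs2, k30]
        · intro x h1 h2 h3 h4
          rw [Function.update_of_ne h3, kx x h1 h2 h3 h4]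
        · simp [k14]; omega
        · simp [k14]; omega
        · simp; omega
        · intro w hw
          simpa [k14] using hU' w hw
        · exact ⟨w', hw', i', by simpa [k14] using hi1', by simpa using hlt, hi3'⟩
        · simp [k14]
          rw [hclog, Nat.succ_mul]
          omega
        · simp [k14]
          omega
    · refine ⟨_, _, _, _, by rw [hid], ?_, ?_, ?_, ?_, ?_, ?_, ?_, ?_⟩
      · intro x _ h14 h15 _
        simp [h14, h15]
      · simp
      · simpa using hlo
      · simp
      · intro w hw
        simpa using hU w hw
      · obtain ⟨w, hw⟩ := Finset.card_pos.1 (hN.symm ▸ hN0)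
        exact ⟨w, hw, by simpa using hU w hw⟩
      · simp
      · simp
    · rintro s' t' q ⟨φ, ψ, ⟨ν, ρ, δ, ε, rfl, hν, hla, hab, hbr, hU', ⟨w, hw, i, hi1, hi2, hi3⟩, rfl, rfl⟩, hc, ht, hq⟩
      have hc : ν 15 ≤ ν 14 + 1 := by simpa using hc
      have hcl : Nat.clog 2 (r - lo) ≤ Nat.clog 2 r := Nat.clog_mono_right _ (by omega)
      have hG1 := Nat.mul_le_mul_right G hcl
      refine h ν ρ δ ε _ _ hν hU' hla (by omega) ⟨w, hw, ?_⟩ ?_ ?_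
      · rwa [show ν 14 = i by omega]
      · simp at ht ⊢
        omega
      · omega

end RealRAM

namespace RealRAM

open ComplexIn

variable {n d : ℕ}

attribute [local simp] NatExp.eval RealExp.eval Test.Holds NatExp.cost RealExp.cost Test.cost
  State.setNatVar State.setRealVar State.setNatCell State.setRealCell wp_skip wp_setNat wp_setReal
  wp_storeNat wp_storeReal wp_seq

/-! ### Creation of a simplex -/

/-- Connect the new simplex in variable `3`, the union of the current simplex and the vertex in
variable `16`, with its facets that contain this vertex. -/
def linkFacets : Prog :=
  forLt 30 8 <|
    .seq (.setNat 31 (.load (.var 2) (.var 30))) <|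
    .seq (.setNat 32 (.load (.load (.var 2) (.add (.add (.var 0) (.var 0)) (.var 30)))
      (.add (.var 0) (.var 16)))) <|
    .seq (.storeNat (.var 32) (.add (.var 0) (.var 31)) (.var 3)) <|
    .seq (.storeNat (.var 3) (.add (.add (.var 0) (.var 0)) (.var 30)) (.var 32)) <|
    .storeNat (.var 3) (.var 30) (.var 31)

/-- Create and report the union of the current simplex and the vertex in variable `16`. -/
def create : Prog :=
  .seq linkFacets <|
  .seq (.storeNat (.var 3) (.var 8) (.var 16)) <|
  .seq (.storeNat (.var 3) (.add (.add (.var 0) (.var 0)) (.var 8)) (.var 2)) <|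
  .seq (.storeNat (.var 2) (.add (.var 0) (.var 16)) (.var 3)) <|
  .seq (.storeNat (.lit 1) (.var 3) (.add (.var 8) (.lit 1))) <|
  .seq (.storeNat (.lit 3) (.var 3) (.var 4)) <|
  .seq (.setReal 1 (.div (.load (.var 5) (.var 16)) (.load (.var 9) (.var 16)))) <|
  .seq (axpy 4 5 9 1 19) <|
  .seq (.report (.var 3) (.add (.var 8) (.lit 1))) <|
  .seq (.setNat 4 (.add (.var 4) (.add (.var 1) (.lit 1)))) <|
  .setNat 3 (.add (.var 3) (.lit 1))

/-- The facet that contains the vertex `w` and misses vertex number `i` of the simplex `p`. -/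
def sideFacet (n : ℕ) (μ : ℕ → ℕ → ℕ) (p w i : ℕ) : ℕ := μ (μ p (n + n + i)) (n + w)

open Classical in
/-- The memory after the new simplex `c` has been connected with the first `k` facets. -/
noncomputable def linkMem (n : ℕ) (μ : ℕ → ℕ → ℕ) (p c w k b o : ℕ) : ℕ :=
  if b = c then
    if o < k then μ p o else if n + n ≤ o ∧ o < n + n + k then sideFacet n μ p w (o - (n + n)) else μ c o
  else if ∃ i < k, b = sideFacet n μ p w i ∧ o = n + μ p i then c else μ b o

open Classical in
/-- The memory after the creation of the simplex `c`. -/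
noncomputable def createMem (n : ℕ) (μ : ℕ → ℕ → ℕ) (len p c R w b o : ℕ) : ℕ :=
  if b = c then
    if o < len then μ p o else if o = len then w else if o = n + n + len then p else
    if n + n ≤ o ∧ o < n + n + len then sideFacet n μ p w (o - (n + n)) else μ c o
  else if b = 1 ∧ o = c then len + 1 else if b = 3 ∧ o = c then R else
  if (b = p ∧ o = n + w) ∨ ∃ i < len, b = sideFacet n μ p w i ∧ o = n + μ p i then c else μ b o

/-- The rounds do not disturb each other: old blocks are changed only in cells `n + v` with `v` a
vertex of the old simplex, while cofacets are looked up in cell `n + w` for the new vertex `w`. -/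
theorem wp_linkFacets {K : ComplexIn (Fin n) d} {s : State n} {p c len w : ℕ} (h0 : s.natVar 0 = n)
    (h2 : s.natVar 2 = p) (h3 : s.natVar 3 = c) (h8 : s.natVar 8 = len) (h16 : s.natVar 16 = w)
    (hcp : p ≠ c) (hln : len ≤ n)
    (hv : ∀ i < len, s.natMem p i < n ∧ s.natMem p i ≠ w) (hq : ∀ i < len, s.natMem p (n + n + i) ≠ c)
    (hh : ∀ i < len, sideFacet n s.natMem p w i ≠ c) (hw : w < n)
    {Post : State n → ℕ → ℕ → Prop}
    (h : ∀ ν t, (∀ x < 30, ν x = s.natVar x) → t ≤ len * 50 + 10 →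
      Post { s with natVar := ν, natMem := linkMem n s.natMem p c w len } t 0) :
    wp K linkFacets s Post := by
  classical
  set μ := s.natMem with hμ
  refine (wp_forLt (by norm_num) 40 (fun k s' => ∃ ν, (∀ x < 30, ν x = s.natVar x) ∧
    s' = { s with natVar := ν, natMem := linkMem n μ p c w k }) ?_ ?_).mono ?_
  · refine ⟨Function.update s.natVar 30 0, ?_, ?_⟩
    · intro x hx
      simp [show x ≠ 30 by omega]
    · simp
      funext b o
      by_cases hb : b = c
      · subst hb; simp [linkMem, ← hμ]
      · simp [linkMem, hb, ← hμ]
  · rintro k s' hk ⟨ν, hν, rfl⟩ h30 -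
    have h30 : ν 30 = k := h30
    rw [h8] at hk
    obtain ⟨hv1, hv2⟩ := hv k hk
    have m0 : ν 0 = n := by rw [hν 0 (by norm_num), h0]
    have m2 : ν 2 = p := by rw [hν 2 (by norm_num), h2]
    have m3 : ν 3 = c := by rw [hν 3 (by norm_num), h3]
    have m16 : ν 16 = w := by rw [hν 16 (by norm_num), h16]
    have r1 : linkMem n μ p c w k p k = μ p k := by
      rw [linkMem, if_neg hcp, if_neg]
      rintro ⟨i, hi, -, hi'⟩
      have := hv i (by omega)
      omega
    have r2 : linkMem n μ p c w k p (n + n + k) = μ p (n + n + k) := by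
      rw [linkMem, if_neg hcp, if_neg]
      rintro ⟨i, hi, -, hi'⟩
      have := (hv i (by omega)).1
      omega
    have r3 : linkMem n μ p c w k (μ p (n + n + k)) (n + w) = sideFacet n μ p w k := by
      rw [linkMem, if_neg (hq k hk), if_neg, sideFacet]
      rintro ⟨i, hi, -, hi'⟩
      have := (hv i (by omega)).2
      omega
    simp only [wp_seq, wp_setNat, wp_storeNat]
    refine ⟨?_, ?_, ⟨Function.update (Function.update (Function.update ν 31 (μ p k)) 32 (sideFacet n μ p w k))
      30 (k + 1), ?_, ?_⟩, ?_, ?_⟩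
    · simp [h30]
    · simp [hν 8]
    · intro x hx
      simp [show x ≠ 30 by omega, show x ≠ 31 by omega, show x ≠ 32 by omega, hν x hx]
    · simp [m0, m2, m3, m16, h30, r1, r2, r3]
      funext b o
      have hhk := hh k hk
      by_cases hb : b = c
      · subst hb
        simp [Function.update_apply, linkMem, hhk.symm]
        have hn0 : n ≠ 0 := by omega
        by_cases e1 : o = k
        · simp [e1]
        · by_cases e2 : o = n + n + k
          · subst e2
            simp [hn0]
          · have f1 : o ≤ k ↔ o < k := by omega
            have f2 : o < n + n + (k + 1) ↔ o < n + n + k := by omega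
            simp [e1, e2, f1, f2]
      · by_cases hb2 : b = sideFacet n μ p w k
        · subst hb2
          by_cases e1 : o = n + μ p k
          · subst e1
            simp [linkMem, hhk]
            intro h
            exact absurd rfl (h k (by omega) rfl)
          · have : (∃ i < k + 1, sideFacet n μ p w k = sideFacet n μ p w i ∧ o = n + μ p i) ↔
              ∃ i < k, sideFacet n μ p w k = sideFacet n μ p w i ∧ o = n + μ p i := by
              constructor
              · rintro ⟨i, hi, h1, h2⟩
                refine ⟨i, ?_, h1, h2⟩
                rcases Nat.lt_succ_iff_lt_or_eq.1 hi with h | rfl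
                · exact h
                · exact absurd h2 e1
              · rintro ⟨i, hi, h1, h2⟩
                exact ⟨i, by omega, h1, h2⟩
            simp only [Function.update_of_ne hb, Function.update_self, Function.update_of_ne e1, linkMem, if_neg hb, this]
        · have : (∃ i < k + 1, b = sideFacet n μ p w i ∧ o = n + μ p i) ↔
              ∃ i < k, b = sideFacet n μ p w i ∧ o = n + μ p i := by
              constructor
              · rintro ⟨i, hi, h1, h2⟩
                refine ⟨i, ?_, h1, h2⟩
                rcases Nat.lt_succ_iff_lt_or_eq.1 hi with h | rfl
                · exact h
                · exact absurd h1 hb2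
              · rintro ⟨i, hi, h1, h2⟩
                exact ⟨i, by omega, h1, h2⟩
          simp only [Function.update_of_ne hb, Function.update_of_ne hb2, linkMem, if_neg hb, this]
    · simp
    · simp
  · rintro s' t q ⟨-, -, ⟨ν, hν, rfl⟩, ht, rfl⟩
    rw [h8] at ht ⊢
    exact h ν t hν (by omega)

theorem wp_create {K : ComplexIn (Fin n) d} {s : State n} {σ : Finset (Fin n)} {p c R rb tb : ℕ}
    {w : Fin n} (h0 : s.natVar 0 = n) (h1 : s.natVar 1 = d)
    (h2 : s.natVar 2 = p) (h3 : s.natVar 3 = c) (h4 : s.natVar 4 = R) (h5 : s.natVar 5 = tb)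
    (h8 : s.natVar 8 = σ.card) (h9 : s.natVar 9 = rb) (h16 : s.natVar 16 = w) (h19 : s.natVar 19 = n + d)
    (hcp : p ≠ c) (hp : 10 ≤ p) (hc : 10 ≤ c) (hwσ : w ∉ σ) (hl : s.Lists p σ.card σ)
    (hv : ∀ i < σ.card, s.natMem p i < n ∧ s.natMem p i ≠ w)
    (hq : ∀ i < σ.card, s.natMem p (n + n + i) ≠ c)
    (hh : ∀ i < σ.card, 10 ≤ sideFacet n s.natMem p w i ∧ sideFacet n s.natMem p w i ≠ c)
    {Post : State n → ℕ → ℕ → Prop}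
    (h : ∀ ν ρ α t, (∀ x < 30, x ≠ 3 → x ≠ 4 → ν x = s.natVar x) → ν 3 = c + 1 → ν 4 = R + (d + 1) →
      (∀ x ≠ 1, ρ x = s.realVar x) →
      (∀ q < n + d, α q = s.realMem tb q - s.realMem tb w / s.realMem rb w * s.realMem rb q) →
      t ≤ 80 * (n + d) + 80 →
      Post { natVar := ν, realVar := ρ, natMem := createMem n s.natMem σ.card p c R w
             realMem := Function.update s.realMem R α
             found := insert (insert w σ) s.found } t 0) :
    wp K create s Post := by
  classical
  have hlen : σ.card < n := by
    have := Finset.card_lt_univ_of_notMem hwσ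
    simpa using this
  set len := σ.card with hlen'
  unfold create
  rw [wp_seq]
  refine wp_linkFacets h0 h2 h3 h8 h16 hcp hlen.le hv hq (fun i hi => (hh i hi).2) w.2 ?_
  intro ν t hν ht
  have m0 : ν 0 = n := by rw [hν 0 (by norm_num), h0]
  have m1 : ν 1 = d := by rw [hν 1 (by norm_num), h1]
  have m2 : ν 2 = p := by rw [hν 2 (by norm_num), h2]
  have m3 : ν 3 = c := by rw [hν 3 (by norm_num), h3]
  have m4 : ν 4 = R := by rw [hν 4 (by norm_num), h4]
  have m5 : ν 5 = tb := by rw [hν 5 (by norm_num), h5]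
  have m8 : ν 8 = len := by rw [hν 8 (by norm_num), h8]
  have m9 : ν 9 = rb := by rw [hν 9 (by norm_num), h9]
  have m16 : ν 16 = w := by rw [hν 16 (by norm_num), h16]
  have m19 : ν 19 = n + d := by rw [hν 19 (by norm_num), h19]
  simp only [wp_seq, wp_storeNat, wp_setReal]
  refine wp_congr_state (s' := { s with
    natVar := ν
    realVar := Function.update s.realVar 1 (s.realMem tb w / s.realMem rb w)
    natMem := createMem n s.natMem len p c R w }) ?_ ?_
  · simp [m0, m2, m3, m4, m5, m8, m9, m16]
    funext b o
    have hc1 : c ≠ 1 := by omega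
    have hc3 : c ≠ 3 := by omega
    have hp1 : p ≠ 1 := by omega
    have hp3 : p ≠ 3 := by omega
    by_cases hb : b = c
    · subst hb
      have hcp' := hcp.symm
      simp [Function.update_apply, linkMem, createMem, hc1, hc3, hcp']
      by_cases e1 : o = len
      · simp [e1]; intro; omega
      · by_cases e2 : o = n + n + len
        · subst e2
          have f1 : ¬ n + n + len < len := by omega
          simp [f1]
          intro; omega
        · simp [e1, e2]
    · by_cases hb1 : b = 1
      · subst hb1
        have : ∀ i < len, 1 ≠ sideFacet n s.natMem p w i := fun i hi => by have := (hh i hi).1; omega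
        have f : ¬ ∃ i < len, 1 = sideFacet n s.natMem p w i ∧ o = n + s.natMem p i := fun ⟨i, hi, h, _⟩ => this i hi h
        simp [Function.update_apply, linkMem, createMem, hb, hp1.symm, f]
      · by_cases hb3 : b = 3
        · subst hb3
          have : ∀ i < len, 3 ≠ sideFacet n s.natMem p w i := fun i hi => by have := (hh i hi).1; omega
          have f : ¬ ∃ i < len, 3 = sideFacet n s.natMem p w i ∧ o = n + s.natMem p i := fun ⟨i, hi, h, _⟩ => this i hi h
          simp [Function.update_apply, linkMem, createMem, hb, hp3.symm, f]
        · by_cases hbp : b = p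
          · subst hbp
            by_cases e : o = n + w
            · simp [Function.update_apply, createMem, hb, hb1, hb3, e]
            · simp [Function.update_apply, linkMem, createMem, hb, hb1, hb3, e]
          · simp [Function.update_apply, linkMem, createMem, hb, hb1, hb3, hbp]
  refine wp_axpy (by norm_num) (by norm_num) (by norm_num) (by norm_num) ?_
  intro t2 ht2
  simp only [m4, m5, m9, m19, Function.update_self] at ht2 ⊢
  refine wp_report (insert w σ) ?_ ?_
  · simp only [State.Lists, NatExp.eval, Function.update_of_ne (show (3 : ℕ) ≠ 40 by decide),
      Function.update_of_ne (show (8 : ℕ) ≠ 40 by decide), m3, m8]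
    rw [Finset.range_add_one, Finset.image_insert, Finset.image_insert]
    congr 1
    · simp [createMem]
    · rw [State.Lists] at hl
      rw [hl]
      refine Finset.image_congr fun o ho => ?_
      have ho : o < len := by simpa using ho
      simp [createMem, ho]
  · rw [wp_setNat, wp_setNat]
    refine h _ _ _ _ ?_ ?_ ?_ ?_ ?_ ?_
    · intro x hx h3 h4
      simp [h3, h4, show x ≠ 40 by omega, hν x hx]
    · simp [m3]
    · simp [m4, m1]
    · intro x hx
      simp [hx]
    · intro q hq
      simp [hq]
    · simp [m8]
      omega

end RealRAM

namespace RealRAM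

open ComplexIn

variable {n d : ℕ}

/-! ### The table of the simplices found so far -/

/-- The simplices found so far have the numbers `k` with `10 ≤ k < c`, and simplex `k` is `F k`; the
number `10` belongs to the empty simplex. Every other simplex has been found as `last k` added to
the simplex `par k`. Block `k` of the memory lists the vertices, the cofacets and the facets of
simplex `k`. -/
structure Table (K : ComplexIn (Fin n) d) (μ : ℕ → ℕ → ℕ) (F : ℕ → Finset (Fin n)) (par : ℕ → ℕ)
    (last : ℕ → Fin n) (c : ℕ) : Prop where
  lt : 10 < c
  root : F 10 = ∅
  inj : ∀ k k', 10 ≤ k → k < c → 10 ≤ k' → k' < c → F k = F k' → k = k'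
  face : ∀ k, 10 < k → k < c → F k ∈ K.faces
  len : ∀ k, 10 ≤ k → k < c → μ 1 k = (F k).card
  block : ∀ k, 10 ≤ k → k < c → μ 3 k = n + 3 + (k - 10) * (d + 1)
  lists : ∀ k, 10 ≤ k → k < c → (F k).image Fin.val = (Finset.range (F k).card).image (μ k)
  down : ∀ k, 10 ≤ k → k < c → ∀ i < (F k).card, ∀ v : Fin n, μ k i = v →
    10 ≤ μ k (n + n + i) ∧ μ k (n + n + i) < c ∧ F (μ k (n + n + i)) = (F k).erase v
  up : ∀ k, 10 ≤ k → k < c → ∀ (w : Fin n) (q : ℕ), q ≠ 0 →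
    (μ k (n + w) = q ↔ 10 ≤ q ∧ q < c ∧ w ∉ F k ∧ F q = insert w (F k))
  fresh : ∀ k, c ≤ k → ∀ o, μ k o = 0
  par_lt : ∀ k, 10 < k → k < c → 10 ≤ par k ∧ par k < k
  par_eq : ∀ k, 10 < k → k < c → last k ∉ F (par k) ∧ F k = insert (last k) (F (par k))
  par_mem : ∀ k, 10 < k → k < c →
    μ k (n + n + ((F k).card - 1)) = par k ∧ μ k ((F k).card - 1) = last k
  mono : ∀ k k', 10 < k → k ≤ k' → k' < c → par k ≤ par k'
  first : ∀ k q (v : Fin n), 10 < k → k < c → 10 ≤ q → q < c → v ∉ F q → F k = insert v (F q) → par k ≤ q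

/-! ### Consequences and extension of the table invariant -/

namespace Table

variable {K : ComplexIn (Fin n) d} {μ : ℕ → ℕ → ℕ} {F : ℕ → Finset (Fin n)} {par : ℕ → ℕ}
  {last : ℕ → Fin n} {c : ℕ}

/-- The table ignores block `2` and the sorting blocks `4` to `7`, which serve as scratch memory. -/
theorem congr (h : Table K μ F par last c) {μ' : ℕ → ℕ → ℕ} (h1 : μ' 1 = μ 1) (h3 : μ' 3 = μ 3)
    (h10 : ∀ k, 10 ≤ k → μ' k = μ k) : Table K μ' F par last c where
  lt := h.lt
  root := h.root
  inj := h.inj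
  face := h.face
  len k hk hc := by rw [h1, h.len k hk hc]
  block k hk hc := by rw [h3, h.block k hk hc]
  lists k hk hc := by rw [h10 k hk, h.lists k hk hc]
  down k hk hc := by rw [h10 k hk]; exact h.down k hk hc
  up k hk hc := by rw [h10 k hk]; exact h.up k hk hc
  fresh k hk := by rw [h10 k (by have := h.lt; omega)]; exact h.fresh k hk
  par_lt := h.par_lt
  par_eq := h.par_eq
  par_mem k hk hc := by rw [h10 k hk.le]; exact h.par_mem k hk hc
  mono := h.mono
  first := h.first

theorem card_par (h : Table K μ F par last c) {k : ℕ} (hk : 10 < k) (hc : k < c) :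
    (F k).card = (F (par k)).card + 1 := by
  obtain ⟨h1, h2⟩ := h.par_eq k hk hc
  rw [h2, Finset.card_insert_of_notMem h1]

/-- Breadth-first order: parents are numbered monotonically, so by induction along the parents the
dimensions are monotone too. -/
theorem card_le_card (h : Table K μ F par last c) {k k' : ℕ} (hk : 10 ≤ k) (hkk : k ≤ k')
    (hc : k' < c) : (F k).card ≤ (F k').card := by
  induction k' using Nat.strong_induction_on generalizing k with
  | _ k' ih =>
    rcases hk.eq_or_lt with rfl | hk
    · simp [h.root]
    · have h1 := h.par_lt k' (by omega) hc
      have h2 := h.par_lt k hk (by omega)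
      have h3 := h.mono k k' hk hkk hc
      rw [h.card_par hk (by omega), h.card_par (by omega) hc]
      have := ih (par k') h1.2 h2.1 h3 (by omega)
      omega

theorem nonempty (h : Table K μ F par last c) {k : ℕ} (hk : 10 < k) (hc : k < c) : (F k).Nonempty :=
  K.nonempty_of_mem _ (h.face k hk hc)

theorem entry (h : Table K μ F par last c) {k i : ℕ} (hk : 10 ≤ k) (hc : k < c)
    (hi : i < (F k).card) : ∃ v ∈ F k, μ k i = v := by
  have : μ k i ∈ (F k).image Fin.val := by
    rw [h.lists k hk hc]
    exact Finset.mem_image_of_mem _ (Finset.mem_range.2 hi)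
  obtain ⟨v, hv, hv'⟩ := Finset.mem_image.1 this
  exact ⟨v, hv, hv'.symm⟩

theorem exists_entry (h : Table K μ F par last c) {k : ℕ} (hk : 10 ≤ k) (hc : k < c) {v : Fin n}
    (hv : v ∈ F k) : ∃ i < (F k).card, μ k i = v := by
  have : (v : ℕ) ∈ (Finset.range (F k).card).image (μ k) := by
    rw [← h.lists k hk hc]
    exact Finset.mem_image_of_mem _ hv
  obtain ⟨i, hi, hi'⟩ := Finset.mem_image.1 this
  exact ⟨i, Finset.mem_range.1 hi, hi'⟩

theorem up_eq_zero (h : Table K μ F par last c) {k : ℕ} (hk : 10 ≤ k) (hc : k < c) {w : Fin n}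
    (hw : w ∉ F k) : μ k (n + w) = 0 ↔ ∀ q, 10 ≤ q → q < c → F q ≠ insert w (F k) := by
  constructor
  · intro h0 q hq hqc hqF
    have := (h.up k hk hc w q (by omega)).2 ⟨hq, hqc, hw, hqF⟩
    omega
  · intro hall
    by_contra hne
    obtain ⟨h1, h2, -, h4⟩ := (h.up k hk hc w _ hne).1 rfl
    exact hall _ h1 h2 h4

theorem up_mem_link (h : Table K μ F par last c) {k : ℕ} (hk : 10 ≤ k) (hc : k < c) {w : Fin n}
    (hw : μ k (n + w) ≠ 0) : w ∈ K.link (F k) := by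
  obtain ⟨h1, h2, h3, h4⟩ := (h.up k hk hc w _ hw).1 rfl
  have : 10 ≠ μ k (n + w) := by
    intro h10
    rw [← h10, h.root] at h4
    exact Finset.insert_ne_empty _ _ h4.symm
  exact mem_link.2 ⟨h3, h4 ▸ h.face _ (by omega) h2⟩

/-- This links the vanishing table entries, which the program tests, with the simplices that have
not been found at all. -/
theorem mem_unknown (h : Table K μ F par last c) {k : ℕ} (hk : 10 ≤ k) (hc : k < c) {w : Fin n} :
    w ∈ unknown K (F k) (μ k) ↔
      w ∉ F k ∧ insert w (F k) ∈ K.faces ∧ ∀ q, 10 ≤ q → q < c → F q ≠ insert w (F k) := by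
  rw [unknown, Finset.mem_filter, mem_link, and_assoc]
  constructor
  · rintro ⟨h1, h2, h3⟩
    exact ⟨h1, h2, (h.up_eq_zero hk hc h1).1 h3⟩
  · rintro ⟨h1, h2, h3⟩
    exact ⟨h1, h2, (h.up_eq_zero hk hc h1).2 h3⟩

/-- One goes down to the facet of `p` opposite to `v` and up again along `w`. The entry for the
second move exists because all facets of the new simplex have been found. -/
theorem sideFacet (h : Table K μ F par last c) {p : ℕ} (hp : 10 ≤ p) (hc : p < c) {w : Fin n}
    (hw : w ∉ F p) (hfac : ∀ v ∈ F p, ∃ q, 10 ≤ q ∧ q < c ∧ F q = (insert w (F p)).erase v)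
    {i : ℕ} (hi : i < (F p).card) {v : Fin n} (hv : μ p i = v) :
    10 ≤ sideFacet n μ p w i ∧ sideFacet n μ p w i < c ∧
      F (sideFacet n μ p w i) = (insert w (F p)).erase v := by
  obtain ⟨h1, h2, h3⟩ := h.down p hp hc i hi v hv
  have hvp : v ∈ F p := by
    obtain ⟨v', hv', e⟩ := h.entry hp hc hi
    rwa [show v = v' from Fin.ext (hv.symm.trans e)]
  obtain ⟨q, hq1, hq2, hq3⟩ := hfac v hvp
  have hwv : w ≠ v := by rintro rfl; exact hw hvp
  have h4 : (insert w (F p)).erase v = insert w ((F p).erase v) := Finset.erase_insert_of_ne hwv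
  have := (h.up _ h1 h2 w q (by omega)).2 ⟨hq1, hq2, by
    rw [h3]; exact fun h => hw (Finset.mem_of_mem_erase h), by rw [hq3, h4, h3]⟩
  rw [RealRAM.sideFacet, this]
  exact ⟨hq1, hq2, hq3⟩

/-- The table after the creation of a simplex. -/
theorem extend (h : Table K μ F par last c) {p : ℕ} (hp : 10 ≤ p) (hc : p < c) {w : Fin n}
    (hpar : ∀ k, 10 < k → k < c → par k ≤ p) (hw : w ∉ F p) (hface : insert w (F p) ∈ K.faces)
    (hnew : ∀ q, 10 ≤ q → q < c → F q ≠ insert w (F p))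
    (hfac : ∀ v ∈ F p, ∃ q, 10 ≤ q ∧ q < c ∧ F q = (insert w (F p)).erase v)
    (hfirst : ∀ q (v : Fin n), 10 ≤ q → q < p → v ∉ F q → insert v (F q) ≠ insert w (F p)) :
    Table K (createMem n μ (F p).card p c (n + 3 + (c - 10) * (d + 1)) w)
      (Function.update F c (insert w (F p))) (Function.update par c p) (Function.update last c w)
      (c + 1) := by
  classical
  have hlt := h.lt
  set len := (F p).card with hlen
  set μ' := createMem n μ len p c (n + 3 + (c - 10) * (d + 1)) w with hμ'
  have hlenn : len < n := by simpa using Finset.card_lt_univ_of_notMem hw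
  have hcard : (insert w (F p)).card = len + 1 := Finset.card_insert_of_notMem hw
  have hFc : ∀ k, k < c → Function.update F c (insert w (F p)) k = F k := fun k hk =>
    Function.update_of_ne (by omega) _ _
  have hpc : ∀ k, k < c → Function.update par c p k = par k := fun k hk =>
    Function.update_of_ne (by omega) _ _
  have hlc : ∀ k, k < c → Function.update last c w k = last k := fun k hk =>
    Function.update_of_ne (by omega) _ _
  have hside := fun {i} (hi : i < len) {v} hv => h.sideFacet hp hc hw hfac hi (v := v) hv
  -- the blocks of the old simplices
  have hold : ∀ k, 10 ≤ k → k ≠ c → ∀ o, μ' k o =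
      if (k = p ∧ o = n + w) ∨ ∃ i < len, k = RealRAM.sideFacet n μ p w i ∧ o = n + μ p i then c else μ k o := by
    intro k hk hkc o
    rw [hμ', createMem, if_neg hkc, if_neg (by omega), if_neg (by omega)]
  have hold' : ∀ k, 10 ≤ k → k ≠ c → ∀ o, (o < n ∨ n + n ≤ o) → μ' k o = μ k o := by
    intro k hk hkc o ho
    rw [hold k hk hkc, if_neg]
    rintro (⟨-, h1⟩ | ⟨i, hi, -, h1⟩)
    · have := w.2; omega
    · obtain ⟨v, -, hv⟩ := h.entry hp hc hi
      have := v.2; omega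
  have hnewlist : ∀ i < len, μ' c i = μ p i := by
    intro i hi
    rw [hμ', createMem, if_pos rfl, if_pos hi]
  have hnewlast : μ' c len = w := by
    rw [hμ', createMem, if_pos rfl, if_neg (by omega), if_pos rfl]
  have hnewpar : μ' c (n + n + len) = p := by
    rw [hμ', createMem, if_pos rfl, if_neg (by omega), if_neg (by omega), if_pos rfl]
  have hnewdown : ∀ i < len, μ' c (n + n + i) = RealRAM.sideFacet n μ p w i := by
    intro i hi
    rw [hμ', createMem, if_pos rfl, if_neg (by omega), if_neg (by omega), if_neg (by omega),
      if_pos (by omega), Nat.add_sub_cancel_left]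
  have hnewup : ∀ v : Fin n, μ' c (n + v) = 0 := by
    intro v
    have := v.2
    rw [hμ', createMem, if_pos rfl, if_neg (by omega), if_neg (by omega), if_neg (by omega),
      if_neg (by omega), h.fresh c le_rfl]
  have hcases : ∀ k, k < c + 1 → k = c ∨ k < c := fun k hk => by omega
  refine ⟨by omega, ?_, ?_, ?_, ?_, ?_, ?_, ?_, ?_, ?_, ?_, ?_, ?_, ?_, ?_⟩
  · rw [hFc _ hlt, h.root]
  · intro k k' hk hkc hk' hkc' he
    rcases hcases k hkc with rfl | hkc <;> rcases hcases k' hkc' with rfl | hkc'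
    · rfl
    · rw [hFc _ hkc', Function.update_self] at he
      exact absurd he.symm (hnew _ hk' hkc')
    · rw [hFc _ hkc, Function.update_self] at he
      exact absurd he (hnew _ hk hkc)
    · rw [hFc _ hkc, hFc _ hkc'] at he
      exact h.inj _ _ hk hkc hk' hkc' he
  · intro k hk hkc
    rcases hcases k hkc with rfl | hkc
    · rwa [Function.update_self]
    · rw [hFc _ hkc]; exact h.face k hk hkc
  · intro k hk hkc
    rcases hcases k hkc with rfl | hkc
    · rw [Function.update_self, hcard, hμ', createMem, if_neg (by omega), if_pos (by simp)]
    · rw [hFc _ hkc, ← h.len k hk hkc, hμ', createMem, if_neg (by omega), if_neg (by omega),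
        if_neg (by omega), if_neg]
      rintro (⟨h1, -⟩ | ⟨i, hi, h1, -⟩)
      · omega
      · obtain ⟨v, -, hv⟩ := h.entry hp hc hi
        have := (hside hi hv).1
        omega
  · intro k hk hkc
    rcases hcases k hkc with rfl | hkc
    · rw [hμ', createMem, if_neg (by omega), if_neg (by omega), if_pos (by simp)]
    · rw [← h.block k hk hkc, hμ', createMem, if_neg (by omega), if_neg (by omega),
        if_neg (by omega), if_neg]
      rintro (⟨h1, -⟩ | ⟨i, hi, h1, -⟩)
      · omega
      · obtain ⟨v, -, hv⟩ := h.entry hp hc hi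
        have := (hside hi hv).1
        omega
  · intro k hk hkc
    rcases hcases k hkc with rfl | hkc
    · rw [Function.update_self, hcard, Finset.range_add_one, Finset.image_insert, Finset.image_insert,
        hnewlast, h.lists p hp hc]
      congr 1
      exact Finset.image_congr fun i hi => (hnewlist i (by simpa using hi)).symm
    · rw [hFc _ hkc, h.lists k hk hkc]
      refine Finset.image_congr fun i hi => (hold' k hk (by omega) i (Or.inl ?_)).symm
      have := Finset.card_le_univ (F k)
      simp at hi this
      omega
  · intro k hk hkc i hi v hv
    rcases hcases k hkc with rfl | hkc
    · rw [Function.update_self, hcard] at hi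
      rw [Function.update_self]
      rcases Nat.lt_succ_iff_lt_or_eq.1 hi with hi | rfl
      · rw [hnewlist i hi] at hv
        obtain ⟨h1, h2, h3⟩ := hside hi hv
        rw [hnewdown i hi, hFc _ h2]
        exact ⟨h1, by omega, h3⟩
      · rw [hnewlast] at hv
        have hv : v = w := Fin.ext hv.symm
        rw [hnewpar, hFc _ hc, hv, Finset.erase_insert hw]
        exact ⟨hp, by omega, rfl⟩
    · rw [hFc _ hkc] at hi ⊢
      have hin : i < n := by
        have := Finset.card_le_univ (F k)
        simp at this
        omega
      rw [hold' k hk (by omega) i (Or.inl hin)] at hv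
      rw [hold' k hk (by omega) _ (Or.inr (by omega))]
      obtain ⟨h1, h2, h3⟩ := h.down k hk hkc i hi v hv
      rw [hFc _ h2]
      exact ⟨h1, by omega, h3⟩
  · intro k hk hkc v q hq
    rcases hcases k hkc with rfl | hkc
    · rw [hnewup, Function.update_self]
      constructor
      · intro h0; omega
      · rintro ⟨h1, h2, h3, h4⟩
        rcases hcases q h2 with rfl | h2
        · rw [Function.update_self] at h4
          exact absurd (h4 ▸ Finset.mem_insert_self v _) h3
        · rw [hFc _ h2] at h4
          -- a found simplex has no unknown facet
          exfalso
          have hq10 : 10 < q := by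
            rcases h1.eq_or_lt with rfl | h1
            · rw [h.root] at h4
              exact absurd h4.symm (Finset.insert_ne_empty _ _)
            · exact h1
          obtain ⟨i, hi, hvi⟩ := h.exists_entry h1 h2 (v := v) (h4 ▸ Finset.mem_insert_self v _)
          obtain ⟨g1, g2, g3⟩ := h.down q h1 h2 i hi v hvi
          refine hnew _ g1 g2 ?_
          rw [g3, h4, Finset.erase_insert h3]
    · rw [hFc _ hkc, hold k hk (by omega)]
      by_cases hcond : (k = p ∧ n + (v : ℕ) = n + w) ∨
          ∃ i < len, k = RealRAM.sideFacet n μ p w i ∧ n + (v : ℕ) = n + μ p i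
      · rw [if_pos hcond]
        have key : v ∉ F k ∧ insert w (F p) = insert v (F k) := by
          rcases hcond with ⟨rfl, h1⟩ | ⟨i, hi, rfl, h1⟩
          · have hv : v = w := Fin.ext (by omega)
            rw [hv]
            exact ⟨hw, rfl⟩
          · have hv : μ p i = v := by omega
            obtain ⟨-, -, h3⟩ := hside hi hv
            obtain ⟨v', hv', e⟩ := h.entry hp hc hi
            have hvv : v = v' := Fin.ext (hv.symm.trans e)
            rw [h3, Finset.insert_erase (Finset.mem_insert_of_mem (hvv ▸ hv'))]
            exact ⟨Finset.notMem_erase _ _, rfl⟩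
        constructor
        · rintro rfl
          rw [Function.update_self]
          exact ⟨by omega, by omega, key⟩
        · rintro ⟨h1, h2, h3, h4⟩
          rcases hcases q h2 with rfl | h2
          · rfl
          · rw [hFc _ h2, ← key.2] at h4
            exact absurd h4 (hnew q h1 h2)
      · rw [if_neg hcond, h.up k hk hkc v q hq]
        constructor
        · rintro ⟨h1, h2, h3, h4⟩
          rw [hFc _ h2]
          exact ⟨h1, by omega, h3, h4⟩
        · rintro ⟨h1, h2, h3, h4⟩
          rcases hcases q h2 with rfl | h2
          · exfalso
            -- A found facet of the new simplex misses either `w`, and is then simplex `p`, or a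
            -- vertex of `p`, and is then a side facet. These are the cells that were written.
            apply hcond
            rw [Function.update_self] at h4
            have hvm : v ∈ insert w (F p) := h4 ▸ Finset.mem_insert_self v _
            have hk' : F k = (insert w (F p)).erase v := by rw [h4, Finset.erase_insert h3]
            rcases Finset.mem_insert.1 hvm with rfl | hvp
            · left
              rw [Finset.erase_insert hw] at hk'
              exact ⟨h.inj _ _ hk hkc hp hc hk', rfl⟩
            · right
              obtain ⟨i, hi, hvi⟩ := h.exists_entry hp hc hvp
              obtain ⟨g1, g2, g3⟩ := hside hi hvi
              exact ⟨i, hi, h.inj _ _ hk hkc g1 g2 (hk'.trans g3.symm), by omega⟩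
          · rw [hFc _ h2] at h4
            exact ⟨h1, h2, h3, h4⟩
  · intro k hk o
    rw [hold k (by omega) (by omega), if_neg, h.fresh k (by omega)]
    rintro (⟨h1, -⟩ | ⟨i, hi, h1, -⟩)
    · omega
    · obtain ⟨v, -, hv⟩ := h.entry hp hc hi
      have := (hside hi hv).2.1
      omega
  · intro k hk hkc
    rcases hcases k hkc with rfl | hkc
    · rw [Function.update_self]; exact ⟨hp, hc⟩
    · rw [hpc _ hkc]; exact h.par_lt k hk hkc
  · intro k hk hkc
    rcases hcases k hkc with rfl | hkc
    · rw [Function.update_self, Function.update_self, Function.update_self, hFc _ hc]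
      exact ⟨hw, rfl⟩
    · have := (h.par_lt k hk hkc).2
      rw [hpc _ hkc, hlc _ hkc, hFc _ hkc, hFc _ (by omega)]
      exact h.par_eq k hk hkc
  · intro k hk hkc
    rcases hcases k hkc with rfl | hkc
    · rw [Function.update_self, Function.update_self, Function.update_self, hcard, Nat.add_sub_cancel]
      exact ⟨hnewpar, hnewlast⟩
    · have hin : (F k).card - 1 < n := by
        have := Finset.card_le_univ (F k)
        simp at this
        omega
      rw [hpc _ hkc, hlc _ hkc, hFc _ hkc, hold' k hk.le (by omega) _ (Or.inl hin),
        hold' k hk.le (by omega) _ (Or.inr (by omega))]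
      exact h.par_mem k hk hkc
  · intro k k' hk hkk hkc
    rcases hcases k' hkc with rfl | hkc
    · rw [Function.update_self]
      rcases hcases k (by omega) with rfl | hkc'
      · rw [Function.update_self]
      · rw [hpc _ hkc']
        exact hpar k hk hkc'
    · rw [hpc _ hkc, hpc _ (by omega)]
      exact h.mono k k' hk hkk hkc
  · intro k q v hk hkc hq hqc hv he
    rcases hcases k hkc with rfl | hkc
    · rw [Function.update_self]
      rw [Function.update_self] at he
      by_contra! hlt
      rw [hFc _ (by omega)] at hv he
      exact hfirst q v hq hlt hv he.symm
    · rw [hpc _ hkc]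
      rcases hcases q hqc with rfl | hqc
      · have := (h.par_lt k hk hkc).2
        omega
      · rw [hFc _ hkc, hFc _ hqc] at he
        rw [hFc _ hqc] at hv
        exact h.first k q v hk hkc hq hqc hv he

/-- Once the cofacets of the simplices before `p` are complete, all faces up to the dimension of
simplex `p` have been found. -/
theorem complete (h : Table K μ F par last c) {p : ℕ}
    (hdone : ∀ q (v : Fin n), 10 ≤ q → q < p → v ∉ F q → insert v (F q) ∈ K.faces →
      ∃ k, 10 < k ∧ k < c ∧ F k = insert v (F q))
    {m : ℕ} (hm : ∀ q, 10 ≤ q → q < c → (F q).card < m → q < p) {τ : Finset (Fin n)} (hτ : τ ∈ K.faces)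
    (hτm : τ.card ≤ m) : ∃ k, 10 < k ∧ k < c ∧ F k = τ := by
  induction hk : τ.card using Nat.strong_induction_on generalizing τ with
  | _ j ih =>
    obtain ⟨v, hv⟩ := K.nonempty_of_mem τ hτ
    have hcard := Finset.card_erase_of_mem hv
    have hpos := Finset.card_pos.2 ⟨v, hv⟩
    -- A facet of `τ` has been found by induction, and its cardinality puts it before `p`; being
    -- processed, it has revealed `τ`.
    obtain ⟨q, hq1, hq2, hq3⟩ : ∃ q, 10 ≤ q ∧ q < c ∧ F q = τ.erase v := by
      rcases (τ.erase v).eq_empty_or_nonempty with he | hne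
      · exact ⟨10, le_rfl, h.lt, by rw [h.root, he]⟩
      · obtain ⟨k, h1, h2, h3⟩ := ih _ (by omega)
          (K.down_closed τ hτ _ (Finset.erase_subset _ _) hne) (by omega) rfl
        exact ⟨k, h1.le, h2, h3⟩
    have := hdone q v hq1 (hm q hq1 hq2 (by rw [hq3]; omega)) (by rw [hq3]; exact Finset.notMem_erase _ _)
      (by rwa [hq3, Finset.insert_erase hv])
    rwa [hq3, Finset.insert_erase hv] at this

theorem card_lt_imp (h : Table K μ F par last c) {p : ℕ} (hp : 10 ≤ p) :
    ∀ q, 10 ≤ q → q < c → (F q).card < (F p).card → q < p := by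
  intro q hq hqc hlt
  by_contra! hle
  have := h.card_le_card hp hle hqc
  omega

end Table

end RealRAM

namespace RealRAM

open ComplexIn

variable {n d : ℕ}

/-! ### The functionals of the simplices found so far -/

/-- The first real block of simplex `k`. -/
def realBlock (n d k : ℕ) : ℕ := n + 3 + (k - 10) * (d + 1)

theorem realBlock_add_le {k k' : ℕ} (hk : 10 ≤ k) (h : k < k') :
    realBlock n d k + (d + 1) ≤ realBlock n d k' := by
  have h1 : k - 10 + 1 ≤ k' - 10 := by omega
  have := Nat.mul_le_mul_right (d + 1) h1
  rw [Nat.succ_mul] at this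
  unfold realBlock
  omega

theorem realBlock_inj {k k' : ℕ} (hk : 10 ≤ k) (hk' : 10 ≤ k')
    (h : realBlock n d k = realBlock n d k') : k = k' := by
  rcases lt_trichotomy k k' with hlt | he | hlt
  · have := realBlock_add_le (n := n) (d := d) hk hlt; omega
  · exact he
  · have := realBlock_add_le (n := n) (d := d) hk' hlt; omega

/-- The functionals obtained from those in the real block of the simplex `p` by eliminating `u`. -/
noncomputable def elimBlock (n d : ℕ) (M : ℕ → ℕ → ℝ) (p u : ℕ) : ℕ → ℕ → ℝ :=
  eliminate (M (realBlock n d p)) (fun j => M (realBlock n d p + 1 + j)) u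

/-- The properties of the functionals of the simplices numbered below `c`. -/
structure Reals (K : ComplexIn (Fin n) d) (M : ℕ → ℕ → ℝ) (F : ℕ → Finset (Fin n)) (par : ℕ → ℕ)
    (last : ℕ → Fin n) (c : ℕ) : Prop where
  affine : ∀ k, 10 ≤ k → k < c → K.Affine (M (realBlock n d k))
  zero : ∀ k, 10 ≤ k → k < c → ∀ v ∈ F k, M (realBlock n d k) v = 0
  pos : ∀ k, 10 < k → k < c → 0 < M (realBlock n d (par k)) (last k)
  order : ∀ k k', 10 < k → k < k' → k' < c → par k = par k' → 0 < M (realBlock n d k) (last k')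
  spans : ∀ k, 10 < k → k < c →
    K.Spans (F k) (M (realBlock n d k)) (elimBlock n d M (par k) (last k)) (d - (F k).card)
  elim : ∀ k, 10 < k → k < c → ∀ j < d - (F k).card, K.Affine (elimBlock n d M (par k) (last k) j) ∧
    ∀ v ∈ F k, elimBlock n d M (par k) (last k) j v = 0
  one : ∀ v : Fin n, M (realBlock n d 10) v = 1
  coord : ∀ (j : Fin d) (v : Fin n), M (realBlock n d 10 + 1 + j) v = K.pos v j
  unit : ∀ j < d, ∀ i < d, M (realBlock n d 10 + 1 + j) (n + i) = if i = j then 1 else 0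

/-- The functionals of the simplex `p` are present in its real block. -/
structure Expanded (K : ComplexIn (Fin n) d) (M : ℕ → ℕ → ℝ) (σ : Finset (Fin n)) (p : ℕ) : Prop where
  spans : K.Spans σ (M (realBlock n d p)) (fun j => M (realBlock n d p + 1 + j)) (d - σ.card)
  affine : ∀ j < d - σ.card, K.Affine (M (realBlock n d p + 1 + j))
  zero : ∀ j < d - σ.card, ∀ v ∈ σ, M (realBlock n d p + 1 + j) v = 0

variable {K : ComplexIn (Fin n) d} {M M' : ℕ → ℕ → ℝ} {μ : ℕ → ℕ → ℕ} {F : ℕ → Finset (Fin n)}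
  {par : ℕ → ℕ} {last : ℕ → Fin n} {c p : ℕ}

theorem Expanded.congr {σ : Finset (Fin n)} (h : Expanded K M σ p)
    (hM : ∀ j < d + 1, M' (realBlock n d p + j) = M (realBlock n d p + j)) : Expanded K M' σ p := by
  have h0 := hM 0 (by omega)
  have h1 : ∀ j < d - σ.card, M' (realBlock n d p + 1 + j) = M (realBlock n d p + 1 + j) := by
    intro j hj
    have := hM (1 + j) (by omega)
    rwa [← add_assoc] at this
  refine ⟨h.spans.congr (fun q _ => by rw [← add_zero (realBlock n d p), h0])
    (fun j hj q _ => by rw [h1 j hj]), fun j hj => ?_, fun j hj => ?_⟩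
  · rw [h1 j hj]; exact h.affine j hj
  · rw [h1 j hj]; exact h.zero j hj

/-! ### How the functionals evolve, and why unknown cofacets lie on the positive side -/

namespace Reals

/-- Besides the leading functionals, the invariant reads further blocks only of parents and of the
empty simplex. The remaining blocks of a simplex without children may thus be filled later, when it
is expanded. -/
theorem congr' (ht : Table K μ F par last c) (h : Reals K M F par last c)
    (h0 : ∀ k, 10 ≤ k → k < c → M' (realBlock n d k) = M (realBlock n d k))
    (h1 : ∀ k, 10 < k → k < c → ∀ j < d, M' (realBlock n d (par k) + 1 + j) = M (realBlock n d (par k) + 1 + j))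
    (h2 : ∀ j < d, M' (realBlock n d 10 + 1 + j) = M (realBlock n d 10 + 1 + j)) :
    Reals K M' F par last c := by
  have hlt := ht.lt
  have he : ∀ k, 10 < k → k < c → ∀ j < d - (F k).card,
      elimBlock n d M' (par k) (last k) j = elimBlock n d M (par k) (last k) j := by
    intro k hk hkc j hj
    have hp := ht.par_lt k hk hkc
    have hpos := Finset.card_pos.2 (ht.nonempty hk hkc)
    funext q
    rw [elimBlock, elimBlock, eliminate, eliminate, h0 _ hp.1 (by omega), h1 k hk hkc (j + 1) (by omega)]
  refine ⟨?_, ?_, ?_, ?_, ?_, ?_, ?_, ?_, ?_⟩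
  · intro k hk hkc; rw [h0 k hk hkc]; exact h.affine k hk hkc
  · intro k hk hkc; rw [h0 k hk hkc]; exact h.zero k hk hkc
  · intro k hk hkc
    have hp := ht.par_lt k hk hkc
    rw [h0 _ hp.1 (by omega)]; exact h.pos k hk hkc
  · intro k k' hk hkk hkc
    rw [h0 k hk.le (by omega)]; exact h.order k k' hk hkk hkc
  · intro k hk hkc
    exact (h.spans k hk hkc).congr (fun q _ => by rw [h0 k hk.le hkc]) fun j hj q _ => by rw [he k hk hkc j hj]
  · intro k hk hkc j hj
    rw [he k hk hkc j hj]
    exact h.elim k hk hkc j hj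
  · intro v; rw [h0 10 le_rfl hlt]; exact h.one v
  · intro j v; rw [h2 j j.2]; exact h.coord j v
  · intro j hj; rw [h2 j hj]; exact h.unit j hj

theorem congr (ht : Table K μ F par last c) (h : Reals K M F par last c)
    (hM : ∀ b, n + 3 ≤ b → b < realBlock n d c → M' b = M b) : Reals K M' F par last c := by
  have hlt := ht.lt
  have h3 : ∀ k, n + 3 ≤ realBlock n d k := fun k => by unfold realBlock; omega
  have key : ∀ k, 10 ≤ k → k < c → ∀ j < d + 1, M' (realBlock n d k + j) = M (realBlock n d k + j) := by
    intro k hk hkc j hj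
    have := realBlock_add_le (n := n) (d := d) hk hkc
    have := h3 k
    exact hM _ (by omega) (by omega)
  refine h.congr' ht (fun k hk hkc => key k hk hkc 0 (by omega)) (fun k hk hkc j hj => ?_) fun j hj => ?_
  · have hp := ht.par_lt k hk hkc
    have := key (par k) hp.1 (by omega) (1 + j) (by omega)
    rwa [← add_assoc] at this
  · have := key 10 le_rfl hlt (1 + j) (by omega)
    rwa [← add_assoc] at this

theorem expanded_root (hroot : F 10 = ∅) (h : Reals K M F par last c) :
    Expanded K M (F 10) 10 := by
  rw [hroot]
  refine ⟨spans_empty h.one h.coord, ?_, fun j _ v hv => absurd hv (Finset.notMem_empty v)⟩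
  intro j hj
  have hj : j < d := hj
  refine ⟨0, fun v => ?_⟩
  rw [h.coord ⟨j, hj⟩ v, zero_add, Finset.sum_eq_single_of_mem ⟨j, hj⟩ (Finset.mem_univ _)]
  · rw [h.unit j hj j hj, if_pos rfl, one_mul]
  · intro i _ hi
    rw [h.unit j hj i i.2, if_neg (fun e => hi (Fin.ext e)), zero_mul]

/-- The functionals after the elimination of the last vertex. -/
theorem materialize (ht : Table K μ F par last c) (h : Reals K M F par last c) (hp : 10 < p)
    (hc : p < c) (hpar : ∀ k, 10 < k → k < c → par k < p) :
    Reals K (elimMem M (realBlock n d p) (realBlock n d (par p)) (last p) (n + d) (d - (F p).card))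
        F par last c ∧
      Expanded K (elimMem M (realBlock n d p) (realBlock n d (par p)) (last p) (n + d) (d - (F p).card))
        (F p) p := by
  set M' := elimMem M (realBlock n d p) (realBlock n d (par p)) (last p) (n + d) (d - (F p).card) with hM'
  have hout : ∀ b, (b ≤ realBlock n d p ∨ realBlock n d p + (d + 1) ≤ b) → M' b = M b := by
    intro b hb
    rw [hM', elimMem, if_neg (by omega)]
  have h0 : ∀ k, 10 ≤ k → M' (realBlock n d k) = M (realBlock n d k) := by
    intro k hk
    refine hout _ ?_
    rcases lt_trichotomy k p with h1 | rfl | h1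
    · have := realBlock_add_le (n := n) (d := d) hk h1; omega
    · exact Or.inl le_rfl
    · exact Or.inr (realBlock_add_le hp.le h1)
  have h1 : ∀ k, 10 ≤ k → k < p → ∀ j < d, M' (realBlock n d k + 1 + j) = M (realBlock n d k + 1 + j) := by
    intro k hk hkp j hj
    have := realBlock_add_le (n := n) (d := d) hk hkp
    exact hout _ (Or.inl (by omega))
  have hin : ∀ j < d - (F p).card, ∀ q < n + d, M' (realBlock n d p + 1 + j) q =
      elimBlock n d M (par p) (last p) j q := by
    intro j hj q hq
    rw [hM', elimMem, if_pos (by omega), if_pos hq, Nat.add_sub_cancel_left, elimBlock]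
  refine ⟨h.congr' ht (fun k hk _ => h0 k hk) (fun k hk hkc => h1 _ (ht.par_lt k hk hkc).1 (hpar k hk hkc))
    (h1 10 le_rfl hp), ?_, ?_, ?_⟩
  · exact (h.spans p hp hc).congr (fun q _ => by rw [h0 p hp.le]) fun j hj q hq => hin j hj q (by omega)
  · intro j hj
    exact (h.elim p hp hc j hj).1.congr fun q hq => hin j hj q hq
  · intro j hj v hv
    rw [hin j hj v (by omega)]
    exact (h.elim p hp hc j hj).2 v hv

/-- Only the leading functional of the new simplex is computed at its creation. The properties of
its further functionals are stated for the elimination formula in the blocks of the parent, so they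
cost nothing until an expansion. -/
theorem extend (ht : Table K μ F par last c) (h : Reals K M F par last c) (hp : 10 ≤ p) (hc : p < c)
    (hexp : Expanded K M (F p) p) {w : Fin n} (hw : w ∉ F p) (hpos : 0 < M (realBlock n d p) w)
    (hord : ∀ k, 10 < k → k < c → par k = p → 0 < M (realBlock n d k) w)
    {t α : ℕ → ℝ} {ε : ℝ}
    (htε : ∀ q < n + d, t q = ∑ j ∈ Finset.range (d - (F p).card), ε ^ j * M (realBlock n d p + 1 + j) q)
    (hα : ∀ q < n + d, α q = t q - t w / M (realBlock n d p) w * M (realBlock n d p) q) :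
    Reals K (Function.update M (realBlock n d c) α) (Function.update F c (insert w (F p)))
      (Function.update par c p) (Function.update last c w) (c + 1) := by
  have hlt := ht.lt
  have hold := h.congr (M' := Function.update M (realBlock n d c) α) ht fun b _ hb =>
    Function.update_of_ne hb.ne _ _
  have hMp : ∀ j < d + 1, Function.update M (realBlock n d c) α (realBlock n d p + j) =
      M (realBlock n d p + j) := by
    intro j hj
    have := realBlock_add_le (n := n) (d := d) hp hc
    exact Function.update_of_ne (by omega) _ _
  have hM0 : Function.update M (realBlock n d c) α (realBlock n d p) = M (realBlock n d p) := hMp 0 (by omega)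
  have hcc : Function.update M (realBlock n d c) α (realBlock n d c) = α := Function.update_self _ _ _
  have hexp' := hexp.congr hMp
  have hcard : (insert w (F p)).card = (F p).card + 1 := Finset.card_insert_of_notMem hw
  have hFc : ∀ k, k < c → Function.update F c (insert w (F p)) k = F k := fun k hk =>
    Function.update_of_ne (by omega) _ _
  have hpc : ∀ k, k < c → Function.update par c p k = par k := fun k hk =>
    Function.update_of_ne (by omega) _ _
  have hlc : ∀ k, k < c → Function.update last c w k = last k := fun k hk =>
    Function.update_of_ne (by omega) _ _
  have hcases : ∀ k, k < c + 1 → k = c ∨ k < c := fun k hk => by omega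
  have htaff : K.Affine t := (Affine.sum _ (fun j hj => hexp.affine j (Finset.mem_range.1 hj))
    (fun j => ε ^ j)).congr htε
  have htz : ∀ v ∈ F p, t v = 0 := fun v hv => by
    rw [htε v (by omega)]
    exact Finset.sum_eq_zero fun j hj => by rw [hexp.zero j (Finset.mem_range.1 hj) v hv, mul_zero]
  refine ⟨?_, ?_, ?_, ?_, ?_, ?_, hold.one, hold.coord, hold.unit⟩
  · intro k hk hkc
    rcases hcases k hkc with rfl | hkc
    · rw [hcc]
      exact (htaff.sub_mul (h.affine p hp hc) _).congr hα
    · exact hold.affine k hk hkc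
  · intro k hk hkc v hv
    rcases hcases k hkc with rfl | hkc
    · rw [Function.update_self] at hv
      rw [hcc, hα v (by omega)]
      rcases Finset.mem_insert.1 hv with rfl | hv
      · rw [div_mul_cancel₀ _ hpos.ne', sub_self]
      · rw [htz v hv, h.zero p hp hc v hv]; ring
    · rw [hFc k hkc] at hv
      exact hold.zero k hk hkc v hv
  · intro k hk hkc
    rcases hcases k hkc with rfl | hkc
    · rw [Function.update_self, Function.update_self, hM0]
      exact hpos
    · rw [hpc k hkc, hlc k hkc]
      exact hold.pos k hk hkc
  · intro k k' hk hkk hkc he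
    rcases hcases k' hkc with rfl | hkc
    · rw [Function.update_self, hpc k hkk] at he
      rw [Function.update_self, Function.update_of_ne fun e => hkk.ne (realBlock_inj hk.le (by omega) e)]
      exact hord k hk hkk he
    · rw [hpc k (by omega), hpc k' hkc] at he
      rw [hlc k' hkc]
      exact hold.order k k' hk hkk hkc he
  · intro k hk hkc
    rcases hcases k hkc with rfl | hkc
    · rw [Function.update_self, Function.update_self, Function.update_self, Function.update_self, hcard]
      have hs := Spans.insert hexp'.spans (u := w) (by rw [hM0]; exact hpos.ne') ε (t := t) fun v => by
        rw [htε v (by omega)]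
        refine Finset.sum_congr rfl fun j hj => ?_
        have := hMp (1 + j) (by have := Finset.mem_range.1 hj; omega)
        rw [← add_assoc] at this
        rw [this]
      rw [Nat.sub_sub] at hs
      refine hs.congr (fun q hq => ?_) fun j hj q hq => rfl
      rw [hα q (by omega), hM0]
    · rw [hpc k hkc, hlc k hkc, hFc k hkc]
      exact hold.spans k hk hkc
  · intro k hk hkc j hj
    rcases hcases k hkc with rfl | hkc
    · rw [Function.update_self, hcard] at hj
      rw [Function.update_self, Function.update_self, Function.update_self]
      refine ⟨((hexp'.affine (j + 1) (by omega)).sub_mul (hold.affine p hp hc) _), ?_⟩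
      intro v hv
      rw [elimBlock, eliminate]
      rcases Finset.mem_insert.1 hv with rfl | hv
      · rw [hM0, div_mul_cancel₀ _ hpos.ne', sub_self]
      · rw [hexp'.zero (j + 1) (by omega) v hv, hold.zero p hp hc v hv]; ring
    · rw [hFc k hkc] at hj
      rw [hpc k hkc, hlc k hkc, hFc k hkc]
      exact hold.elim k hk hkc j hj

/-- The unknown cofacets of the current simplex lie on the positive side. -/
theorem pos_of_unknown (ht : Table K μ F par last c) (h : Reals K M F par last c)
    (hdone : ∀ q (v : Fin n), 10 ≤ q → q < p → v ∉ F q → insert v (F q) ∈ K.faces →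
      ∃ k, 10 < k ∧ k < c ∧ F k = insert v (F q))
    (hp : 10 ≤ p) (hc : p < c) {w : Fin n} (hw : w ∈ unknown K (F p) (μ p)) :
    0 < M (realBlock n d p) w := by
  obtain ⟨h1, h2, h3⟩ := (ht.mem_unknown hp hc).1 hw
  rcases hp.eq_or_lt with rfl | hp10
  · rw [h.one]; exact one_pos
  obtain ⟨p1, p2⟩ := ht.par_lt p hp10 hc
  obtain ⟨l1, l2⟩ := ht.par_eq p hp10 hc
  set q := par p with hq
  set u := last p with hu
  have hwq : w ∉ F q := fun hwq => h1 (l2 ▸ Finset.mem_insert_of_mem hwq)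
  have huw : u ≠ w := by
    rintro he
    exact h1 (l2 ▸ he ▸ Finset.mem_insert_self u _)
  -- Write simplex `p` as `F q ∪ {u}` with its parent `q`. The other facet `F q ∪ {w}` of the
  -- unknown simplex is a cofacet of the processed simplex `q`, hence known; let `k` be its number.
  obtain ⟨k, k1, k2, k3⟩ := hdone q w p1 p2 hwq
    (K.down_closed _ h2 _ (Finset.insert_subset_insert _ (l2 ▸ Finset.subset_insert _ _))
      (Finset.insert_nonempty _ _))
  have hins : insert w (F p) = insert u (F k) := by rw [k3, l2, Finset.insert_comm]
  have huk : u ∉ F k := by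
    rw [k3, Finset.mem_insert, not_or]
    exact ⟨huw, l1⟩
  have hkp : p ≠ k := by
    rintro rfl
    exact h1 (k3 ▸ Finset.mem_insert_self w _)
  -- Had `k` come before `p`, its processing would have revealed `F k ∪ {u} = F p ∪ {w}`.
  have hpk : p < k := by
    by_contra! hle
    obtain ⟨k', g1, g2, g3⟩ := hdone k u k1.le (lt_of_le_of_ne hle (Ne.symm hkp)) huk (hins ▸ h2)
    exact h3 k' g1.le g2 (g3.trans hins.symm)
  -- Parents are the first facets to be processed, which bounds `par k` by `q`, and they are
  -- monotone, which gives the converse. So `k` is a later sibling with last vertex `w`, and the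
  -- sweep order yields the sign.
  have hpar : par k = q := le_antisymm (ht.first k q w k1 k2 p1 (by omega) hwq k3)
    (ht.mono p k hp10 hpk.le k2)
  obtain ⟨g1, g2⟩ := ht.par_eq k k1 k2
  have hlast : last k = w := by
    have : last k ∈ insert w (F q) := k3 ▸ g2 ▸ Finset.mem_insert_self _ _
    rw [hpar] at g1
    exact (Finset.mem_insert.1 this).resolve_right g1
  have := h.order p k hp10 hpk k2 hpar.symm
  rwa [hlast] at this

end Reals

/-- The complex `K` itself is the embedded complex required of a candidate. -/
theorem isCandidate_of_mem_link (hK : K.Embedded) {σ : Finset (Fin n)} {w : Fin n}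
    (hw : w ∈ K.link σ) : K.IsCandidate σ w := by
  obtain ⟨h1, h2⟩ := mem_link.1 hw
  refine ⟨h1, ?_, Fin n, K, Function.Embedding.refl _, hK, fun _ => rfl, ?_, ?_⟩
  · intro ρ hρ hne
    rw [skeleton, Finset.mem_filter]
    refine ⟨K.down_closed _ h2 _ hρ.1 hne, ?_⟩
    have := Finset.card_lt_card hρ
    rw [Finset.card_insert_of_notMem h1] at this
    omega
  · intro ρ hρ
    rw [Finset.map_refl]
    exact (Finset.mem_filter.1 hρ).1
  · rwa [Finset.map_refl]

end RealRAM

namespace RealRAM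

open ComplexIn

variable {n d : ℕ}

attribute [local simp] NatExp.eval RealExp.eval Test.Holds NatExp.cost RealExp.cost Test.cost
  State.setNatVar State.setRealVar State.setNatCell State.setRealCell wp_skip wp_setNat wp_setReal
  wp_storeNat wp_storeReal wp_seq

/-! ### The global invariant -/

/-- The state of the reconstruction in which the simplices numbered below `p` have been processed,
the next free number is `c`, and the found simplices have parents below `b`. -/
structure Main (K : ComplexIn (Fin n) d) (s : State n) (F : ℕ → Finset (Fin n)) (par : ℕ → ℕ)
    (last : ℕ → Fin n) (p c b : ℕ) : Prop where
  h0 : s.natVar 0 = n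
  h1 : s.natVar 1 = d
  h2 : s.natVar 2 = p
  h3 : s.natVar 3 = c
  h4 : s.natVar 4 = realBlock n d c
  h5 : s.natVar 5 = n
  h6 : s.natVar 6 = n + 1
  h7 : s.natVar 7 = n + 2
  h19 : s.natVar 19 = n + d
  table : Table K s.natMem F par last c
  reals : Reals K s.realMem F par last c
  found : ∀ ρ, ρ ∈ s.found ↔ (∃ v, ρ = {v}) ∨ ∃ k, 10 < k ∧ k < c ∧ F k = ρ
  ten_le : 10 ≤ p
  par_lt : ∀ k, 10 < k → k < c → par k < b
  done : ∀ q (v : Fin n), 10 ≤ q → q < p → v ∉ F q → insert v (F q) ∈ K.faces →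
    ∃ k, 10 < k ∧ k < c ∧ F k = insert v (F q)

theorem Main.congr {K : ComplexIn (Fin n) d} {s s' : State n} {F : ℕ → Finset (Fin n)} {par : ℕ → ℕ}
    {last : ℕ → Fin n} {p c b : ℕ} (h : Main K s F par last p c b)
    (hν : ∀ x, x < 8 ∨ x = 19 → s'.natVar x = s.natVar x)
    (hμ : ∀ x, x = 1 ∨ x = 3 ∨ 10 ≤ x → s'.natMem x = s.natMem x)
    (hM : ∀ x, n + 3 ≤ x → x < realBlock n d c → s'.realMem x = s.realMem x)
    (hF : s'.found = s.found) : Main K s' F par last p c b where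
  h0 := by rw [hν 0 (by omega), h.h0]
  h1 := by rw [hν 1 (by omega), h.h1]
  h2 := by rw [hν 2 (by omega), h.h2]
  h3 := by rw [hν 3 (by omega), h.h3]
  h4 := by rw [hν 4 (by omega), h.h4]
  h5 := by rw [hν 5 (by omega), h.h5]
  h6 := by rw [hν 6 (by omega), h.h6]
  h7 := by rw [hν 7 (by omega), h.h7]
  h19 := by rw [hν 19 (by omega), h.h19]
  table := h.table.congr (hμ 1 (by omega)) (hμ 3 (by omega)) fun k hk => hμ k (by omega)
  reals := h.reals.congr h.table hM
  found := hF ▸ h.found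
  ten_le := h.ten_le
  par_lt := h.par_lt
  done := h.done

/-! ### The vertices to be considered at a simplex -/

/-- Load the data of the current simplex and write the indicator of its candidates into block `2`. -/
def lookUp : Prog :=
  .seq (.setNat 8 (.load (.lit 1) (.var 2))) <|
  .seq (.setNat 9 (.load (.lit 3) (.var 2))) <|
  .seq (.setNat 10 (.sub (.var 1) (.var 8))) <|
  .ite (.natLe (.var 8) (.lit 0)) (forLt 30 0 (.storeNat (.lit 2) (.var 30) (.lit 1)))
    (.cand (.var 2) (.var 8) (.lit 2))

/-- Collect the vertices of the set in block `2` that do not form a known simplex with the current one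
and lie on the positive side of its functional, in block `4`. -/
def collect : Prog :=
  .seq (.setNat 11 (.lit 0)) <|
  forLt 30 0 <|
    .ite (.and (.not (.natLe (.load (.lit 2) (.var 30)) (.lit 0)))
        (.and (.natLe (.load (.var 2) (.add (.var 0) (.var 30))) (.lit 0))
          (.not (.realLe (.load (.var 9) (.var 30)) (.lit 0)))))
      (.seq (.storeNat (.lit 4) (.var 11) (.var 30)) <|
        .seq (.storeNat (.lit 5) (.var 11) (.lit 0)) (.setNat 11 (.add (.var 11) (.lit 1)))) .skip

theorem wp_collect {K : ComplexIn (Fin n) d} {s : State n} {p rb : ℕ} (h0 : s.natVar 0 = n)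
    (h2 : s.natVar 2 = p) (h9 : s.natVar 9 = rb) (hp : 10 ≤ p) {P : ℕ → Prop} [DecidablePred P]
    (hP : ∀ w < n, P w ↔ s.natMem 2 w ≠ 0 ∧ s.natMem p (n + w) = 0 ∧ 0 < s.realMem rb w)
    {Post : State n → ℕ → ℕ → Prop}
    (h : ∀ ν μ t, (∀ x < 30, x ≠ 11 → ν x = s.natVar x) → (∀ b, b ≠ 4 → b ≠ 5 → μ b = s.natMem b) →
      (Finset.range (ν 11)).image (μ 4) = (Finset.range n).filter P →
      ((Finset.range n).filter P).card = ν 11 → (∀ q < ν 11, μ 5 q = 0) → t ≤ 50 * n + 20 →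
      Post { s with natVar := ν, natMem := μ } t 0) :
    wp K collect s Post := by
  unfold collect
  rw [wp_seq, wp_setNat]
  refine (wp_forLt (by norm_num) 40 (fun k s' => ∃ ν μ, s' = { s with natVar := ν, natMem := μ } ∧
    (∀ x < 30, x ≠ 11 → ν x = s.natVar x) ∧ (∀ b, b ≠ 4 → b ≠ 5 → μ b = s.natMem b) ∧
      (Finset.range (ν 11)).image (μ 4) = (Finset.range k).filter P ∧
      ((Finset.range k).filter P).card = ν 11 ∧ (∀ q < ν 11, μ 5 q = 0)) ?_ ?_).mono ?_
  · refine ⟨_, _, rfl, ?_, fun _ _ _ => rfl, ?_, ?_, ?_⟩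
    · intro x hx h11
      simp [h11, show x ≠ 30 by omega]
    · simp
    · simp
    · simp
  · rintro k s' hk ⟨ν, μ, rfl, hν, hμ, himg, hcard, hzero⟩ h30 hν0
    have h30 : ν 30 = k := h30
    have hk : k < n := by simpa [h0] using hk
    have m0 : ν 0 = n := by rw [hν 0 (by norm_num) (by norm_num), h0]
    have m2 : ν 2 = p := by rw [hν 2 (by norm_num) (by norm_num), h2]
    have m9 : ν 9 = rb := by rw [hν 9 (by norm_num) (by norm_num), h9]
    have b2 : μ 2 = s.natMem 2 := hμ 2 (by norm_num) (by norm_num)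
    have bp : μ p = s.natMem p := hμ p (by omega) (by omega)
    have hr : (Finset.range (k + 1)).filter P =
        if P k then insert k ((Finset.range k).filter P) else (Finset.range k).filter P := by
      rw [Finset.range_add_one, Finset.filter_insert]
    rw [wp_ite]
    have hcP : (Test.and (.not (.natLe (.load (.lit 2) (.var 30)) (.lit 0)))
        (.and (.natLe (.load (.var 2) (.add (.var 0) (.var 30))) (.lit 0))
          (.not (.realLe (.load (.var 9) (.var 30)) (.lit 0))))).Holds
        ({ s with natVar := ν, natMem := μ } : State n) ↔ P k := by
      rw [hP k hk]
      simp [m0, m2, m9, h30, b2, bp]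
    rw [hcP]
    constructor
    · intro hc
      rw [hr, if_pos hc]
      simp only [wp_seq, wp_storeNat, wp_setNat]
      refine ⟨?_, ?_, ⟨Function.update (Function.update ν 11 (ν 11 + 1)) 30 (k + 1), _, rfl, ?_, ?_, ?_, ?_, ?_⟩, ?_, ?_⟩
      · simp [h30]
      · simpa using hν0
      · intro x hx h11
        simp [h11, show x ≠ 30 by omega, hν x hx h11]
      · intro b h4 h5
        simp [h4, h5, hμ b h4 h5]
      · simp [Finset.range_add_one, h30]
        rw [← himg]
        congr 1
        refine Finset.image_congr fun i hi => ?_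
        have : i < ν 11 := by simpa using hi
        rw [Function.update_of_ne (by omega)]
      · rw [Finset.card_insert_of_notMem (by simp), hcard]
        simp
      · intro q hq
        simp at hq ⊢
        by_cases hq' : q = ν 11
        · simp [hq']
        · rw [Function.update_of_ne hq', hzero q (by omega)]
      · simp
      · simp
    · intro hc
      rw [hr, if_neg hc, wp_skip]
      refine ⟨h30, hν0, ⟨_, _, rfl, ?_, hμ, ?_, ?_, ?_⟩, ?_, rfl⟩
      · intro x hx h11
        simp [show x ≠ 30 by omega, hν x hx h11]
      · simpa using himg
      · simpa using hcard
      · simpa using hzero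
      · simp
  · rintro s' t q ⟨-, -, ⟨ν, μ, rfl, hν, hμ, himg, hcard, hzero⟩, ht, rfl⟩
    simp [h0] at himg hcard ht ⊢
    exact h ν μ _ hν hμ himg hcard hzero (by omega)

/-- This is the legality of the candidate lookup: in breadth-first order all simplices of smaller
dimension have been processed, so the skeleton up to the dimension of `F p` is complete. -/
theorem Main.found_filter {K : ComplexIn (Fin n) d} {s : State n} {F : ℕ → Finset (Fin n)}
    {par : ℕ → ℕ} {last : ℕ → Fin n} {p c b : ℕ} (h : Main K s F par last p c b) :
    s.found.filter (fun ρ => ρ.card ≤ (F p).card) = K.faces.filter (fun ρ => ρ.card ≤ (F p).card) := by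
  ext ρ
  simp only [Finset.mem_filter, and_congr_left_iff]
  intro hρ
  rw [h.found]
  constructor
  · rintro (⟨v, rfl⟩ | ⟨k, h1, h2, rfl⟩)
    · exact K.vertex_mem v
    · exact h.table.face k h1 h2
  · intro hf
    exact Or.inr (h.table.complete h.done (h.table.card_lt_imp h.ten_le) hf hρ)

open Classical in
/-- The vertices to be considered as new vertices at the simplex `p`. -/
noncomputable def targets (K : ComplexIn (Fin n) d) (s : State n) (σ : Finset (Fin n)) (p : ℕ) :
    Finset ℕ :=
  (Finset.univ.filter fun w : Fin n => (σ = ∅ ∨ K.IsCandidate σ w) ∧ s.natMem p (n + w) = 0 ∧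
    0 < s.realMem (realBlock n d p) w).image Fin.val

theorem mem_targets {K : ComplexIn (Fin n) d} {s : State n} {σ : Finset (Fin n)} {p : ℕ} {w : Fin n} :
    (w : ℕ) ∈ targets K s σ p ↔ (σ = ∅ ∨ K.IsCandidate σ w) ∧ s.natMem p (n + w) = 0 ∧
      0 < s.realMem (realBlock n d p) w := by
  classical
  rw [targets, Finset.mem_image]
  constructor
  · rintro ⟨v, hv, he⟩
    obtain rfl := Fin.ext he
    simpa using hv
  · intro hw
    exact ⟨w, by simpa using hw, rfl⟩

theorem targets_lt {K : ComplexIn (Fin n) d} {s : State n} {σ : Finset (Fin n)} {p w : ℕ}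
    (hw : w ∈ targets K s σ p) : w < n := by
  classical
  rw [targets, Finset.mem_image] at hw
  obtain ⟨v, -, rfl⟩ := hw
  exact v.2

/-- Load the data of the current simplex and collect its targets. -/
def setup : Prog := .seq lookUp collect

/-- The empty simplex is not a face and has no candidate lookup; there, all vertices are admitted
instead. -/
theorem wp_setup {K : ComplexIn (Fin n) d} {s : State n} {F : ℕ → Finset (Fin n)}
    {par : ℕ → ℕ} {last : ℕ → Fin n} {p c b : ℕ} (hs : Main K s F par last p c b) (hc : p < c)
    {Post : State n → ℕ → ℕ → Prop}
    (h : ∀ ν μ t, (∀ x < 30, x < 8 ∨ 11 < x → ν x = s.natVar x) →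
      ν 8 = (F p).card → ν 9 = realBlock n d p → ν 10 = d - (F p).card →
      (∀ b, b < 2 ∨ b = 3 ∨ 5 < b → μ b = s.natMem b) →
      (Finset.range (ν 11)).image (μ 4) = targets K s (F p) p →
      (targets K s (F p) p).card = ν 11 → (∀ q < ν 11, μ 5 q = 0) → t ≤ 70 * n + 80 →
      Post { s with natVar := ν, natMem := μ } t 0) :
    wp K setup s Post := by
  classical
  have hT := hs.table
  unfold setup lookUp
  simp only [wp_seq, wp_setNat]
  set s1 : State n := ((s.setNatVar 8 _).setNatVar 9 _).setNatVar 10 _ with hs1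
  have e1 : s1 = { s with natVar := Function.update (Function.update (Function.update s.natVar 8
      (F p).card) 9 (realBlock n d p)) 10 (d - (F p).card) } := by
    simp [hs1, hs.h2, hs.h1, hT.len p hs.ten_le hc, hT.block p hs.ten_le hc, realBlock]
  rw [e1]
  clear_value s1
  have hrest : ∀ ν μ t0 (Post' : State n → ℕ → ℕ → Prop),
      (∀ s t, Post s (t0 + t) 0 → Post' s t 0) → (∀ x < 30, ν x = (Function.update (Function.update (Function.update s.natVar 8
        (F p).card) 9 (realBlock n d p)) 10 (d - (F p).card)) x) → (∀ b ≠ 2, μ b = s.natMem b) →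
      (∀ w : Fin n, μ 2 w ≠ 0 ↔ (F p = ∅ ∨ K.IsCandidate (F p) w)) → t0 ≤ 20 * n + 50 →
      wp K collect { s with natVar := ν, natMem := μ } Post' := by
    intro ν μ t0 Post' hPost hν hμ hcand ht0
    have hpp : p ≠ 2 := by have := hs.ten_le; omega
    refine wp_collect (p := p) (rb := realBlock n d p) (P := fun w => w ∈ targets K s (F p) p) ?_ ?_ ?_ hs.ten_le ?_ ?_
    · simp [hν, hs.h0]
    · simp [hν, hs.h2]
    · simp [hν]
    · intro w hw
      have := mem_targets (K := K) (s := s) (σ := F p) (p := p) (w := ⟨w, hw⟩)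
      simp only at this
      rw [this, ← hcand ⟨w, hw⟩]
      simp only [hμ p hpp]
    · intro ν' μ' t hν' hμ' himg hcard hzero ht
      have hf : (Finset.range n).filter (fun w => w ∈ targets K s (F p) p) = targets K s (F p) p := by
        ext w
        simp only [Finset.mem_filter, Finset.mem_range, and_iff_right_iff_imp]
        exact targets_lt
      rw [hf] at himg hcard
      refine hPost _ _ (h ν' μ' _ ?_ ?_ ?_ ?_ ?_ himg hcard hzero (by omega))
      · intro x hx hx'
        have : ν' x = ν x := hν' x hx (by omega)
        rw [this, hν x hx]
        simp [show x ≠ 8 by omega, show x ≠ 9 by omega, show x ≠ 10 by omega]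
      · rw [hν' 8 (by norm_num) (by norm_num)]; simp [hν]
      · rw [hν' 9 (by norm_num) (by norm_num)]; simp [hν]
      · rw [hν' 10 (by norm_num) (by norm_num)]; simp [hν]
      · intro b hb
        rw [hμ' b (by omega) (by omega)]
        exact hμ b (by omega)
  rw [wp_ite]
  constructor
  · intro h8
    have h8 : (F p).card = 0 := by simpa using h8
    have hemp : F p = ∅ := Finset.card_eq_zero.1 h8
    refine (wp_forLt (by norm_num) 5 (fun k s' => s' = { s with
      natVar := Function.update (Function.update (Function.update (Function.update s.natVar 8
        (F p).card) 9 (realBlock n d p)) 10 (d - (F p).card)) 30 k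
      natMem := Function.update s.natMem 2 fun o => if o < k then 1 else s.natMem 2 o }) ?_ ?_).mono ?_
    · simp
    · rintro k s' hk rfl - -
      simp
      congr 1
      funext o
      by_cases ho : o = k
      · subst ho; simp
      · rw [Function.update_of_ne ho]
        by_cases h1 : o < k
        · rw [if_pos h1, if_pos (by omega)]
        · rw [if_neg h1, if_neg (by omega)]
    · rintro s' t q ⟨-, -, rfl, ht, rfl⟩
      have e0 : Function.update (Function.update (Function.update s.natVar 8 (F p).card) 9
          (realBlock n d p)) 10 (d - (F p).card) 0 = n := by simp [hs.h0]
      simp only [e0] at ht ⊢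
      refine hrest _ _ (16 + t) _ ?_ ?_ ?_ ?_ ?_
      · intro s t hp
        convert hp using 1
        simp; omega
      · intro x hx
        rw [Function.update_of_ne (by omega)]
      · intro b hb
        rw [Function.update_of_ne hb]
      · intro w
        simp [hemp]
      · omega
  · intro h8
    have h8 : (F p).card ≠ 0 := by simpa using h8
    have hne : F p ≠ ∅ := fun he => h8 (by simp [he])
    have hp10 : 10 < p := lt_of_le_of_ne hs.ten_le (by rintro rfl; exact hne hT.root)
    refine wp_cand (F p) ?_ (hT.face p hp10 hc) hs.found_filter ?_
    · simp [State.Lists, hs.h2]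
      exact hT.lists p hs.ten_le hc
    · refine hrest _ _ (20 + (F p).card + n) _ ?_ (fun _ _ => rfl) ?_ ?_ ?_
      · intro s t hp
        convert hp using 1
        simp; omega
      · intro b hb
        simp [hb]
      · intro w
        simp [hne]
      · have : (F p).card ≤ n := by simpa using Finset.card_le_univ (F p)
        omega

end RealRAM

namespace RealRAM

open ComplexIn

variable {n d : ℕ}

attribute [local simp] NatExp.eval RealExp.eval Test.Holds NatExp.cost RealExp.cost Test.cost
  State.setNatVar State.setRealVar State.setNatCell State.setRealCell wp_skip wp_setNat wp_setReal
  wp_storeNat wp_storeReal wp_seq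

/-! ### Expansion of a simplex -/

/-- Count the unknown cofacets of the current simplex. -/
def count : Prog :=
  .ite (.natLe (.var 8) (.lit 0)) (.setNat 12 (.var 0)) <|
    -- The combination `f - 2 f` is `-f`.
    .seq (.setReal 1 (.lit 2)) <| .seq (axpy 6 9 9 1 19) <| .seq query <| .setNat 12 (.var 17)

/-- All unknown cofacets have `f > 0`, so the query with `-f` counts every one of them. For the
empty simplex the answer `n` is known in advance and no query is made. -/
theorem wp_count {K : ComplexIn (Fin n) d} {s : State n} {F : ℕ → Finset (Fin n)}
    {par : ℕ → ℕ} {last : ℕ → Fin n} {p c : ℕ} (hs : Main K s F par last p c p) (hc : p < c)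
    (h8 : s.natVar 8 = (F p).card) (h9 : s.natVar 9 = realBlock n d p)
    (hne : ∃ w : Fin n, 0 < s.realMem (realBlock n d p) w)
    {Post : State n → ℕ → ℕ → Prop}
    (h : ∀ ν ρ δ ε t q, (∀ x < 30, x ≠ 12 → x ≠ 17 → ν x = s.natVar x) →
      ν 12 = (unknown K (F p) (s.natMem p)).card → t ≤ 100 * (n + d) + 100 →
      (q = 0 ∨ q = 1 ∧ F p ≠ ∅) →
      Post { s with
        natVar := ν, realVar := ρ
        realMem := Function.update (Function.update s.realMem (n + 1) δ) (n + 2) ε } t q) :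
    wp K count s Post := by
  have hT := hs.table
  have hrb : n + 3 ≤ realBlock n d p := by unfold realBlock; omega
  unfold count
  rw [wp_ite]
  constructor
  · intro hc8
    have hc8 : (F p).card = 0 := by simpa [h8] using hc8
    have hemp : F p = ∅ := Finset.card_eq_zero.1 hc8
    have hp10 : p = 10 := hT.inj p 10 hs.ten_le hc le_rfl hT.lt (by rw [hemp, hT.root])
    subst hp10
    -- A further simplex would have a parent numbered at least `10`, yet below `p = 10`: nothing has
    -- been found before the root is processed.
    have hc11 : c = 11 := by
      by_contra hne
      have h1 := (hT.par_lt 11 (by norm_num) (by have := hT.lt; omega)).1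
      have h2 := hs.par_lt 11 (by norm_num) (by have := hT.lt; omega)
      omega
    have huniv : unknown K (F 10) (s.natMem 10) = Finset.univ := by
      ext w
      simp only [Finset.mem_univ, iff_true]
      rw [hT.mem_unknown le_rfl hc, hemp]
      refine ⟨by simp, by simpa using K.vertex_mem w, fun q h1 h2 => ?_⟩
      obtain rfl : q = 10 := by omega
      rw [hemp]
      exact (Finset.insert_ne_empty _ _).symm
    rw [wp_setNat]
    have := h (Function.update s.natVar 12 n) s.realVar (s.realMem (n + 1)) (s.realMem (n + 2)) 6 0
      (fun x _ h12 _ => Function.update_of_ne h12 _ _) (by rw [huniv]; simp) (by omega) (Or.inl rfl)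
    simpa [hs.h0] using this
  · intro hc8
    have hc8 : (F p).card ≠ 0 := by simpa [h8] using hc8
    have hnemp : F p ≠ ∅ := fun he => hc8 (by simp [he])
    have hp10 : 10 < p := lt_of_le_of_ne hs.ten_le (by rintro rfl; exact hnemp hT.root)
    set f := s.realMem (realBlock n d p) with hf
    set g : ℕ → ℝ := fun q => if q < n + d then f q - 2 * f q else s.realMem (n + 1) q with hg
    have gval : ∀ v : Fin n, g v = -f v := fun v => by
      simp only [hg]; rw [if_pos (by omega)]; ring
    rw [wp_seq, wp_setReal, wp_seq]
    refine wp_axpy (by norm_num) (by norm_num) (by norm_num) (by norm_num) ?_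
    intro t1 ht1
    rw [wp_seq]
    refine wp_congr_state (s' := { s with
      natVar := Function.update s.natVar 40 (n + d)
      realVar := Function.update s.realVar 1 2
      realMem := Function.update s.realMem (n + 1) g }) ?_ ?_
    · simp [h9, hs.h6, hs.h19, ← hf, hg]
    refine wp_query (σ := F p) (by simp [hs.h0]) (by simp [hs.h1]) (by simp [hs.h6, hs.h7]) ?_
      (hT.face p hp10 hc) ?_ ?_ ?_ ?_ ?_
    · simp [State.Lists, hs.h2, h8]
      exact hT.lists p hs.ten_le hc
    · simp [hs.h6]
      exact ((hs.reals.affine p hs.ten_le hc).sub_mul (hs.reals.affine p hs.ten_le hc) 2).congr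
        fun q hq => if_pos hq
    · intro u hu
      simp [hs.h6, gval]
      exact hs.reals.zero p hs.ten_le hc u hu
    · obtain ⟨w, hw⟩ := hne
      refine ⟨w, ?_⟩
      simp [hs.h6, gval]
      exact hw.ne'
    · intro w
      simp [hs.h2]
      exact fun hw => hT.up_mem_link hs.ten_le hc hw
    · intro ν ρ δ t hν hρ h17 ht
      simp [hs.h2, hs.h6, gval] at h17
      rw [Finset.filter_true_of_mem fun w hw =>
        (hs.reals.pos_of_unknown hT hs.done hs.ten_le hc hw).le] at h17
      rw [wp_setNat]
      have := h (Function.update ν 12 (ν 17)) ρ g δ (2 + (t1 + (t + 2)) + 4) 1 ?_ ?_ ?_ (Or.inr ⟨rfl, hnemp⟩)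
      · convert this using 1
        · simp [hs.h7]
        · simp; omega
      · intro x hx h12 h17
        rw [Function.update_of_ne h12, hν x (by omega) h17]
        simp [show x ≠ 40 by omega]
      · simpa using h17
      · simp [hs.h19] at ht1
        omega

/-- Make the functionals of the current simplex available, sort its targets, and find a functional
that separates them. -/
def expand : Prog :=
  .seq (.ite (.natLe (.var 8) (.lit 0)) .skip materialize) <|
  .seq mergeSort <| .seq chooseEps combine

/-- A bound on the time of an expansion. -/
def expandTime (n d len : ℕ) : ℕ :=
  (if len = 0 then 0 else d * (21 * (n + d) + 50)) + (Nat.clog 2 n * (250 * n + 60) + 60 * (n * d)) +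
    n * (80 * d + 120) + (d * (21 * (if len = 0 then n else n + d) + 60) + 20 * (n + d)) + 300

theorem slope_sum (m : ℕ) (e : ℝ) (B : ℕ → ℝ) (f : ℝ) :
    (∑ j ∈ Finset.range m, e ^ j * B j) / f = ∑ j ∈ Finset.range m, e ^ j * (B j / f) := by
  rw [Finset.sum_div]
  exact Finset.sum_congr rfl fun j _ => by ring

/-- Distinct rays give distinct keys, the sort orders them, a small `ε` turns the lexicographic
order into an order of real slopes, and consecutive inequalities chain to all pairs. -/
theorem wp_expand {K : ComplexIn (Fin n) d} {s : State n} {F : ℕ → Finset (Fin n)}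
    {par : ℕ → ℕ} {last : ℕ → Fin n} {p c r : ℕ} (hs : Main K s F par last p c p) (hc : p < c)
    (h8 : s.natVar 8 = (F p).card) (h9 : s.natVar 9 = realBlock n d p)
    (h10 : s.natVar 10 = d - (F p).card) (h11 : s.natVar 11 = r)
    {T : Finset ℕ} (hT : (Finset.range r).image (s.natMem 4) = T) (hcard : T.card = r)
    (h5 : ∀ q < r, s.natMem 5 q = 0)
    (hTn : ∀ w ∈ T, w < n)
    (hTw : ∀ w : Fin n, (w : ℕ) ∈ T →
      (F p = ∅ ∨ K.IsCandidate (F p) w) ∧ 0 < s.realMem (realBlock n d p) w)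
    {Post : State n → ℕ → ℕ → Prop}
    (h : ∀ s' t e, Main K s' F par last p c p → s'.natMem p = s.natMem p →
      (∀ x < 20, x ≠ 18 → s'.natVar x = s.natVar x) →
      s'.natVar 20 = 4 ∨ s'.natVar 20 = 6 → (Finset.range r).image (s'.natMem (s'.natVar 20)) = T →
      Ready K s' (F p) p (realBlock n d p) r (s'.natMem (s'.natVar 20)) (s'.realMem (realBlock n d p))
        (s'.realMem n) →
      Expanded K s'.realMem (F p) p →
      (∀ q < n + d, s'.realMem n q =
        ∑ j ∈ Finset.range (d - (F p).card), e ^ j * s'.realMem (realBlock n d p + 1 + j) q) →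
      t ≤ expandTime n d (F p).card → Post s' t 0) :
    wp K expand s Post := by
  have hTab := hs.table
  have hrb : n + 3 ≤ realBlock n d p := by unfold realBlock; omega
  have hrn : r ≤ n := by
    rw [← hcard]
    have : T ⊆ Finset.range n := fun w hw => Finset.mem_range.2 (hTn w hw)
    simpa using Finset.card_le_card this
  set m := d - (F p).card with hm
  have hmd : m ≤ d := Nat.sub_le _ _
  unfold expand
  rw [wp_seq]
  -- the first part
  have hfirst : wp K (.ite (.natLe (.var 8) (.lit 0)) .skip materialize) s fun s1 t q =>
      (∃ ν ρ M, s1 = { s with natVar := ν, realVar := ρ, realMem := M } ∧ (∀ x < 30, ν x = s.natVar x) ∧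
        M (realBlock n d p) = s.realMem (realBlock n d p) ∧
        Reals K M F par last c ∧ Expanded K M (F p) p) ∧
      t ≤ (if (F p).card = 0 then 0 else d * (21 * (n + d) + 50)) + 50 ∧ q = 0 := by
    rw [wp_ite]
    constructor
    · intro hc8
      have hc8 : (F p).card = 0 := by simpa [h8] using hc8
      have hemp : F p = ∅ := Finset.card_eq_zero.1 hc8
      have hp10 : p = 10 := hTab.inj p 10 hs.ten_le hc le_rfl hTab.lt (by rw [hemp, hTab.root])
      subst hp10
      rw [wp_skip]
      refine ⟨⟨_, _, _, rfl, fun _ _ => rfl, rfl, hs.reals, hs.reals.expanded_root hTab.root⟩, ?_, rfl⟩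
      simp
    · intro hc8
      have hc8 : (F p).card ≠ 0 := by simpa [h8] using hc8
      have hnemp : F p ≠ ∅ := fun he => hc8 (by simp [he])
      have hp10 : 10 < p := lt_of_le_of_ne hs.ten_le (by rintro rfl; exact hnemp hTab.root)
      obtain ⟨p1, p2⟩ := hTab.par_lt p hp10 hc
      obtain ⟨q1, q2⟩ := hTab.par_mem p hp10 hc
      have hpos := Nat.pos_of_ne_zero hc8
      refine wp_materialize (rb := realBlock n d p) (pb := realBlock n d (par p)) (m := m) (N := n + d)
        (u := last p) h9 h10 hs.h19 ?_ ?_ ?_ ?_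
      · rw [hs.h0, hs.h2, h8, Nat.add_sub_assoc hpos, q1, hTab.block _ p1 (by omega), realBlock]
      · rw [hs.h2, h8, q2]
      · have := realBlock_add_le (n := n) (d := d) p1 p2
        omega
      · intro ν ρ t hν hρ ht
        obtain ⟨g1, g2⟩ := hs.reals.materialize hTab hp10 hc hs.par_lt
        refine ⟨⟨ν, ρ, _, rfl, hν, ?_, g1, g2⟩, ?_, rfl⟩
        · rw [elimMem, if_neg (by omega)]
        · rw [if_neg hc8]
          have := Nat.mul_le_mul_right (21 * (n + d) + 50) hmd
          simp
          omega
  refine hfirst.mono ?_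
  rintro s1 t1 q ⟨⟨ν1, ρ1, M, rfl, hν1, hM0, hreals, hexp⟩, ht1, rfl⟩
  rw [wp_seq]
  -- The embedding hypothesis behind the candidates enters here; at the empty simplex injectivity of
  -- the vertex map suffices.
  have hsep : ∀ x ∈ T, ∀ y ∈ T, x ≠ y → ∃ l < m,
      M (realBlock n d p + 1 + l) x / M (realBlock n d p) x ≠
      M (realBlock n d p + 1 + l) y / M (realBlock n d p) y := by
    intro x hx y hy hxy
    obtain ⟨x, rfl⟩ : ∃ x' : Fin n, x = x' := ⟨⟨x, hTn x hx⟩, rfl⟩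
    obtain ⟨y, rfl⟩ : ∃ y' : Fin n, y = y' := ⟨⟨y, hTn y hy⟩, rfl⟩
    have hxy : x ≠ y := fun he => hxy (by rw [he])
    obtain ⟨hx1, hx2⟩ := hTw x hx
    obtain ⟨hy1, hy2⟩ := hTw y hy
    have hsep : K.Separated (F p) x y := by
      rcases hx1 with he | hx1
      · rw [he]; exact separated_empty K hxy
      · rcases hy1 with he | hy1
        · rw [he]; exact separated_empty K hxy
        · exact hx1.separated hy1 hxy
    exact hexp.spans.exists_ne (by rw [hM0]; exact hx2) (by rw [hM0]; exact hy2) hsep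
  refine wp_mergeSort (s := { s with natVar := ν1, realVar := ρ1, realMem := M }) (m := m) ?_ h5 hT hcard ?_ ?_
  · simp only
    rw [hν1 11 (by norm_num), h11]
  · intro x hx y hy hxy
    obtain ⟨l, hl, hne⟩ := hsep x hx y hy hxy
    refine ⟨l, hl, ?_⟩
    simpa [State.key, hν1 9, h9] using hne
  intro ν2 μ2 t2 hν2 hμ2 hbuf himg hlex ht2
  rw [wp_seq]
  have k2 : ∀ x < 20, ν2 x = s.natVar x := fun x hx => (hν2 x hx).trans (hν1 x (by omega))
  have hkey : ∀ ν ρ μ, ν 9 = realBlock n d p → State.key ({ s with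
      natVar := ν, realVar := ρ, natMem := μ, realMem := M } : State n) = fun w h =>
        M (realBlock n d p + 1 + h) w / M (realBlock n d p) w := by
    intro ν ρ μ h
    funext w l
    simp [State.key, h]
  rw [hkey _ _ _ (by rw [hν1 9 (by norm_num), h9])] at hlex
  set o := μ2 (ν2 20) with ho
  set l := μ2 (ν2 21) with hl
  set key : ℕ → ℕ → ℝ := fun w h => M (realBlock n d p + 1 + h) w / M (realBlock n d p) w with hkeydef
  refine wp_chooseEps (o := o) (l := l) (r := r) (m := m) ?_ ?_ rfl rfl ?_ ?_
  · simp only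
    rw [k2 11 (by norm_num), h11]
  · simp only
    rw [k2 10 (by norm_num), h10]
  · rw [hkey _ _ _ (by rw [k2 9 (by norm_num), h9])]
    exact hlex
  intro ν3 ρ3 t3 hν3 hρ3 he0 he1 hgap ht3
  rw [hkey _ _ _ (by rw [k2 9 (by norm_num), h9])] at hgap
  simp only at hν3
  have k3 : ∀ x < 20, ν3 x = s.natVar x := fun x hx => (hν3 x (by omega)).trans (k2 x hx)
  refine wp_combine (rb := realBlock n d p) (m := m) (tb := n) (len := (F p).card) ?_ ?_ ?_ ?_ ?_ ?_ (by omega) ?_ ?_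
  · simp only; rw [k3 0 (by norm_num), hs.h0]
  · simp only; rw [k3 5 (by norm_num), hs.h5]
  · simp only; rw [k3 8 (by norm_num), h8]
  · simp only; rw [k3 19 (by norm_num), hs.h19]
  · simp only; rw [k3 9 (by norm_num), h9]
  · simp only; rw [k3 10 (by norm_num), h10]
  · intro h0 j hj i hi
    have hemp : F p = ∅ := Finset.card_eq_zero.1 h0
    have hp10 : p = 10 := hTab.inj p 10 hs.ten_le hc le_rfl hTab.lt (by rw [hemp, hTab.root])
    subst hp10
    exact hreals.unit j (by omega) i hi
  intro ν4 ρ4 τ t4 hν4 hρ4 hτ ht4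
  simp only at hν4 hτ
  set e := ρ3 0 with he
  have k4 : ∀ x < 20, x ≠ 18 → ν4 x = s.natVar x := fun x hx hx' => (hν4 x (by omega) hx').trans (k3 x hx)
  have k420 : ν4 20 = ν2 20 := by rw [hν4 20 (by norm_num) (by norm_num), hν3 20 (by norm_num)]
  have hpn : ∀ x ∈ T, (∑ j ∈ Finset.range m, e ^ j * M (realBlock n d p + 1 + j) x) = τ x := fun x hx =>
    (hτ x (by have := hTn x hx; omega)).symm
  have hoT : ∀ i < r, o i ∈ T := fun i hi => by
    rw [← himg]
    exact Finset.mem_image_of_mem _ (Finset.mem_range.2 hi)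
  have hfo : ∀ i < r, 0 < M (realBlock n d p) (o i) := fun i hi => by
    have := (hTw ⟨o i, hTn _ (hoT i hi)⟩ (hoT i hi)).2
    rwa [hM0]
  have hstep : ∀ i, i + 1 < r → τ (o i) / M (realBlock n d p) (o i) <
      τ (o (i + 1)) / M (realBlock n d p) (o (i + 1)) := by
    intro i hi
    rw [← hpn _ (hoT i (by omega)), ← hpn _ (hoT _ hi), slope_sum, slope_sum]
    exact (hlex (i + 1) (by omega) hi).sum_lt he0 he1 (hgap (i + 1) (by omega) hi)
  have hslopes : ∀ i j, i < j → j < r → τ (o i) / M (realBlock n d p) (o i) <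
      τ (o j) / M (realBlock n d p) (o j) := by
    intro i j hij hj
    induction j, hij using Nat.le_induction with
    | base => exact hstep i hj
    | succ j hij ih => exact (ih (by omega)).trans (hstep j hj)
  have hMn : ∀ b, b ≠ n → Function.update M n τ b = M b := fun b hb => Function.update_of_ne hb _ _
  have hmain : Main K ({ s with natVar := ν4, realVar := ρ4, natMem := μ2, realMem := Function.update M n τ } :
      State n) F par last p c p := by
    have h' : Main K ({ s with realMem := M } : State n) F par last p c p :=
      { hs with reals := hreals }
    refine h'.congr ?_ ?_ ?_ rfl
    · intro x hx
      exact k4 x (by omega) (by omega)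
    · intro x hx
      exact hμ2 x (by omega)
    · intro x hx _
      exact hMn x (by omega)
  have hμp : μ2 p = s.natMem p := hμ2 p (by have := hs.ten_le; omega)
  have hexp' : Expanded K (Function.update M n τ) (F p) p := hexp.congr fun j _ => hMn _ (by omega)
  have hτ' : ∀ q < n + d, Function.update M n τ n q =
      ∑ j ∈ Finset.range m, e ^ j * Function.update M n τ (realBlock n d p + 1 + j) q := by
    intro q hq
    rw [Function.update_self, hτ q hq]
    exact Finset.sum_congr rfl fun j _ => by rw [hMn _ (by omega)]
  refine h _ _ e hmain hμp k4 ?_ ?_ ?_ hexp' hτ' ?_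
  · simp only
    rwa [k420]
  · simp only
    rw [k420, himg]
  · have hMp := hMn (realBlock n d p) (by omega)
    have haff : K.Affine τ := (Affine.sum _ (fun j hj => hexp.affine j (Finset.mem_range.1 hj))
      (fun j => e ^ j)).congr hτ
    have hzero : ∀ v ∈ F p, τ v = 0 := fun v hv => by
      rw [hτ v (by omega)]
      exact Finset.sum_eq_zero fun j hj => by rw [hexp.zero j (Finset.mem_range.1 hj) v hv, mul_zero]
    have hR : Ready K ({ s with natVar := ν4, realVar := ρ4, natMem := μ2, realMem := Function.update M n τ } :
        State n) (F p) p (realBlock n d p) r o (M (realBlock n d p)) τ :=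
      { h0 := hmain.h0
        h1 := hmain.h1
        h2 := hmain.h2
        h5 := hmain.h5
        h6 := hmain.h6
        h7 := hmain.h7
        h8 := (k4 8 (by norm_num) (by norm_num)).trans h8
        h9 := (k4 9 (by norm_num) (by norm_num)).trans h9
        h11 := (k4 11 (by norm_num) (by norm_num)).trans h11
        h19 := hmain.h19
        h20 := by simp only; rw [k420]
        rb_le := hrb
        f_eq := hMp
        t_eq := Function.update_self _ _ _
        f_affine := hreals.affine p hs.ten_le hc
        t_affine := haff
        f_zero := hreals.zero p hs.ten_le hc
        t_zero := hzero
        o_lt := fun i hi => hTn _ (hoT i hi)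
        f_pos := hfo
        slopes := hslopes
        lists := by
          simp only [State.Lists, hμp]
          exact hTab.lists p hs.ten_le hc
        up := fun w hw => hTab.up_mem_link hs.ten_le hc (by simpa only [hμp] using hw) }
    convert hR using 1
    · simp only; rw [k420]
    · exact Function.update_self _ _ _
  · have b1 : Nat.clog 2 r ≤ Nat.clog 2 n := Nat.clog_mono_right _ hrn
    have b2 : Nat.clog 2 r * (250 * r + 60) ≤ Nat.clog 2 n * (250 * n + 60) := Nat.mul_le_mul b1 (by omega)
    have b3 : r * m ≤ n * d := Nat.mul_le_mul hrn hmd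
    have b4 : r * (80 * m + 120) ≤ n * (80 * d + 120) := Nat.mul_le_mul hrn (by omega)
    have b5 := Nat.mul_le_mul_right (21 * (if (F p).card = 0 then n else n + d) + 60) hmd
    unfold expandTime
    omega

end RealRAM

namespace RealRAM

open ComplexIn

variable {n d : ℕ}

attribute [local simp] NatExp.eval RealExp.eval Test.Holds NatExp.cost RealExp.cost Test.cost
  State.setNatVar State.setRealVar State.setNatCell State.setRealCell wp_skip wp_setNat wp_setReal
  wp_storeNat wp_storeReal wp_seq

/-! ### The loop over the unknown cofacets of a simplex -/

/-- Find and create one unknown cofacet of the current simplex. -/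
def child : Prog :=
  .seq findChild <|
  .seq (.setNat 16 (.load (.var 20) (.var 14))) <|
  .seq create <|
  .seq (.setNat 13 (.add (.var 14) (.lit 1))) (.setNat 12 (.sub (.var 12) (.lit 1)))

/-- Find and create all unknown cofacets of the current simplex. -/
def children : Prog :=
  .seq (.setNat 13 (.lit 0)) (.loop (.not (.natLe (.var 12) (.lit 0))) child)

/-- The state during the search for the cofacets of the simplex `p`: those before the place `lo` are
known, and `N` are not. -/
structure Searching (K : ComplexIn (Fin n) d) (s : State n) (F : ℕ → Finset (Fin n)) (par : ℕ → ℕ)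
    (last : ℕ → Fin n) (p c r lo N : ℕ) (o : ℕ → ℕ) (f t : ℕ → ℝ) (e : ℝ) : Prop where
  main : Main K s F par last p c (p + 1)
  lt : p < c
  ready : Ready K s (F p) p (realBlock n d p) r o f t
  buf : s.natVar 20 = 4 ∨ s.natVar 20 = 6
  expanded : Expanded K s.realMem (F p) p
  sum : ∀ q < n + d, t q =
    ∑ j ∈ Finset.range (d - (F p).card), e ^ j * s.realMem (realBlock n d p + 1 + j) q
  h12 : s.natVar 12 = N
  h13 : s.natVar 13 = lo
  card : (unknown K (F p) (s.natMem p)).card = N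
  place : ∀ w ∈ unknown K (F p) (s.natMem p), ∃ i, lo ≤ i ∧ i < r ∧ o i = w
  query : F p ∈ K.faces ∨ r - lo ≤ N
  order : ∀ k, 10 < k → k < c → par k = p → ∀ i, lo ≤ i → i < r → 0 < s.realMem (realBlock n d k) (o i)

/-- A bound on the time to find and create a simplex. -/
def childTime (n d : ℕ) : ℕ := Nat.clog 2 n * (100 * (n + d) + 130) + 80 * (n + d) + 130

/-- The sorted list and the functionals `f` and `t` of the current simplex survive the creation, so
one expansion serves all its children. The new functional is positive at all places after the one
just found. -/
theorem wp_child {K : ComplexIn (Fin n) d} {s : State n} {F : ℕ → Finset (Fin n)}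
    {par : ℕ → ℕ} {last : ℕ → Fin n} {p c r lo N : ℕ} {o : ℕ → ℕ} {f t : ℕ → ℝ} {e : ℝ}
    (hs : Searching K s F par last p c r lo N o f t e) (hN : 0 < N) (hrn : r ≤ n)
    {Post : State n → ℕ → ℕ → Prop}
    (h : ∀ s' T q F' par' last' lo', Searching K s' F' par' last' p (c + 1) r lo' (N - 1) o f t e →
      (∀ k < c, F' k = F k) → T ≤ childTime n d → q ≤ Nat.clog 2 n → Post s' T q) :
    wp K child s Post := by
  have hT := hs.main.table
  have hp := hs.main.ten_le
  have hc := hs.lt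
  have hrb : n + 3 ≤ realBlock n d p := by unfold realBlock; omega
  have hpc := realBlock_add_le (n := n) (d := d) hp hc
  unfold child
  rw [wp_seq]
  refine wp_findChild hs.ready hs.h12 hs.h13 hs.query hs.card hN hs.place ?_
  intro ν ρ δ ε T1 q1 hν hU hlo hr ⟨w, hw, how⟩ hT1 hq1
  obtain ⟨w1, w2, w3⟩ := (hT.mem_unknown hp hc).1 hw
  set a := ν 14 with ha
  have hM : ∀ b, n + 3 ≤ b → Function.update (Function.update s.realMem (n + 1) δ) (n + 2) ε b =
      s.realMem b := fun b hb => by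
    rw [Function.update_of_ne (by omega), Function.update_of_ne (by omega)]
  have hMn : Function.update (Function.update s.realMem (n + 1) δ) (n + 2) ε n = t := by
    rw [Function.update_of_ne (by omega), Function.update_of_ne (by omega), hs.ready.t_eq]
  set M := Function.update (Function.update s.realMem (n + 1) δ) (n + 2) ε with hMdef
  have hmain : Main K ({ s with natVar := Function.update ν 16 w, realVar := ρ, realMem := M } : State n)
      F par last p c (p + 1) := by
    refine hs.main.congr ?_ (fun _ _ => rfl) (fun b hb _ => hM b hb) rfl
    intro x hx
    simp only
    rw [Function.update_of_ne (by omega), hν x (by omega) (by omega) (by omega) (by omega)]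
  have hMf : M (realBlock n d p) = f := by rw [hM _ hrb, hs.ready.f_eq]
  have hfw : 0 < f w := how ▸ hs.ready.f_pos a hr
  rw [wp_seq, wp_setNat, wp_seq]
  refine wp_congr_state
    (s' := { s with natVar := Function.update ν 16 w, realVar := ρ, realMem := M }) ?_ ?_
  · have : s.natMem (ν 20) = o := by
      rw [hν 20 (by norm_num) (by norm_num) (by norm_num) (by norm_num), hs.ready.h20]
    simp [this, ← ha, how]
  -- The facets of the new simplex have the dimension of `F p` and have all been found.
  have hfac : ∀ v ∈ F p, ∃ q, 10 ≤ q ∧ q < c ∧ F q = (insert w (F p)).erase v := by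
    intro v hv
    have hwv : w ≠ v := by rintro rfl; exact w1 hv
    have hcard : ((insert w (F p)).erase v).card = (F p).card := by
      rw [Finset.card_erase_of_mem (Finset.mem_insert_of_mem hv), Finset.card_insert_of_notMem w1,
        Nat.add_sub_cancel]
    obtain ⟨k, k1, k2, k3⟩ := hT.complete hs.main.done (hT.card_lt_imp hp)
      (K.down_closed _ w2 _ (Finset.erase_subset v _)
        ⟨w, Finset.mem_erase.2 ⟨hwv, Finset.mem_insert_self _ _⟩⟩) hcard.le
    exact ⟨k, k1.le, k2, k3⟩
  -- An earlier facet would have been processed and would have revealed the simplex.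
  have hfirst : ∀ q (v : Fin n), 10 ≤ q → q < p → v ∉ F q → insert v (F q) ≠ insert w (F p) := by
    intro q v h1 h2 h3 h4
    obtain ⟨k, k1, k2, k3⟩ := hs.main.done q v h1 h2 h3 (h4 ▸ w2)
    exact w3 k k1.le k2 (k3.trans h4)
  have hx : ∀ x < 30, x ≠ 14 → x ≠ 15 → x ≠ 16 → x ≠ 17 → Function.update ν 16 w x = s.natVar x := by
    intro x h1 h2 h3 h4 h5
    rw [Function.update_of_ne h4, hν x h1 h2 h3 h5]
  refine wp_create (σ := F p) (p := p) (c := c) (R := realBlock n d c) (rb := realBlock n d p) (tb := n)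
    (w := w) hmain.h0 hmain.h1 hmain.h2 hmain.h3 hmain.h4 hmain.h5
    ((hx 8 (by norm_num) (by norm_num) (by norm_num) (by norm_num) (by norm_num)).trans hs.ready.h8)
    ((hx 9 (by norm_num) (by norm_num) (by norm_num) (by norm_num) (by norm_num)).trans hs.ready.h9)
    (by simp) hmain.h19 hc.ne hp (by omega) w1 hs.ready.lists ?_ ?_ ?_ ?_
  · intro i hi
    obtain ⟨v, hv, hv'⟩ := hT.entry hp hc hi
    simp only
    rw [hv']
    exact ⟨v.2, fun he => w1 (Fin.ext he ▸ hv)⟩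
  · intro i hi
    obtain ⟨v, hv, hv'⟩ := hT.entry hp hc hi
    exact (hT.down p hp hc i hi v hv').2.1.ne
  · intro i hi
    obtain ⟨v, hv, hv'⟩ := hT.entry hp hc hi
    have := hT.sideFacet hp hc w1 hfac hi hv'
    exact ⟨this.1, this.2.1.ne⟩
  intro ν' ρ' α T2 hν' h3' h4' hρ' hα hT2
  rw [wp_seq, wp_setNat, wp_setNat]
  simp only at hν' hα ⊢
  rw [hMf, hMn] at hα
  set F' := Function.update F c (insert w (F p)) with hF'
  set par' := Function.update par c p with hpar'
  set last' := Function.update last c w with hlast'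
  set μ' := createMem n s.natMem (F p).card p c (realBlock n d c) w with hμ'
  set M' := Function.update M (realBlock n d c) α with hM'
  have hFk : ∀ k < c, F' k = F k := fun k hk => Function.update_of_ne hk.ne _ _
  have hFp := hFk p hc
  have hTab' : Table K μ' F' par' last' (c + 1) :=
    hT.extend hp hc (fun k k1 k2 => Nat.lt_succ_iff.1 (hs.main.par_lt k k1 k2)) w1 w2 w3 hfac hfirst
  have hexpM : Expanded K M (F p) p := hs.expanded.congr fun j _ => hM _ (by omega)
  have hsumM : ∀ q < n + d, t q =
      ∑ j ∈ Finset.range (d - (F p).card), e ^ j * M (realBlock n d p + 1 + j) q := by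
    intro q hq
    rw [hs.sum q hq]
    exact Finset.sum_congr rfl fun j _ => by rw [hM _ (by omega)]
  have hReals' : Reals K M' F' par' last' (c + 1) := by
    refine hmain.reals.extend hT hp hc hexpM w1 ?_ ?_ hsumM ?_
    · simp only
      rw [hMf]; exact hfw
    · intro k k1 k2 k3
      simp only
      rw [hM _ (by unfold realBlock; omega), ← how]
      exact hs.order k k1 k2 k3 a hlo hr
    · simp only
      rw [hMf]; exact hα
  have hM'p : ∀ j < d + 1, M' (realBlock n d p + j) = M (realBlock n d p + j) := fun j hj =>
    Function.update_of_ne (by omega) _ _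
  have hM'n : M' n = t := by
    rw [hM', Function.update_of_ne (by unfold realBlock; omega), hMn]
  have hunk : unknown K (F' p) (μ' p) = (unknown K (F p) (s.natMem p)).erase w := by
    ext v
    rw [Finset.mem_erase, hTab'.mem_unknown hp (by omega), hT.mem_unknown hp hc, hFp]
    constructor
    · rintro ⟨g1, g2, g3⟩
      refine ⟨?_, g1, g2, fun q q1 q2 => ?_⟩
      · rintro rfl
        exact g3 c (by omega) (by omega) (Function.update_self _ _ _)
      · rw [← hFk q q2]
        exact g3 q q1 (by omega)
    · rintro ⟨g0, g1, g2, g3⟩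
      refine ⟨g1, g2, fun q q1 q2 he => ?_⟩
      rcases Nat.lt_succ_iff_lt_or_eq.1 q2 with q2 | rfl
      · rw [hFk q q2] at he
        exact g3 q q1 q2 he
      · rw [hF', Function.update_self] at he
        have : v ∈ insert w (F p) := he ▸ Finset.mem_insert_self v _
        exact (Finset.mem_insert.1 this).elim g0 g1
  set ν'' := Function.update (Function.update ν' 13 (a + 1)) 12 (N - 1) with hν''
  have hxx : ∀ x, x < 3 ∨ (5 ≤ x ∧ x < 12) ∨ (18 ≤ x ∧ x < 30) → ν'' x = s.natVar x := by
    intro x hx30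
    rw [hν'', Function.update_of_ne (by omega), Function.update_of_ne (by omega),
      hν' x (by omega) (by omega) (by omega),
      hx x (by omega) (by omega) (by omega) (by omega) (by omega)]
  have hν''3 : ν'' 3 = c + 1 := by simp [hν'', h3']
  have hν''4 : ν'' 4 = realBlock n d (c + 1) := by
    have : c + 1 - 10 = (c - 10) + 1 := by omega
    simp [hν'', h4', realBlock, this]
    ring
  have hν'14 : ν' 14 = a := by
    rw [hν' 14 (by norm_num) (by norm_num) (by norm_num), Function.update_of_ne (by norm_num)]
  have hν'12 : ν' 12 = N := by
    rw [hν' 12 (by norm_num) (by norm_num) (by norm_num),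
      hx 12 (by norm_num) (by norm_num) (by norm_num) (by norm_num) (by norm_num), hs.h12]
  have hpost := h { natVar := ν'', realVar := ρ', natMem := μ', realMem := M',
                    found := insert (insert w (F p)) s.found } (T1 + (4 + (T2 + (4 + 4))))
    (q1 + (0 + (0 + (0 + 0)))) F' par' last' (a + 1) ?_ hFk ?_ ?_
  · convert hpost using 1
    · simp [hν'14, hν'12, hν'']
    · simp
  · have hmain' : Main K ({ natVar := ν'', realVar := ρ', natMem := μ', realMem := M',
                            found := insert (insert w (F p)) s.found } : State n)
        F' par' last' p (c + 1) (p + 1) :=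
      { h0 := by simp only; rw [hxx 0 (by norm_num), hs.main.h0]
        h1 := by simp only; rw [hxx 1 (by norm_num), hs.main.h1]
        h2 := by simp only; rw [hxx 2 (by norm_num), hs.main.h2]
        h3 := hν''3
        h4 := hν''4
        h5 := by simp only; rw [hxx 5 (by norm_num), hs.main.h5]
        h6 := by simp only; rw [hxx 6 (by norm_num), hs.main.h6]
        h7 := by simp only; rw [hxx 7 (by norm_num), hs.main.h7]
        h19 := by simp only; rw [hxx 19 (by norm_num), hs.main.h19]
        table := hTab'
        reals := hReals'
        found := by
          intro τ
          rw [Finset.mem_insert, hs.main.found]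
          constructor
          · rintro (rfl | hv | ⟨k, k1, k2, rfl⟩)
            · exact Or.inr ⟨c, by have := hT.lt; omega, by omega, Function.update_self _ _ _⟩
            · exact Or.inl hv
            · exact Or.inr ⟨k, k1, by omega, hFk k k2⟩
          · rintro (hv | ⟨k, k1, k2, rfl⟩)
            · exact Or.inr (Or.inl hv)
            · rcases Nat.lt_succ_iff_lt_or_eq.1 k2 with k2 | rfl
              · exact Or.inr (Or.inr ⟨k, k1, k2, (hFk k k2).symm⟩)
              · exact Or.inl (Function.update_self _ _ _)
        ten_le := hp
        par_lt := by
          intro k k1 k2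
          rcases Nat.lt_succ_iff_lt_or_eq.1 k2 with k2 | rfl
          · rw [hpar', Function.update_of_ne k2.ne]
            exact hs.main.par_lt k k1 k2
          · rw [hpar', Function.update_self]
            omega
        done := by
          intro q v q1 q2
          rw [hFk q (by omega)]
          intro q3 q4
          obtain ⟨k, k1, k2, k3⟩ := hs.main.done q v q1 q2 q3 q4
          exact ⟨k, k1, by omega, (hFk k k2).trans k3⟩ }
    have h20 : ν'' 20 = s.natVar 20 := hxx 20 (by norm_num)
    have hready : Ready K ({ natVar := ν'', realVar := ρ', natMem := μ', realMem := M',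
                             found := insert (insert w (F p)) s.found } : State n)
        (F p) p (realBlock n d p) r o f t :=
      { hs.ready with
        h0 := hmain'.h0
        h1 := hmain'.h1
        h2 := hmain'.h2
        h5 := hmain'.h5
        h6 := hmain'.h6
        h7 := hmain'.h7
        h8 := (hxx 8 (by norm_num)).trans hs.ready.h8
        h9 := (hxx 9 (by norm_num)).trans hs.ready.h9
        h11 := (hxx 11 (by norm_num)).trans hs.ready.h11
        h19 := hmain'.h19
        h20 := by
          simp only
          rw [h20, ← hs.ready.h20]
          funext x
          have hb := hs.buf
          rw [hμ', createMem, if_neg (by omega), if_neg (by omega), if_neg (by omega), if_neg]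
          rintro (⟨g1, -⟩ | ⟨i, hi, g1, -⟩)
          · omega
          · obtain ⟨v, hv, hv'⟩ := hT.entry hp hc hi
            have := (hT.sideFacet hp hc w1 hfac hi hv').1
            omega
        f_eq := (hM'p 0 (by omega)).trans hMf
        t_eq := hM'n
        lists := by
          have := hTab'.lists p hp (by omega)
          rwa [hFp] at this
        up := fun v hv => by
          have := hTab'.up_mem_link hp (by omega) hv
          rwa [hFp] at this }
    refine
      { main := hmain'
        lt := by omega
        ready := hFp.symm ▸ hready
        buf := by simp only; rw [h20]; exact hs.buf
        expanded := hFp.symm ▸ hexpM.congr hM'p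
        sum := ?_
        h12 := by simp [hν'']
        h13 := by simp [hν'']
        card := ?_
        place := ?_
        query := ?_
        order := ?_ }
    · intro q hq
      rw [hFp, hsumM q hq]
      refine Finset.sum_congr rfl fun j hj => ?_
      have := Finset.mem_range.1 hj
      have := hM'p (1 + j) (by omega)
      rw [← add_assoc] at this
      simp only
      rw [this]
    · simp only
      rw [hunk, Finset.card_erase_of_mem hw, hs.card]
    · intro v hv
      simp only at hv
      rw [hunk, Finset.mem_erase] at hv
      obtain ⟨i, i1, i2, i3⟩ := hU v hv.2
      refine ⟨i, ?_, i2, i3⟩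
      have : i ≠ a := by
        rintro rfl
        exact hv.1 (Fin.ext (i3.symm.trans how))
      omega
    · rw [hFp]
      refine hs.query.imp_right fun hq => ?_
      omega
    · intro k k1 k2 k3 i i1 i2
      simp only
      rcases Nat.lt_succ_iff_lt_or_eq.1 k2 with k2 | rfl
      · have hkc := realBlock_add_le (n := n) (d := d) k1.le k2
        rw [hpar', Function.update_of_ne k2.ne] at k3
        rw [hM', Function.update_of_ne (by omega), hM _ (by unfold realBlock; omega)]
        exact hs.order k k1 k2 k3 i (by omega) i2
      -- The functional of the new simplex is the one through its own place, hence positive at the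
      -- later places.
      · have := hs.ready.o_lt i i2
        rw [hM', Function.update_self, hα _ (by omega), ← how]
        exact hs.ready.sub_pos (by omega) i2
  · have hcl : Nat.clog 2 r ≤ Nat.clog 2 n := Nat.clog_mono_right _ hrn
    have := Nat.mul_le_mul_right (100 * (n + d) + 130) hcl
    unfold childTime
    omega
  · have hcl : Nat.clog 2 r ≤ Nat.clog 2 n := Nat.clog_mono_right _ hrn
    omega

/-- The sum of the next free number and the count of unknown cofacets is constant, so the number of
rounds equals the number of simplices created. -/
theorem wp_children {K : ComplexIn (Fin n) d} {s : State n} {F : ℕ → Finset (Fin n)}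
    {par : ℕ → ℕ} {last : ℕ → Fin n} {p c r N : ℕ} {o : ℕ → ℕ} {f t : ℕ → ℝ} {e : ℝ}
    (hs : Searching K (s.setNatVar 13 0) F par last p c r 0 N o f t e) (hrn : r ≤ n)
    {Post : State n → ℕ → ℕ → Prop}
    (h : ∀ s' T q c' F' par' last', Main K s' F' par' last' p c' (p + 1) → c ≤ c' →
      (∀ k < c, F' k = F k) → unknown K (F' p) (s'.natMem p) = ∅ →
      T ≤ (c' - c) * (childTime n d + 10) + 10 → q ≤ (c' - c) * Nat.clog 2 n → Post s' T q) :
    wp K children s Post := by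
  unfold children
  rw [wp_seq, wp_setNat]
  refine (wp_loop (fun s' φ ψ => ∃ F' par' last' c' lo N', Searching K s' F' par' last' p c' r lo N' o f t e ∧
    c ≤ c' ∧ c' + N' = c + N ∧ (∀ k < c, F' k = F k) ∧ φ = N' * (childTime n d + 10) ∧
    ψ = N' * Nat.clog 2 n) ?_ (φ := N * (childTime n d + 10)) (ψ := N * Nat.clog 2 n) ?_).mono ?_
  · rintro s' φ ψ ⟨F', par', last', c', lo, N', hs', hcc, hcN, hF, rfl, rfl⟩ hc
    have hN' : 0 < N' := by simpa [hs'.h12, Nat.pos_iff_ne_zero] using hc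
    refine wp_child hs' hN' hrn ?_
    intro s2 T q F2 par2 last2 lo2 hs2 hF2 hT hq
    obtain ⟨N2, rfl⟩ : ∃ N2, N' = N2 + 1 := ⟨N' - 1, by omega⟩
    rw [Nat.add_sub_cancel] at hs2
    refine ⟨_, _, ⟨F2, par2, last2, c' + 1, lo2, N2, hs2, by omega, by omega, ?_, rfl, rfl⟩, ?_, ?_⟩
    · intro k hk
      rw [hF2 k (by omega), hF k hk]
    · rw [Nat.succ_mul]
      simp
      omega
    · rw [Nat.succ_mul]
      omega
  · exact ⟨F, par, last, c, 0, N, hs, le_rfl, rfl, fun _ _ => rfl, rfl, rfl⟩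
  · rintro s' T q ⟨φ, ψ, ⟨F', par', last', c', lo, N', hs', hcc, hcN, hF, rfl, rfl⟩, hc, hT, hq⟩
    have hN' : N' = 0 := by simpa [hs'.h12] using hc
    subst hN'
    have hNc : N = c' - c := by omega
    refine h s' _ _ c' F' par' last' hs'.main hcc hF (Finset.card_eq_zero.1 hs'.card) ?_ ?_
    · rw [← hNc]
      simp at hT ⊢
      omega
    · rw [← hNc]
      simp at hq ⊢
      omega

end RealRAM

namespace RealRAM

open ComplexIn

variable {n d : ℕ}

attribute [local simp] NatExp.eval RealExp.eval Test.Holds NatExp.cost RealExp.cost Test.cost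
  State.setNatVar State.setRealVar State.setNatCell State.setRealCell wp_skip wp_setNat wp_setReal
  wp_storeNat wp_storeReal wp_seq

/-! ### Processing a simplex -/

/-- Find all unknown cofacets of the current simplex. -/
def process : Prog :=
  .seq setup <|
  .seq (.ite (.natLe (.var 11) (.lit 0)) .skip <|
    .seq count <| .ite (.natLe (.var 12) (.lit 0)) .skip (.seq expand children)) <|
  .setNat 2 (.add (.var 2) (.lit 1))

/-- When nothing unknown is left at `p`, its cofacets are complete, which is what the invariant
asserts for every processed simplex. -/
theorem Main.advance {K : ComplexIn (Fin n) d} {s : State n} {F : ℕ → Finset (Fin n)}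
    {par : ℕ → ℕ} {last : ℕ → Fin n} {p c b : ℕ} (hs : Main K s F par last p c b) (hb : b ≤ p + 1)
    (hc : p < c) (hU : unknown K (F p) (s.natMem p) = ∅) :
    Main K (s.setNatVar 2 (p + 1)) F par last (p + 1) c (p + 1) :=
  { hs with
    h2 := by simp
    ten_le := by have := hs.ten_le; omega
    par_lt := fun k k1 k2 => (hs.par_lt k k1 k2).trans_le hb
    done := by
      intro q v q1 q2 q3 q4
      rcases Nat.lt_succ_iff_lt_or_eq.1 q2 with q2 | rfl
      · exact hs.done q v q1 q2 q3 q4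
      · have : v ∉ unknown K (F q) (s.natMem q) := by simp [hU]
        rw [hs.table.mem_unknown q1 hc] at this
        push Not at this
        obtain ⟨k, k1, k2, k3⟩ := this q3 q4
        refine ⟨k, lt_of_le_of_ne k1 ?_, k2, k3⟩
        rintro rfl
        rw [hs.table.root] at k3
        exact Finset.insert_ne_empty _ _ k3.symm }

/-- A bound on the time to process a simplex, without expansion and creation of cofacets. -/
def baseTime (n d : ℕ) : ℕ := 200 * (n + d) + 300

/-- The expansion is accounted for separately by `x`, which is nonzero only for a simplex with a
nonempty link. All other costs are charged to `p` itself or to the simplices it creates. -/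
theorem wp_process {K : ComplexIn (Fin n) d} (hK : K.Embedded) {s : State n}
    {F : ℕ → Finset (Fin n)} {par : ℕ → ℕ} {last : ℕ → Fin n} {p c : ℕ}
    (hs : Main K s F par last p c p) (hc : p < c) {Post : State n → ℕ → ℕ → Prop}
    (h : ∀ s' t q x c' F' par' last', Main K s' F' par' last' (p + 1) c' (p + 1) → c ≤ c' →
      (∀ k < c, F' k = F k) →
      (x = 0 ∨ (K.link (F p)).Nonempty ∧ x ≤ expandTime n d (F p).card) →
      t ≤ baseTime n d + (c' - c) * (childTime n d + 10) + x →
      q ≤ (c' - c + 1) * Nat.clog 2 n → Post s' t q) :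
    wp K process s Post := by
  have hT := hs.table
  have hp := hs.ten_le
  have hrb : n + 3 ≤ realBlock n d p := by unfold realBlock; omega
  set T := targets K s (F p) p with hTdef
  -- Restricting to the positive side loses no unknown cofacet.
  have hUT : ∀ w ∈ unknown K (F p) (s.natMem p), (w : ℕ) ∈ T := by
    intro w hw
    have hw' := Finset.mem_filter.1 hw
    exact mem_targets.2 ⟨Or.inr (isCandidate_of_mem_link hK hw'.1), hw'.2,
      hs.reals.pos_of_unknown hT hs.done hp hc hw⟩
  have hrn : T.card ≤ n := by
    have : T ⊆ Finset.range n := fun w hw => Finset.mem_range.2 (targets_lt hw)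
    simpa using Finset.card_le_card this
  unfold process
  rw [wp_seq]
  refine wp_setup hs hc ?_
  intro ν μ t1 hν h8 h9 h10 hμ himg hcard h5 ht1
  set r := ν 11 with hr
  have hμp : μ p = s.natMem p := hμ p (by omega)
  have hmain1 : Main K ({ s with natVar := ν, natMem := μ } : State n) F par last p c p :=
    hs.congr (fun x hx => hν x (by omega) (by omega)) (fun x hx => hμ x (by omega)) (fun _ _ _ => rfl) rfl
  rw [wp_seq, wp_ite]
  constructor
  · intro hr0
    have hr0 : r = 0 := by simpa [← hr] using hr0
    have hU : unknown K (F p) (s.natMem p) = ∅ := by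
      rw [Finset.eq_empty_iff_forall_notMem]
      intro w hw
      have := hUT w hw
      have hT0 : T = ∅ := Finset.card_eq_zero.1 (hcard.trans hr0)
      rw [hT0] at this
      exact Finset.notMem_empty _ this
    rw [wp_skip, wp_setNat]
    have hadv := hmain1.advance (by omega) hc (by simp only; rw [hμp, hU])
    have e2 : NatExp.eval ({ s with natVar := ν, natMem := μ } : State n) (.add (.var 2) (.lit 1)) = p + 1 := by
      have := hmain1.h2
      simp only at this
      simp [this]
    rw [e2]
    refine h _ _ _ 0 c F par last hadv le_rfl (fun _ _ => rfl) (Or.inl rfl) ?_ ?_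
    · unfold baseTime
      simp
      omega
    · simp
  · intro hr0
    have hr0 : 0 < r := Nat.pos_of_ne_zero (by simpa [← hr] using hr0)
    obtain ⟨w0, hw0⟩ := Finset.card_pos.1 (hcard.symm ▸ hr0)
    obtain ⟨w0, rfl⟩ : ∃ w : Fin n, w0 = w := ⟨⟨w0, targets_lt hw0⟩, rfl⟩
    obtain ⟨g1, g2, g3⟩ := mem_targets.1 hw0
    rw [wp_seq]
    refine wp_count hmain1 hc h8 h9 ⟨w0, g3⟩ ?_
    intro ν2 ρ2 δ ε t2 q2 hν2 h12 ht2 hq2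
    simp only at hν2 h12 ⊢
    rw [hμp] at h12
    have hM : ∀ b, n + 3 ≤ b → Function.update (Function.update s.realMem (n + 1) δ) (n + 2) ε b =
        s.realMem b := fun b hb => by
      rw [Function.update_of_ne (by omega), Function.update_of_ne (by omega)]
    set M := Function.update (Function.update s.realMem (n + 1) δ) (n + 2) ε with hMdef
    have hmain2 : Main K ({ s with natVar := ν2, realVar := ρ2, natMem := μ, realMem := M } : State n)
        F par last p c p :=
      hmain1.congr (fun x hx => hν2 x (by omega) (by omega) (by omega)) (fun _ _ => rfl)
        (fun x hx _ => hM x hx) rfl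
    -- For `n = 1` no query is affordable. A counting query is made only if `σ` has a vertex and
    -- there is a target outside of `σ`, whence `n ≥ 2`.
    have hq2' : q2 ≤ Nat.clog 2 n := by
      rcases hq2 with rfl | ⟨rfl, hne⟩
      · exact Nat.zero_le _
      · refine Nat.clog_pos (by norm_num) ?_
        obtain ⟨v, hv⟩ := Finset.nonempty_iff_ne_empty.2 hne
        have hvw : v ≠ w0 := fun he => (g1.resolve_left hne).1 (he ▸ hv)
        have : v.1 ≠ w0.1 := fun he => hvw (Fin.ext he)
        have := v.2
        have := w0.2
        omega
    rw [wp_ite]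
    constructor
    · intro hN0
      have hN0 : ν2 12 = 0 := by simpa using hN0
      have hU : unknown K (F p) (s.natMem p) = ∅ := Finset.card_eq_zero.1 (h12.symm.trans hN0)
      rw [wp_skip, wp_setNat]
      have hadv := hmain2.advance (by omega) hc (by simp only; rw [hμp, hU])
      have e2 : NatExp.eval ({ s with natVar := ν2, realVar := ρ2, natMem := μ, realMem := M } : State n)
          (.add (.var 2) (.lit 1)) = p + 1 := by
        have := hmain2.h2
        simp only at this
        simp [this]
      rw [e2]
      refine h _ _ _ 0 c F par last hadv le_rfl (fun _ _ => rfl) (Or.inl rfl) ?_ ?_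
      · unfold baseTime
        simp
        omega
      · simpa using hq2'
    · intro hN0
      have hN0 : 0 < ν2 12 := Nat.pos_of_ne_zero (by simpa using hN0)
      have k11 : ν2 11 = r := hν2 11 (by norm_num) (by norm_num) (by norm_num)
      rw [wp_seq]
      refine wp_expand (r := r) (T := T) hmain2 hc
        ((hν2 8 (by norm_num) (by norm_num) (by norm_num)).trans h8)
        ((hν2 9 (by norm_num) (by norm_num) (by norm_num)).trans h9)
        ((hν2 10 (by norm_num) (by norm_num) (by norm_num)).trans h10) k11
        himg hcard h5 (fun w hw => targets_lt hw) ?_ ?_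
      · intro w hw
        obtain ⟨a1, a2, a3⟩ := mem_targets.1 hw
        refine ⟨a1, ?_⟩
        simp only
        rw [hM _ hrb]
        exact a3
      intro s3 t3 e hmain3 hs3p hν3 hbuf himg3 hready hexp hsum ht3
      simp only at hs3p hν3
      rw [hμp] at hs3p
      have hexpN : (K.link (F p)).Nonempty := by
        rw [h12] at hN0
        obtain ⟨w, hw⟩ := Finset.card_pos.1 hN0
        exact ⟨w, (Finset.mem_filter.1 hw).1⟩
      have hmain3' : Main K (s3.setNatVar 13 0) F par last p c p :=
        hmain3.congr (fun x hx => Function.update_of_ne (by omega) _ _) (fun _ _ => rfl)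
          (fun _ _ _ => rfl) rfl
      have hn3 : ∀ x, x ≠ 13 → (s3.setNatVar 13 0).natVar x = s3.natVar x := fun x hx =>
        Function.update_of_ne hx _ _
      refine wp_children (r := r) (N := ν2 12) (F := F) (par := par) (last := last) (p := p) (c := c)
        (o := s3.natMem (s3.natVar 20)) (f := s3.realMem (realBlock n d p)) (t := s3.realMem n) (e := e)
        ?_ (hcard ▸ hrn) ?_
      · exact
          { main := { hmain3' with par_lt := fun k k1 k2 => (hmain3'.par_lt k k1 k2).trans (by omega) }
            lt := hc
            ready :=
              { hready with
                h0 := hmain3'.h0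
                h1 := hmain3'.h1
                h2 := hmain3'.h2
                h5 := hmain3'.h5
                h6 := hmain3'.h6
                h7 := hmain3'.h7
                h8 := (hn3 8 (by norm_num)).trans hready.h8
                h9 := (hn3 9 (by norm_num)).trans hready.h9
                h11 := (hn3 11 (by norm_num)).trans hready.h11
                h19 := hmain3'.h19
                h20 := by rw [hn3 20 (by norm_num)]; rfl }
            buf := by rw [hn3 20 (by norm_num)]; exact hbuf
            expanded := hexp
            sum := hsum
            h12 := by rw [hn3 12 (by norm_num), hν3 12 (by norm_num) (by norm_num)]
            h13 := by simp
            card := by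
              show (unknown K (F p) (s3.natMem p)).card = _
              rw [hs3p, h12]
            place := by
              intro w hw
              have hw : w ∈ unknown K (F p) (s3.natMem p) := hw
              rw [hs3p] at hw
              have := hUT w hw
              rw [← himg3] at this
              obtain ⟨i, hi, hi'⟩ := Finset.mem_image.1 this
              exact ⟨i, Nat.zero_le _, Finset.mem_range.1 hi, hi'⟩
            -- At the empty simplex every target is an unknown cofacet, since every vertex is a
            -- face; so the search never has to ask there.
            query := by
              rcases (F p).eq_empty_or_nonempty with he | hne
              · right
                rw [h12, Nat.sub_zero, ← hcard, ← Finset.card_image_of_injective _ Fin.val_injective]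
                refine Finset.card_le_card fun w hw => ?_
                obtain ⟨w, rfl⟩ : ∃ w' : Fin n, w = w' := ⟨⟨w, targets_lt hw⟩, rfl⟩
                refine Finset.mem_image_of_mem _ (Finset.mem_filter.2 ⟨mem_link.2 ?_, (mem_targets.1 hw).2.1⟩)
                rw [he]
                exact ⟨Finset.notMem_empty _, by simpa using K.vertex_mem w⟩
              · left
                refine hT.face p (lt_of_le_of_ne hp ?_) hc
                rintro rfl
                exact hne.ne_empty hT.root
            -- Vacuous at the start: the simplices found so far have parents before `p`.
            order := fun k k1 k2 k3 => absurd (hmain3.par_lt k k1 k2) (by omega) }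
      · intro s4 t4 q4 c' F' par' last' hmain4 hcc hF hU ht4 hq4
        rw [wp_setNat]
        have hadv := hmain4.advance le_rfl (by omega) hU
        have e2 : NatExp.eval s4 (.add (.var 2) (.lit 1)) = p + 1 := by
          simp [hmain4.h2]
        rw [e2]
        refine h _ _ _ t3 c' F' par' last' hadv hcc hF (Or.inr ⟨hexpN, ht3⟩) ?_ ?_
        · unfold baseTime
          simp
          omega
        · rw [Nat.succ_mul]
          omega

end RealRAM

namespace RealRAM

open ComplexIn

variable {n d : ℕ}

attribute [local simp] NatExp.eval RealExp.eval Test.Holds NatExp.cost RealExp.cost Test.cost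
  State.setNatVar State.setRealVar State.setNatCell State.setRealCell wp_skip wp_setNat wp_setReal
  wp_storeNat wp_storeReal wp_seq

/-! ### The whole program -/

/-- Set the constants and create the table entry of the empty simplex. -/
def initNat : Prog :=
  .seq (.setNat 2 (.lit 10)) <| .seq (.setNat 3 (.lit 11)) <| .seq (.setNat 5 (.var 0)) <|
  .seq (.setNat 6 (.add (.var 0) (.lit 1))) <| .seq (.setNat 7 (.add (.var 0) (.lit 2))) <|
  .seq (.setNat 19 (.add (.var 0) (.var 1))) <| .seq (.setNat 9 (.add (.var 0) (.lit 3))) <|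
  -- The size of the empty simplex in block `1` need not be written, as the memory is zero
  -- initially.
  .seq (.setNat 4 (.add (.var 9) (.add (.var 1) (.lit 1)))) <| .storeNat (.lit 3) (.lit 10) (.var 9)

/-- Set the functionals of the empty simplex: the constant `1` and the coordinates. -/
def initReal : Prog :=
  .seq (forLt 30 0 (.storeReal (.var 9) (.var 30) (.lit 1))) <|
  forLt 31 1 <|
    .seq (.setNat 32 (.add (.add (.var 9) (.lit 1)) (.var 31))) <|
    .seq (forLt 30 0 (.storeReal (.var 32) (.var 30) (.load (.var 30) (.var 31)))) <|
    -- Only the nonzero coefficient is written; the others are zero initially. This keeps the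
    -- preparation at `O(n d)`, without a term in `d ^ 2`.
    .storeReal (.var 32) (.add (.var 0) (.var 31)) (.lit 1)

/-- The real memory after the first `k` coordinates have been set. -/
noncomputable def rootMem (n : ℕ) (M : ℕ → ℕ → ℝ) (k b o : ℕ) : ℝ :=
  if b = n + 3 then if o < n then 1 else M b o
  else if n + 4 ≤ b ∧ b < n + 4 + k then
    if o < n then M o (b - (n + 4)) else if o = n + (b - (n + 4)) then 1 else M b o
  else M b o

theorem wp_initReal {K : ComplexIn (Fin n) d} {s : State n} (h0 : s.natVar 0 = n)
    (h1 : s.natVar 1 = d) (h9 : s.natVar 9 = n + 3) {Post : State n → ℕ → ℕ → Prop}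
    (h : ∀ ν t, (∀ x < 30, ν x = s.natVar x) → t ≤ n * 20 + d * (n * 20 + 50) + 20 →
      Post { s with natVar := ν, realMem := rootMem n s.realMem d } t 0) :
    wp K initReal s Post := by
  set M := s.realMem with hM
  unfold initReal
  rw [wp_seq]
  refine (wp_forLt (by norm_num) 11 (fun k s' => s' = { s with
    natVar := Function.update s.natVar 30 k
    realMem := Function.update M (n + 3) fun o => if o < k then 1 else M (n + 3) o }) ?_ ?_).mono ?_
  · simp [← hM]
  · rintro k s' hk rfl - -
    simp [h9]
    congr 1
    funext o
    by_cases ho : o = k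
    · subst ho; simp
    · rw [Function.update_of_ne ho]
      by_cases h1 : o < k
      · rw [if_pos h1, if_pos (by omega)]
      · rw [if_neg h1, if_neg (by omega)]
  rintro s' t1 q ⟨-, -, rfl, ht1, rfl⟩
  rw [h0] at ht1 ⊢
  refine (wp_forLt (by norm_num) (n * 20 + 40) (fun k s' => ∃ ν, (∀ x < 30, ν x = s.natVar x) ∧
    s' = { s with natVar := ν, realMem := rootMem n M k }) ?_ ?_).mono ?_
  · refine ⟨Function.update (Function.update s.natVar 30 n) 31 0, ?_, ?_⟩
    · intro x hx
      simp [show x ≠ 30 by omega, show x ≠ 31 by omega]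
    · simp
      funext b o
      by_cases hb : b = n + 3
      · subst hb; simp [rootMem]
      · rw [Function.update_of_ne hb, rootMem, if_neg hb, if_neg (by omega)]
  · rintro k s' hk ⟨ν, hν, rfl⟩ h31 -
    have h31 : ν 31 = k := h31
    have m0 : ν 0 = n := by rw [hν 0 (by norm_num), h0]
    have m9 : ν 9 = n + 3 := by rw [hν 9 (by norm_num), h9]
    have hb : n + 3 + 1 + k = n + 4 + k := by omega
    rw [wp_seq, wp_setNat, wp_seq]
    refine (wp_forLt (by norm_num) 11 (fun i s' => s' = { s with
      natVar := Function.update (Function.update ν 32 (n + 4 + k)) 30 i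
      realMem := Function.update (rootMem n M k) (n + 4 + k) fun o => if o < i then M o k else
        M (n + 4 + k) o }) ?_ ?_).mono ?_
    · have : (fun o => M (n + 4 + k) o) = rootMem n M k (n + 4 + k) := by
        funext o
        rw [rootMem, if_neg (by omega), if_neg (by omega)]
      simp [m9, h31, hb]
      rw [this]
    · rintro i s' hi rfl - -
      have hi : i < n := by simpa [m0] using hi
      have hr : rootMem n M k i k = M i k := by
        rw [rootMem, if_neg (by omega), if_neg (by omega)]
      simp [h31, show i ≠ n + 4 + k by omega, hr]
      congr 1
      funext o
      by_cases ho : o = i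
      · subst ho; simp
      · rw [Function.update_of_ne ho]
        by_cases h1 : o < i
        · rw [if_pos h1, if_pos (by omega)]
        · rw [if_neg h1, if_neg (by omega)]
    · rintro s' t q ⟨-, -, rfl, ht, rfl⟩
      simp [m0] at ht
      rw [wp_storeReal]
      refine ⟨?_, ?_, ⟨Function.update (Function.update (Function.update ν 32 (n + 4 + k)) 30 n) 31 (k + 1),
        ?_, ?_⟩, ?_, ?_⟩
      · simp [h31]
      · simp [hν 1]
      · intro x hx
        simp [show x ≠ 30 by omega, show x ≠ 31 by omega, show x ≠ 32 by omega, hν x hx]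
      · simp [m0, h31]
        funext b o
        by_cases hbk : b = n + 4 + k
        · subst hbk
          rw [Function.update_self, rootMem, if_neg (by omega), if_pos (by omega), Nat.add_sub_cancel_left]
          by_cases ho : o = n + k
          · subst ho; simp
          · rw [Function.update_of_ne ho, if_neg ho]
        · rw [Function.update_of_ne hbk, rootMem, rootMem]
          have : (n + 4 ≤ b ∧ b < n + 4 + (k + 1)) ↔ (n + 4 ≤ b ∧ b < n + 4 + k) := by omega
          simp only [this]
      · simp
        omega
      · simp
  · rintro s' t2 q ⟨-, -, ⟨ν, hν, rfl⟩, ht2, rfl⟩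
    simp [h1] at ht2 ⊢
    refine h ν _ hν ?_
    rw [show n * 20 + 40 + 9 = n * 20 + 49 by omega] at ht2
    have : d * (n * 20 + 49) ≤ d * (n * 20 + 50) := Nat.mul_le_mul_left _ (by omega)
    omega

/-- Prepare the reconstruction. -/
def init : Prog := .seq initNat initReal

/-- A bound on the time of the preparation. -/
def initTime (n d : ℕ) : ℕ := n * 20 + d * (n * 20 + 50) + 80

/-- The vertex `v0` is a mere default: the empty simplex has no last vertex. -/
theorem wp_init (K : ComplexIn (Fin n) d) (v0 : Fin n) {Post : State n → ℕ → ℕ → Prop}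
    (h : ∀ s t, Main K s (fun _ => ∅) (fun _ => 0) (fun _ => v0) 10 11 10 → t ≤ initTime n d →
      Post s t 0) :
    wp K init (start K.pos) Post := by
  unfold init initNat
  simp only [wp_seq, wp_setNat, wp_storeNat]
  refine wp_initReal ?_ ?_ ?_ ?_
  · simp [start]
  · simp [start]
  · simp [start]
  intro ν t hν ht
  refine h _ _ ?_ ?_
  rotate_left
  · unfold initTime
    simp
    omega
  have hrb : realBlock n d 10 = n + 3 := by simp [realBlock]
  have hM0 : ∀ b, n ≤ b → ∀ o, (start K.pos).realMem b o = 0 := by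
    intro b hb o
    simp only [start]
    rw [dif_neg (by omega)]
  have hMv : ∀ (v : Fin n) (j : Fin d), (start K.pos).realMem v j = K.pos v j := by
    intro v j
    simp [start]
  have hroot0 : ∀ v : Fin n, rootMem n (start K.pos).realMem d (n + 3) v = 1 := by
    intro v
    rw [rootMem, if_pos rfl, if_pos v.2]
  have hroot1 : ∀ j : Fin d, rootMem n (start K.pos).realMem d (n + 3) (n + j) = 0 := by
    intro j
    rw [rootMem, if_pos rfl, if_neg (by omega), hM0 _ (by omega)]
  constructor
  · simp only; rw [hν 0 (by norm_num)]; simp [start]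
  · simp only; rw [hν 1 (by norm_num)]; simp [start]
  · simp only; rw [hν 2 (by norm_num)]; simp
  · simp only; rw [hν 3 (by norm_num)]; simp
  · simp only; rw [hν 4 (by norm_num)]; simp [start, realBlock]
  · simp only; rw [hν 5 (by norm_num)]; simp [start]
  · simp only; rw [hν 6 (by norm_num)]; simp [start]
  · simp only; rw [hν 7 (by norm_num)]; simp [start]
  · simp only; rw [hν 19 (by norm_num)]; simp [start]
  · refine ⟨by norm_num, rfl, ?_, ?_, ?_, ?_, ?_, ?_, ?_, ?_, ?_, ?_, ?_, ?_, ?_⟩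
    · intros; omega
    · intros; omega
    · intro k h1 h2
      obtain rfl : k = 10 := by omega
      simp [start]
    · intro k h1 h2
      obtain rfl : k = 10 := by omega
      simp [start]
    · simp
    · simp
    · intro k h1 h2 w q hq
      obtain rfl : k = 10 := by omega
      simp [start, hq.symm]
    · intro k hk o
      simp [start, show k ≠ 3 by omega]
    all_goals intros; omega
  · refine ⟨?_, ?_, ?_, ?_, ?_, ?_, ?_, ?_, ?_⟩
    · intro k h1 h2
      obtain rfl : k = 10 := by omega
      rw [hrb]
      refine ⟨1, fun v => ?_⟩
      have e : ∑ j : Fin d, rootMem n (start K.pos).realMem d (n + 3) (n + j) * K.pos v j = 0 :=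
        Finset.sum_eq_zero fun j _ => by rw [hroot1, zero_mul]
      refine (hroot0 v).trans ?_
      have := e
      simp only [State.setNatVar, State.setNatCell] at *
      linarith
    · simp
    · intros; omega
    · intros; omega
    · intros; omega
    · intros; omega
    · intro v
      rw [hrb]
      exact hroot0 v
    · intro j v
      rw [hrb]
      show rootMem n (start K.pos).realMem d (n + 3 + 1 + j) v = _
      rw [rootMem, if_neg (by omega), if_pos (by omega), if_pos v.2,
        show n + 3 + 1 + (j : ℕ) - (n + 4) = j by omega, hMv]
    · intro j hj i hi
      rw [hrb]
      show rootMem n (start K.pos).realMem d (n + 3 + 1 + j) (n + i) = _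
      rw [rootMem, if_neg (by omega), if_pos (by omega), if_neg (by omega),
        show n + 3 + 1 + j - (n + 4) = j by omega, hM0 _ (by omega)]
      simp
  · intro ρ
    simp [start, eq_comm]
    intros; omega
  · norm_num
  · intros; omega
  · intros; omega

/-- The reconstruction of a simplicial complex. -/
def reconstruct : Prog := .seq init (.loop (.natLt (.var 2) (.var 3)) process)

/-- The numbers from `11` on name distinct faces, so the free number stays at most `11` above their
total. -/
theorem Main.card_le {K : ComplexIn (Fin n) d} {s : State n} {F : ℕ → Finset (Fin n)} {par : ℕ → ℕ}
    {last : ℕ → Fin n} {p c b : ℕ} (hs : Main K s F par last p c b) : c ≤ K.faces.card + 11 := by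
  have hT := hs.table
  have h1 : ((Finset.Ioo 10 c).image F).card = (Finset.Ioo 10 c).card := by
    refine Finset.card_image_of_injOn fun k hk k' hk' he => ?_
    simp only [Finset.coe_Ioo, Set.mem_Ioo] at hk hk'
    exact hT.inj k k' hk.1.le hk.2 hk'.1.le hk'.2 he
  have h2 : (Finset.Ioo 10 c).image F ⊆ K.faces := by
    intro τ hτ
    obtain ⟨k, hk, rfl⟩ := Finset.mem_image.1 hτ
    rw [Finset.mem_Ioo] at hk
    exact hT.face k hk.1 hk.2
  have h3 := Finset.card_le_card h2
  rw [h1, Nat.card_Ioo] at h3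
  omega

/-- A simplex with a cofacet has dimension below that of the complex. This is what allows expansions
to be charged to the lower skeleton. -/
theorem mem_skeleton_of_link {K : ComplexIn (Fin n) d} {σ : Finset (Fin n)} (hσ : σ ∈ K.faces)
    (hl : (K.link σ).Nonempty) : σ ∈ K.skeleton ((K.dim : ℤ) - 1) := by
  obtain ⟨w, hw⟩ := hl
  obtain ⟨h1, h2⟩ := mem_link.1 hw
  rw [skeleton, Finset.mem_filter]
  refine ⟨hσ, ?_⟩
  have := Finset.le_sup (f := fun σ : Finset (Fin n) => σ.card - 1) h2
  rw [Finset.card_insert_of_notMem h1] at this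
  have h3 : σ.card ≤ K.dim := this
  omega

/-- The faces that have not been processed and can still cause an expansion. -/
def pending (K : ComplexIn (Fin n) d) (F : ℕ → Finset (Fin n)) (p : ℕ) : Finset (Finset (Fin n)) :=
  K.skeleton ((K.dim : ℤ) - 1) \ (Finset.Ico 10 p).image F

/-- A bound on the time of the reconstruction. -/
def totalTime (K : ComplexIn (Fin n) d) : ℕ :=
  initTime n d + (K.faces.card + 1) * (baseTime n d + 10) + K.faces.card * (childTime n d + 10) +
    expandTime n d 0 + (K.skeleton ((K.dim : ℤ) - 1)).card * expandTime n d 1 + 10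

theorem expandTime_eq {len : ℕ} (h : len ≠ 0) : expandTime n d len = expandTime n d 1 := by
  simp [expandTime, h]

/-- Each simplex is processed once and created once, and each of the two accounts for at most `⌈log₂
n⌉` queries; the additional `1` is for the empty simplex. -/
theorem wp_reconstruct (K : ComplexIn (Fin n) d) (hK : K.Embedded) (v0 : Fin n) :
    wp K reconstruct (start K.pos) fun s t q => s.found = K.faces ∧ t ≤ totalTime K ∧
      q ≤ (2 * K.faces.card + 1) * Nat.clog 2 n := by
  set m := K.faces.card + 11 with hm
  set E0 := expandTime n d 0 with hE0
  set E1 := expandTime n d 1 with hE1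
  set G := childTime n d + 10 with hG
  set B := baseTime n d + 10 with hB
  unfold reconstruct
  rw [wp_seq]
  refine wp_init K v0 fun s t1 hs ht1 => ?_
  -- The budget pays `B` for every number still to be processed, `G` for every simplex still to be
  -- created, `E0` for the expansion of the empty simplex, and `E1` for every pending face.
  refine (wp_loop (fun s' φ ψ => ∃ F par last p c, Main K s' F par last p c p ∧ p ≤ c ∧
    φ = (m - p) * B + (m - c) * G + (if p = 10 then E0 else 0) + (pending K F p).card * E1 ∧
    ψ = ((m - p) + (m - c)) * Nat.clog 2 n) ?_
    (φ := (m - 10) * B + (m - 11) * G + E0 + (K.skeleton ((K.dim : ℤ) - 1)).card * E1)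
    (ψ := ((m - 10) + (m - 11)) * Nat.clog 2 n) ?_).mono ?_
  · rintro s' φ ψ ⟨F, par, last, p, c, hs', hpc, rfl, rfl⟩ hc
    have hc : p < c := by simpa [hs'.h2, hs'.h3] using hc
    have hT := hs'.table
    have hp := hs'.ten_le
    refine wp_process hK hs' hc ?_
    intro s2 t q x c' F' par' last' hs2 hcc hF hx ht hq
    have hcm := hs2.card_le
    refine ⟨_, _, ⟨F', par', last', p + 1, c', hs2, by omega, rfl, rfl⟩, ?_, ?_⟩
    · have hsub : pending K F' (p + 1) ⊆ pending K F p := by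
        refine Finset.sdiff_subset_sdiff le_rfl fun τ hτ => ?_
        obtain ⟨k, hk, rfl⟩ := Finset.mem_image.1 hτ
        rw [Finset.mem_Ico] at hk
        rw [← hF k (by omega)]
        exact Finset.mem_image_of_mem _ (Finset.mem_Ico.2 ⟨hk.1, by omega⟩)
      have hpot : x + (if p + 1 = 10 then E0 else 0) + (pending K F' (p + 1)).card * E1 ≤
          (if p = 10 then E0 else 0) + (pending K F p).card * E1 := by
        have hle := Nat.mul_le_mul_right E1 (Finset.card_le_card hsub)
        rw [if_neg (by omega)]
        rcases hx with rfl | ⟨hlink, hx⟩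
        · omega
        · by_cases hp10 : p = 10
          · subst hp10
            rw [hT.root, Finset.card_empty] at hx
            rw [if_pos rfl]
            omega
          · have hne := hT.nonempty (by omega : 10 < p) hc
            rw [expandTime_eq (Finset.card_pos.2 hne).ne'] at hx
            -- An expanded simplex has a cofacet, so it lies in the lower skeleton; it leaves the
            -- pending set now and pays for its expansion.
            have hlt : pending K F' (p + 1) ⊂ pending K F p := by
              refine hsub.ssubset_of_ne fun he => ?_
              have h1 : F p ∈ pending K F p := by
                refine Finset.mem_sdiff.2 ⟨mem_skeleton_of_link (hT.face p (by omega) hc) hlink, fun hk => ?_⟩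
                obtain ⟨k, hk, he⟩ := Finset.mem_image.1 hk
                rw [Finset.mem_Ico] at hk
                have := hT.inj k p hk.1 (by omega) hp hc he
                omega
              rw [← he, pending, Finset.mem_sdiff] at h1
              exact h1.2 (Finset.mem_image.2 ⟨p, Finset.mem_Ico.2 ⟨hp, by omega⟩, hF p hc⟩)
            have := Nat.mul_le_mul_right E1 (Nat.succ_le_of_lt (Finset.card_lt_card hlt))
            rw [Nat.succ_mul] at this
            omega
      obtain ⟨a, ha⟩ : ∃ a, m - p = a + 1 := ⟨m - p - 1, by omega⟩
      have ha' : m - (p + 1) = a := by omega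
      obtain ⟨e, he⟩ : ∃ e, c' = c + e := ⟨c' - c, by omega⟩
      have he' : m - c = (m - c') + e := by omega
      have he2 : c' - c = e := by omega
      rw [ha', ha, he', Nat.succ_mul, Nat.add_mul]
      rw [he2, ← hG] at ht
      simp only [Test.cost, NatExp.cost]
      omega
    · obtain ⟨a, ha⟩ : ∃ a, m - p = a + 1 := ⟨m - p - 1, by omega⟩
      have ha' : m - (p + 1) = a := by omega
      rw [ha', ha]
      have : a + 1 + (m - c) = a + (m - c') + (c' - c + 1) := by omega
      rw [this, Nat.add_mul (a + (m - c'))]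
      omega
  · refine ⟨_, _, _, 10, 11, hs, by norm_num, ?_, rfl⟩
    simp [pending]
  · rintro s' t q ⟨φ, ψ, ⟨F, par, last, p, c, hs', hpc, rfl, rfl⟩, hc, ht, hq⟩
    have hc : c ≤ p := by simpa [hs'.h2, hs'.h3] using hc
    have hT := hs'.table
    refine ⟨?_, ?_, ?_⟩
    · ext τ
      rw [hs'.found]
      constructor
      · rintro (⟨v, rfl⟩ | ⟨k, k1, k2, rfl⟩)
        · exact K.vertex_mem v
        · exact hT.face k k1 k2
      · intro hτ
        exact Or.inr (hT.complete hs'.done (m := τ.card) (fun q _ h _ => by omega) hτ le_rfl)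
    · have h1 : m - 10 = K.faces.card + 1 := by omega
      have h2 : m - 11 = K.faces.card := by omega
      rw [h1, h2] at ht
      simp only [Test.cost, NatExp.cost] at ht
      unfold totalTime
      rw [← hE0, ← hE1, ← hG, ← hB]
      omega
    · have h1 : m - 10 + (m - 11) = 2 * K.faces.card + 1 := by omega
      rw [h1] at hq
      omega

/-! ### The running time -/

/-- For `n ≥ 2` the rounded-up binary logarithm is at most `1 + log n / log 2 ≤ 2 log n / log 2`,
and `2 / log 2 < 3`. For smaller `n` both sides vanish. -/
theorem clog_le_log (n : ℕ) : (Nat.clog 2 n : ℝ) ≤ 3 * Real.log n := by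
  rcases Nat.lt_or_ge n 2 with h | h
  · rw [Nat.clog_of_right_le_one (by omega)]
    have : 0 ≤ Real.log n := Real.log_natCast_nonneg n
    push_cast
    linarith
  · have h1 : 2 ^ (Nat.clog 2 n - 1) < n := Nat.pow_pred_clog_lt_self (by norm_num) (by omega)
    have h2 : ((2 : ℝ) ^ (Nat.clog 2 n - 1)) ≤ n := by exact_mod_cast h1.le
    have h3 := Real.log_le_log (by positivity) h2
    rw [Real.log_pow] at h3
    have h4 : 0 < Nat.clog 2 n := Nat.clog_pos (by norm_num) h
    have h5 : ((Nat.clog 2 n - 1 : ℕ) : ℝ) = (Nat.clog 2 n : ℝ) - 1 := by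
      rw [Nat.cast_sub h4, Nat.cast_one]
    rw [h5] at h3
    have h6 : Real.log 2 ≤ Real.log n := Real.log_le_log (by norm_num) (by exact_mod_cast h)
    have h7 := Real.log_two_gt_d9
    have h8 : (1 : ℝ) ≤ Nat.clog 2 n := by exact_mod_cast h4
    nlinarith

/-- Only an expansion of a nonempty simplex leaves a term `d * d`, which goes into `d ^ 3`; all else
is absorbed by `n d + n log n`. As the skeleton has at most `f` elements, the rest of its expansions
is covered by `f * X`. -/
theorem totalTime_le {K : ComplexIn (Fin n) d} (hn : 1 ≤ n) (hd : 1 ≤ d) (hK : 1 ≤ K.faces.card) :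
    totalTime K ≤ 10000 * (K.faces.card * (n * d + n * Nat.clog 2 n) +
      (K.skeleton ((K.dim : ℤ) - 1)).card * d ^ 3) := by
  set c := Nat.clog 2 n with hc
  set S := (K.skeleton ((K.dim : ℤ) - 1)).card with hS
  set f := K.faces.card with hf
  have hSf : S ≤ f := Finset.card_filter_le _ _
  have hcn : c ≤ n := Nat.clog_le_of_le_pow (Nat.lt_two_pow_self).le
  set X := n * d + n * c with hX
  have b1 : n ≤ n * d := Nat.le_mul_of_pos_right _ hd
  have b2 : d ≤ n * d := Nat.le_mul_of_pos_left _ hn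
  -- The `log n` queries per simplex cost `d` steps each for the direction; `log n ≤ n` hides this
  -- in `n d`.
  have b3 : c * d ≤ n * d := Nat.mul_le_mul_right _ hcn
  have b4 : d * d ≤ d ^ 3 := by
    rw [← pow_two]
    exact Nat.pow_le_pow_right hd (by norm_num)
  have b5 : n * c = c * n := mul_comm _ _
  have e1 : initTime n d ≤ 200 * X := by
    have : initTime n d = n * 20 + 20 * (n * d) + 50 * d + 80 := by unfold initTime; ring
    omega
  have e2 : baseTime n d + 10 ≤ 800 * X := by
    unfold baseTime
    omega
  have e3 : childTime n d + 10 ≤ 1000 * X := by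
    have : childTime n d = 100 * (c * n) + 100 * (c * d) + 130 * c + 80 * (n + d) + 130 := by
      unfold childTime; ring
    omega
  have e4 : expandTime n d 0 ≤ 1500 * X := by
    have : expandTime n d 0 = 250 * (c * n) + 60 * c + 60 * (n * d) + 80 * (n * d) + 120 * n +
        21 * (n * d) + 60 * d + 20 * (n + d) + 300 := by
      simp only [expandTime, if_true]; ring
    omega
  have e5 : expandTime n d 1 ≤ 1500 * X + 50 * d ^ 3 := by
    have : expandTime n d 1 = 250 * (c * n) + 60 * c + 60 * (n * d) + 80 * (n * d) + 120 * n +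
        42 * (n * d) + 42 * (d * d) + 110 * d + 20 * (n + d) + 300 := by
      simp only [expandTime, one_ne_zero, if_false]; ring
    omega
  have g1 := Nat.mul_le_mul_left (f + 1) e2
  have g2 := Nat.mul_le_mul_left f e3
  have g3 := Nat.mul_le_mul_left S e5
  have g4 := Nat.mul_le_mul_right X hSf
  have g5 := Nat.mul_le_mul_right X hK
  have i1 : (f + 1) * (800 * X) = 800 * (f * X) + 800 * X := by ring
  have i2 : f * (1000 * X) = 1000 * (f * X) := by ring
  have i3 : S * (1500 * X + 50 * d ^ 3) = 1500 * (S * X) + 50 * (S * d ^ 3) := by ring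
  have i4 : 1 ≤ X := by omega
  unfold totalTime
  rw [← hf, ← hS]
  omega

end RealRAM

/-- There is one real-RAM program that, for all `d ≥ 1`, reconstructs every nonempty embedded
simplicial complex `K` in `ℝ^d` from its vertices (numbered in any order), with the stated number of
indegree queries and the stated running time when every indegree query takes time `I`. -/
theorem mainTheorem3 :
    ∃ (P : RealRAM.Prog) (C : ℝ), ∀ (d n : ℕ), 1 ≤ d → 1 ≤ n →
      ∀ K : ComplexIn (Fin n) d, K.Embedded →
        ∃ (s : RealRAM.State n) (steps queries : ℕ),
          RealRAM.Exec K P (RealRAM.start K.pos) s steps queries ∧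
          s.found = K.faces ∧
          (queries : ℝ) ≤ C * (K.faces.card * Real.log n) ∧
          ∀ I : ℝ, 0 ≤ I →
            (steps : ℝ) + queries * I ≤
              C * (K.faces.card * (n * d + n * Real.log n + I * Real.log n) +
                (K.skeleton ((K.dim : ℤ) - 1)).card * (d : ℝ) ^ 3) := by
  -- The constant is 3 times that of `totalTime_le`, the factor 3 being the price of natural
  -- logarithms.
  refine ⟨RealRAM.reconstruct, 30000, fun d n hd hn K hK => ?_⟩
  obtain ⟨s, t, q, hexec, hfound, ht, hq⟩ := RealRAM.wp_reconstruct K hK ⟨0, hn⟩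
  have hf : 1 ≤ K.faces.card := Finset.card_pos.2 ⟨_, K.vertex_mem ⟨0, hn⟩⟩
  have hfR : (1 : ℝ) ≤ K.faces.card := by exact_mod_cast hf
  have hL : 0 ≤ Real.log n := Real.log_natCast_nonneg n
  have hc := RealRAM.clog_le_log n
  -- One factor 3 bounds `2 |K| + 1` by `3 |K|`, the other comes from the change of logarithm.
  have hq' : (q : ℝ) ≤ 9 * (K.faces.card * Real.log n) := by
    have h1 : (q : ℝ) ≤ (2 * K.faces.card + 1) * Nat.clog 2 n := by exact_mod_cast hq
    have h2 : (2 * (K.faces.card : ℝ) + 1) * Nat.clog 2 n ≤ (3 * K.faces.card) * (3 * Real.log n) :=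
      mul_le_mul (by linarith) hc (Nat.cast_nonneg _) (by linarith)
    linarith
  have ht' : (t : ℝ) ≤ 30000 * (K.faces.card * (n * d + n * Real.log n) +
      (K.skeleton ((K.dim : ℤ) - 1)).card * (d : ℝ) ^ 3) := by
    have h1 : (t : ℝ) ≤ 10000 * (K.faces.card * (n * d + n * Nat.clog 2 n) +
        (K.skeleton ((K.dim : ℤ) - 1)).card * (d : ℝ) ^ 3) := by
      exact_mod_cast ht.trans (RealRAM.totalTime_le hn hd hf)
    have h2 : (n : ℝ) * Nat.clog 2 n ≤ n * (3 * Real.log n) :=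
      mul_le_mul_of_nonneg_left hc (Nat.cast_nonneg _)
    have h3 : (0 : ℝ) ≤ n * d := by positivity
    have h4 : (K.faces.card : ℝ) * (n * d + n * Nat.clog 2 n) ≤
        K.faces.card * (3 * (n * d + n * Real.log n)) :=
      mul_le_mul_of_nonneg_left (by linarith) (by linarith)
    have h5 : (0 : ℝ) ≤ (K.skeleton ((K.dim : ℤ) - 1)).card * (d : ℝ) ^ 3 := by positivity
    linarith
  have hX : (0 : ℝ) ≤ K.faces.card * Real.log n := mul_nonneg (by linarith) hL
  refine ⟨s, t, q, hexec, hfound, by linarith, fun I hI => ?_⟩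
  have h1 := mul_le_mul_of_nonneg_right hq' hI
  have h2 := mul_nonneg hX hI
  linarith
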